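/- **Setting.** Let $\mu_1\perp\mu_2\in\mathbb R^d$ (strong and weak feature), $p\in(0,\tfrac12)$, $\sigma_p,\sigma_0,\eta>0$, $\delta,\delta'\in(0,1)$. A data point has a Rademacher label $y\in\{\pm1\}$ and two patches $(y\mu_l,\xi)$, where independently $l=1$ with probability $1-p$, $l=2$ with probability $p$, and $\xi\sim N(0,\sigma_p^2I_d)$. The initial labelled set consists of $n_0$ such points $(y_i\mu_{l_i},\xi_i)$, the pool $\mathcal P$ of $|\mathcal P|$ further ones; all points are independent of each other and of the initial weights $w^{(0)}_{j,r}\sim N(0,\sigma_0^2I_d)$ i.i.d., $j\in\{\pm1\}$, $1\le r\le m$. The network is $f(W,x)=\sum_{j=\pm1}\frac jm\sum_{r=1}^m\sum_{k=1}^2\sigma(\langle w_{j,r},x_k\rangle)$ with the ReLU $\sigma$ (and $\sigma'(0)=1$), and $W^{(t)}$ is obtained from $W^{(0)}$ by $t$ steps of gradient descent with learning rate $\eta$ on $\frac1{n_0}\sum_i\log(1+e^{-y_if(W,x^{(i)})})$ over the initial labelled set. The coefficients $\gamma^{(t)}_{j,r,l},\rho^{(t)}_{j,r,i}$ are those of the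 signal-noise decomposition $$w^{(t)}_{j,r}=w^{(0)}_{j,r}+j\sum_{l=1}^2\gamma^{(t)}_{j,r,l}\frac{\mu_l}{\|\mu_l\|^2}+\sum_{i=1}^{n_0}\rho^{(t)}_{j,r,i}\frac{\xi_i}{\|\xi_i\|^2},$$ and $\bar\gamma^{(t)}_l=\frac1{2m}\sum_{j,r}\gamma^{(t)}_{j,r,l}$. Uncertainty Sampling queries $n^*$ pool samples of lowest confidence $\max\{s,1-s\}$, $s=1/(1+e^{-yf(W^{(t)},x)})$. Diversity Sampling with exponent $q\in[1,\infty)$ queries $n^*$ pool samples of largest $\ell_q$ distance $\|Z(x)-\frac1{n_0}\sum_iZ(x^{(i)})\|_q$, where $Z(x)\in\mathbb R^m$, $Z_r(x)=\sum_j\sum_k\sigma(\langle w_{j,r}^{(t)},x_k\rangle)$. Ties are broken arbitrarily. **Proposition (Querying Stage).** For all $K,\kappa,c>0$ there is $C>0$ such that the following holds for all parameters $d,m,n_0\ge1$, $n^*,\tilde n$ with $n_0+n^*\le\tilde n$, and $T^*\ge3$ that satisfy, for $l=1,2$: * (feature norms) $\|\mu_l\|^2\ge C\sigma_p^2\log(n_0/\delta)$,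 $\ \|\mu_1\|^4\ge K^{-1}\sigma_p^4d/n_0$, $\ \|\mu_2\|^4\le K\sigma_p^4d/n_0$; * (sizes) $n_0\ge C\log(m/\delta)$, $\ n_0\ge Cp^{-1}\log(1/\delta)$, $\ \tilde n\le Kp^{-1}\sigma_p^4d\|\mu_2\|^{-4}$, $\ m\ge C\log(n_0/\delta)$; * (dimension) $d\ge C\tilde n\sigma_p^{-2}\|\mu_l\|^2\log T^*$, $\ d\ge C\tilde n^2\log(\tilde nm/\delta)(\log T^*)^2$; * (initialization and learning rate) $\sigma_0\le C^{-1}\|\mu_l\|^{-1}(\log(m/\delta))^{-1/2}$, $\ \sigma_0\le C^{-1}\sigma_p^{-1}d^{-1}n_0^{1/2}$, $\ \eta\le C^{-1}\sigma_p^{-2}d^{-1}\tilde n$, $\ \eta\le C^{-1}\sigma_p^{-2}d^{-3/2}\tilde n^2m(\log(\tilde n/\delta))^{1/2}$; * (pool) $|\mathcal P|\ge Cp^{-1}\sigma_p^4d\|\mu_2\|^{-4}$, $\ |\mathcal P|\ge Cp^{-1}\log(1/\delta)$, $\ |\mathcal P|\le(m/\delta')^{\kappa}$; * (gap) $\|\mu_1\|^2-\|\mu_2\|^2\ge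 C\sigma_p^2\big(d\,n_0^{-1}\log(m/\delta')\big)^{1/2}$. Let the querying time $t$ be any number of gradient steps, deterministic or a measurable function of the initial weights and the initial labelled set, with $c\,\eta^{-1}n_0m\sigma_p^{-2}d^{-1}\le t\le T^*$. Then with probability at least $1-C(\delta+\delta')$ all of the following hold at time $t$: the signal-noise coefficients exist and are unique; $\bar\gamma^{(t)}_2<\bar\gamma^{(t)}_1$; the pool contains at least $p|\mathcal P|/2$ weak-feature samples; and every set of $n^*$ samples queried by Uncertainty Sampling, or by Diversity Sampling for any $q\in[1,\infty)$, consists of $n^*$ pool samples with the lowest values of the average feature-learning coefficient $\bar\gamma^{(t)}_l$ ($l$ being the feature of the sample), all of which are weak-feature ($\mu_2$) samples provided that the pool contains at least $n^*$ weak-feature samples. -/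

import Mathlib

open MeasureTheory ProbabilityTheory

noncomputable section

namespace ActiveLearning

/-- The ambient space `ℝ^d` with its Euclidean norm. -/
abbrev Vec (d : ℕ) := EuclideanSpace ℝ (Fin d)

/-- The signs `±1`, encoded by `Bool`: `true` is `+1` and `false` is `-1`. -/
def sgn (b : Bool) : ℝ := if b then 1 else -1

/-- A labelled data point `(y, l, ξ)`: the label `y`, the index `l` of its feature
(`0` is the strong feature, `1` is the weak feature) and the noise patch `ξ`. -/
abbrev Sample (d : ℕ) := Bool × Fin 2 × Vec d

namespace Sample

variable {d : ℕ}

/-- The label `y`. -/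
def label (x : Sample d) : Bool := x.1

/-- The index of the feature contained in the sample. -/
def feature (x : Sample d) : Fin 2 := x.2.1

/-- The noise patch. -/
def noise (x : Sample d) : Vec d := x.2.2

/-- The two patches `(y • μ_l, ξ)` seen by the network (which is symmetric in the patches). -/
def patch (μ : Fin 2 → Vec d) (x : Sample d) : Fin 2 → Vec d :=
  ![sgn x.label • μ x.feature, x.noise]

end Sample

/-- The centred Gaussian law on `ℝ^d` with covariance `s ^ 2 • I`. -/
def gaussianNoise (d : ℕ) (s : ℝ) : Measure (Vec d) :=
  (stdGaussian (Vec d)).map (fun z => s • z)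

/-- The Rademacher law on signs. -/
def rademacher : Measure Bool :=
  ENNReal.ofReal (1 / 2) • Measure.dirac true + ENNReal.ofReal (1 / 2) • Measure.dirac false

/-- The law of the feature index: strong with probability `1 - p`, weak with probability `p`. -/
def featureLaw (p : ℝ) : Measure (Fin 2) :=
  ENNReal.ofReal (1 - p) • Measure.dirac 0 + ENNReal.ofReal p • Measure.dirac 1

/-- The data distribution: independent label, feature index and noise patch. -/
def dataLaw (d : ℕ) (p σp : ℝ) : Measure (Sample d) :=
  rademacher.prod ((featureLaw p).prod (gaussianNoise d σp))

/-- The first-layer weights `w_{j,r}`, with `j = ±1` and `r` ranging over `m` neurons. -/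
abbrev Weights (m d : ℕ) := Bool → Fin m → Vec d

/-- Gaussian initialization: all entries are i.i.d. `N(0, σ0 ^ 2)`. -/
def initLaw (m d : ℕ) (σ0 : ℝ) : Measure (Weights m d) :=
  Measure.pi fun _ => Measure.pi fun _ => gaussianNoise d σ0

/-- What the training algorithm sees: the initial weights and the initial labelled set. -/
abbrev TrainData (m d n : ℕ) := Weights m d × (Fin n → Sample d)

/-- The joint law of the initial weights, the labelled set of size `n` and the pool of size `N`;
all of them are independent, and all data points have law `dataLaw`. -/
def experimentLaw (m d n N : ℕ) (p σp σ0 : ℝ) :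
    Measure (TrainData m d n × (Fin N → Sample d)) :=
  ((initLaw m d σ0).prod (Measure.pi fun _ => dataLaw d p σp)).prod
    (Measure.pi fun _ => dataLaw d p σp)

/-- The ReLU activation. -/
def relu (z : ℝ) : ℝ := max z 0

/-- The derivative of the ReLU, with the convention that its value at `0` is `1`. -/
def reluDeriv (z : ℝ) : ℝ := if 0 ≤ z then 1 else 0

/-- The logistic loss `ℓ(z) = log (1 + exp (-z))`. -/
def logisticLoss (z : ℝ) : ℝ := Real.log (1 + Real.exp (-z))

section Network

variable {m d n : ℕ}

/-- The partial network `F_j`. -/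
def partialNet (W : Weights m d) (j : Bool) (x : Fin 2 → Vec d) : ℝ :=
  (1 / (m : ℝ)) * ∑ r : Fin m, ∑ k : Fin 2, relu (inner ℝ (W j r) (x k))

/-- The two-layer ReLU CNN `f = F_{+1} - F_{-1}`. -/
def net (W : Weights m d) (x : Fin 2 → Vec d) : ℝ :=
  ∑ j : Bool, sgn j * partialNet W j x

/-- One step of gradient descent, with step size `η`, for the empirical logistic loss
`(1 / n) ∑ i, ℓ (y i * f (W, x i))`. -/
def gdStep (μ : Fin 2 → Vec d) (η : ℝ) (S : Fin n → Sample d) (W : Weights m d) :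
    Weights m d :=
  fun j r => W j r - (η / (n * m : ℝ)) •
    ∑ i : Fin n,
      (deriv logisticLoss (sgn (S i).label * net W ((S i).patch μ)) *
          (sgn j * sgn (S i).label)) •
        ∑ k : Fin 2, reluDeriv (inner ℝ (W j r) ((S i).patch μ k)) • (S i).patch μ k

/-- The weights after `t` steps of gradient descent on the labelled set `S` from `W0`. -/
def gdIter (μ : Fin 2 → Vec d) (η : ℝ) (S : Fin n → Sample d) (W0 : Weights m d) :
    ℕ → Weights m d
  | 0 => W0
  | t + 1 => gdStep μ η S (gdIter μ η S W0 t)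

/-- `(γ, ρ)` are coefficients of a signal-noise decomposition of the weights `W`:
`w_{j,r} = w0_{j,r} + j ∑_l γ_{j,r,l} μ_l / ‖μ_l‖² + ∑_i ρ_{j,r,i} ξ_i / ‖ξ_i‖²`. -/
def IsSignalNoiseDecomp (μ : Fin 2 → Vec d) (S : Fin n → Sample d) (W0 W : Weights m d)
    (c : (Bool → Fin m → Fin 2 → ℝ) × (Bool → Fin m → Fin n → ℝ)) : Prop :=
  ∀ j r, W j r = W0 j r
    + sgn j • ∑ l : Fin 2, (c.1 j r l / ‖μ l‖ ^ 2) • μ l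
    + ∑ i : Fin n, (c.2 j r i / ‖(S i).noise‖ ^ 2) • (S i).noise

/-- The average over `j = ±1` and `r` of the feature-learning coefficients of the feature `l`. -/
def avgCoeff (γ : Bool → Fin m → Fin 2 → ℝ) (l : Fin 2) : ℝ :=
  (1 / (2 * m : ℝ)) * ∑ j : Bool, ∑ r : Fin m, γ j r l

/-- The confidence score of the network on a sample. -/
def confidence (μ : Fin 2 → Vec d) (W : Weights m d) (x : Sample d) : ℝ :=
  max (1 / (1 + Real.exp (-(sgn x.label * net W (x.patch μ)))))
    (1 - 1 / (1 + Real.exp (-(sgn x.label * net W (x.patch μ)))))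

/-- The feature map of a sample, a vector of length `m`. -/
def featureMap (μ : Fin 2 → Vec d) (W : Weights m d) (x : Sample d) (r : Fin m) : ℝ :=
  ∑ j : Bool, ∑ k : Fin 2, relu (inner ℝ (W j r) (x.patch μ k))

/-- The `ℓ_q` distance between the feature map of `x` and the mean feature map of the labelled
set `S`. -/
def featureDist (μ : Fin 2 → Vec d) (q : ℝ) (W : Weights m d) (S : Fin n → Sample d)
    (x : Sample d) : ℝ :=
  (∑ r : Fin m,
    |featureMap μ W x r - (1 / (n : ℝ)) * ∑ i : Fin n, featureMap μ W (S i) r| ^ q) ^ (1 / q)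

end Network

/-- `Q` is a possible choice of the `k` members of a family with the lowest scores
(ties may be broken in any way). -/
def IsLowest {N : ℕ} (score : Fin N → ℝ) (k : ℕ) (Q : Finset (Fin N)) : Prop :=
  Q.card = k ∧ ∀ a ∈ Q, ∀ b ∉ Q, score a ≤ score b

/-- `Q` may be queried by Uncertainty Sampling: the `k` pool samples of lowest confidence. -/
def UncertaintyQuery {m d N : ℕ} (μ : Fin 2 → Vec d) (W : Weights m d)
    (P : Fin N → Sample d) (k : ℕ) (Q : Finset (Fin N)) : Prop :=
  IsLowest (fun a => confidence μ W (P a)) k Q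

/-- `Q` may be queried by Diversity Sampling with the `ℓ_q` distance: the `k` pool samples of
largest feature distance to the labelled set. -/
def DiversityQuery {m d n N : ℕ} (μ : Fin 2 → Vec d) (q : ℝ) (W : Weights m d)
    (S : Fin n → Sample d) (P : Fin N → Sample d) (k : ℕ) (Q : Finset (Fin N)) : Prop :=
  IsLowest (fun a => -featureDist μ q W S (P a)) k Q

/-- The pool samples which contain the weak feature. -/
def weakSamples {d N : ℕ} (P : Fin N → Sample d) : Finset (Fin N) :=
  Finset.univ.filter fun a => (P a).feature = 1

/-- The event of the querying stage, for weights `W` obtained by training on `S` from `W0`: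
the signal-noise coefficients of `W` exist and are unique, the weak feature has the strictly lower
average coefficient, at least `p N / 2` pool samples are weak, and every set of `k` samples queried
by Uncertainty Sampling, or by Diversity Sampling for any `ℓ_q` distance with `1 ≤ q < ∞`, consists
of `k` pool samples of lowest average coefficient, all of them weak as long as the pool contains
`k` weak samples. -/
def QueryingEvent {m d n N : ℕ} (μ : Fin 2 → Vec d) (p : ℝ) (k : ℕ)
    (W0 W : Weights m d) (S : Fin n → Sample d) (P : Fin N → Sample d) : Prop :=
  (∃! c, IsSignalNoiseDecomp μ S W0 W c) ∧
  p * N / 2 ≤ ((weakSamples P).card : ℝ) ∧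
  ∀ γ ρ, IsSignalNoiseDecomp μ S W0 W (γ, ρ) →
    avgCoeff γ 1 < avgCoeff γ 0 ∧
    ∀ Q : Finset (Fin N),
      (UncertaintyQuery μ W P k Q ∨ ∃ q : ℝ, 1 ≤ q ∧ DiversityQuery μ q W S P k Q) →
        IsLowest (fun a => avgCoeff γ (P a).feature) k Q ∧
        (k ≤ (weakSamples P).card → Q ⊆ weakSamples P)

/-- The parameters of the problem. -/
structure Params where
  /-- dimension of a patch -/
  d : ℕ
  /-- number of neurons of each sign -/
  m : ℕ
  /-- size of the initial labelled set -/
  n0 : ℕ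
  /-- number of queried samples -/
  nstar : ℕ
  /-- maximal size of the labelled set after querying -/
  ntilde : ℕ
  /-- size of the sampling pool -/
  N : ℕ
  /-- the strong feature `μ 0` and the weak feature `μ 1` -/
  μ : Fin 2 → Vec d
  /-- probability of the weak feature -/
  p : ℝ
  /-- standard deviation of the noise patch -/
  σp : ℝ
  /-- standard deviation of the initial weights -/
  σ0 : ℝ
  /-- learning rate -/
  η : ℝ
  /-- maximal admissible number of iterations -/
  Tstar : ℝ
  δ : ℝ
  δ' : ℝ

/-- The basic ranges of the parameters. -/
structure Params.Basic (θ : Params) : Prop where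
  m_pos : 0 < θ.m
  n0_pos : 0 < θ.n0
  sizes : θ.n0 + θ.nstar ≤ θ.ntilde
  orthogonal : inner ℝ (θ.μ 0) (θ.μ 1) = 0
  p_pos : 0 < θ.p
  p_lt : θ.p < 1 / 2
  σp_pos : 0 < θ.σp
  σ0_pos : 0 < θ.σ0
  η_pos : 0 < θ.η
  Tstar_ge : 3 ≤ θ.Tstar
  δ_pos : 0 < θ.δ
  δ_lt : θ.δ < 1
  δ'_pos : 0 < θ.δ'
  δ'_lt : θ.δ' < 1

/-- The conditions on the feature norms: `K` is the constant of the order relations which hold with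
some constant, and `C` is the (large) constant of the other ones. -/
structure Params.FeatureNorms (θ : Params) (K C : ℝ) : Prop where
  norm_sq_ge : ∀ l, C * (θ.σp ^ 2 * Real.log (θ.n0 / θ.δ)) ≤ ‖θ.μ l‖ ^ 2
  strong : K⁻¹ * (θ.σp ^ 4 * θ.d / θ.n0) ≤ ‖θ.μ 0‖ ^ 4
  weak : ‖θ.μ 1‖ ^ 4 ≤ K * (θ.σp ^ 4 * θ.d / θ.n0)

/-- The conditions on the sizes, the dimension, the initialization and the learning rate. -/
structure Params.Training (θ : Params) (K C : ℝ) : Prop where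
  n0_ge_log : C * Real.log (θ.m / θ.δ) ≤ θ.n0
  n0_ge_p : C * (θ.p⁻¹ * Real.log (1 / θ.δ)) ≤ θ.n0
  ntilde_le : (θ.ntilde : ℝ) ≤ K * (θ.p⁻¹ * θ.σp ^ 4 * θ.d / ‖θ.μ 1‖ ^ 4)
  m_ge : C * Real.log (θ.n0 / θ.δ) ≤ θ.m
  d_ge_norm : ∀ l, C * (θ.ntilde * ‖θ.μ l‖ ^ 2 / θ.σp ^ 2 * Real.log θ.Tstar) ≤ θ.d
  d_ge_sq : C * (θ.ntilde ^ 2 * Real.log (θ.ntilde * θ.m / θ.δ) * Real.log θ.Tstar ^ 2) ≤ θ.d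
  σ0_le_norm : ∀ l, θ.σ0 ≤ C⁻¹ * (1 / (‖θ.μ l‖ * Real.sqrt (Real.log (θ.m / θ.δ))))
  σ0_le_d : θ.σ0 ≤ C⁻¹ * (Real.sqrt θ.n0 / (θ.σp * θ.d))
  η_le : θ.η ≤ C⁻¹ * (θ.ntilde / (θ.σp ^ 2 * θ.d))
  η_le' : θ.η ≤ C⁻¹ * (θ.ntilde ^ 2 * θ.m * Real.sqrt (Real.log (θ.ntilde / θ.δ)) /
    (θ.σp ^ 2 * (θ.d * Real.sqrt θ.d)))

/-- The conditions on the size of the pool, which is moreover at most polynomial, with exponent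
`κ`, in `m / δ'`. -/
structure Params.Pool (θ : Params) (κ C : ℝ) : Prop where
  ge_norm : C * (θ.p⁻¹ * θ.σp ^ 4 * θ.d / ‖θ.μ 1‖ ^ 4) ≤ θ.N
  ge_log : C * (θ.p⁻¹ * Real.log (1 / θ.δ)) ≤ θ.N
  le_poly : (θ.N : ℝ) ≤ (θ.m / θ.δ') ^ κ

/-- The gap between the feature norms. -/
def Params.NormGap (θ : Params) (C : ℝ) : Prop :=
  C * (θ.σp ^ 2 * Real.sqrt (θ.d / θ.n0 * Real.log (θ.m / θ.δ'))) ≤ ‖θ.μ 0‖ ^ 2 - ‖θ.μ 1‖ ^ 2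

end ActiveLearning

end

/-! Write `μ 0` for the strong feature, D = σp²d, Λ_i for the loss weights 1/(1 + exp(margin)) of
training sample i summed over the steps taken, and Λ for the sum of the Λ_i. Three quantities
measure the trained network: x = ηΛ/(n0 m), which bounds every feature coefficient; A = xD/n0, the
scale of the memorised training noise; and G = x‖μ 0‖², the scale of the strong feature. All
estimates on a typical training set (`TypicalTraining`) hold uniformly in the number of steps.

Memorisation. The training noises are nearly orthogonal to each other and to the features, so the
response to ξ_i is governed by its own coefficient. Neurons of the sign of the label that start
active on ξ_i stay active, and the margin of sample i lies between two increasing linear functions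
of ηDΛ_i/(n0 m). A sample that has accumulated too much weight therefore has a large margin and a
small current loss weight, which keeps all Λ_i within a factor 40 of each other
(`balanced_and_active`).

Learning. At each step a neuron is active on all strong samples of at least one label, and both
labels push it in the same direction. Hence every neuron has strong coefficient at least x/51200
(`le_signalCoeff_strong`). The weak coefficient is at most x, and the gap together with the upper
bound on ‖μ 1‖ gives ‖μ 1‖² ≤ e‖μ 0‖² with a tiny e. Thus the weak response, and the weak
coefficient in the normalisation of the decomposition, are negligible against G.

Fresh noise. Given the training data, the response to a pool noise is Gaussian with deviation σp‖w‖,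
and ‖w‖ ≤ (1 + 82A)√(n0/D) by near orthogonality (`norm_gdIter_le`). The lower bound on the querying
time bounds A from below, and the gap then makes this response negligible against G as well
(`pool_noise_le`).

Queries. A strong pool sample has margin of order G and a weak one a far smaller absolute margin,
which settles Uncertainty Sampling. For Diversity Sampling, every coordinate of the feature map is
larger for a strong sample than for a weak one. Both lie below the labelled mean, which contains
memorised noise of order A, much larger than G. So weak samples are farther from the mean in every
coordinate, hence in every ℓ_q distance (`queryingEvent`). The probabilistic part consists of
Gaussian tails and Chernoff bounds for the typical events. -/

namespace ActiveLearning

open scoped ENNReal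

/-! ### Chernoff bounds and sections of product measures. -/

section MeasureBounds

variable {α β : Type*} [MeasurableSpace α] [MeasurableSpace β]

/-- Markov's inequality for a product of independent copies of a nonnegative variable. -/
lemma pi_one_le_prod_le (n : ℕ) (ν : Measure α) [IsProbabilityMeasure ν] {φ : α → ℝ≥0∞}
    (hφ : Measurable φ) :
    Measure.pi (fun _ : Fin n => ν) {x | 1 ≤ ∏ i, φ (x i)} ≤ (∫⁻ a, φ a ∂ν) ^ n := by
  have hind : iIndepFun (fun (i : Fin n) (x : Fin n → α) => φ (x i))
      (Measure.pi fun _ : Fin n => ν) :=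
    iIndepFun_pi (X := fun _ => φ) fun _ => hφ.aemeasurable
  have h1 := lintegral_prod_eq_prod_lintegral_of_indepFun Finset.univ
    (fun (i : Fin n) (x : Fin n → α) => φ (x i)) hind
    (fun i => hφ.comp (measurable_pi_apply i))
  have h2 : ∀ i : Fin n, ∫⁻ x, φ (x i) ∂(Measure.pi fun _ : Fin n => ν) = ∫⁻ a, φ a ∂ν :=
    fun i => (measurePreserving_eval (fun _ : Fin n => ν) i).lintegral_comp hφ
  simp only [h2, Finset.prod_const, Finset.card_univ, Fintype.card_fin] at h1
  rw [← h1]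
  have := mul_meas_ge_le_lintegral₀ (μ := Measure.pi fun _ : Fin n => ν)
    (f := fun x => ∏ i, φ (x i))
    (Finset.measurable_prod _ fun i _ => hφ.comp (measurable_pi_apply i)).aemeasurable 1
  simpa using this

/-- Chernoff's bound for the lower tail of the number of successes among independent trials. -/
lemma pi_card_filter_lt_le (n : ℕ) (ν : Measure α) [IsProbabilityMeasure ν] {A : Set α}
    (hA : MeasurableSet A) {a : ℝ} (ha : ENNReal.ofReal a ≤ ν A) :
    Measure.pi (fun _ : Fin n => ν)
      {x | (({i | x i ∈ A} : Set (Fin n)).ncard : ℝ) < a * n / 2} ≤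
        ENNReal.ofReal (Real.exp (-(a * n / 8))) := by
  classical
  -- The exponential tilt e^{a/2 - 1_A}: its product over the coordinates is at least 1 exactly when
  -- the number of successes is at most an/2.
  set φ : α → ℝ≥0∞ := fun x =>
    ENNReal.ofReal (Real.exp (a / 2)) * (A.indicator (fun _ => ENNReal.ofReal (Real.exp (-1))) x
      + Aᶜ.indicator (fun _ => 1) x) with hφ
  have hψ : Measurable fun x => A.indicator (fun _ => ENNReal.ofReal (Real.exp (-1))) x
      + Aᶜ.indicator (fun _ => (1 : ℝ≥0∞)) x :=
    (measurable_const.indicator hA).add (measurable_const.indicator hA.compl)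
  have hφm : Measurable φ := hψ.const_mul _
  have hφ' : ∀ x, φ x = ENNReal.ofReal (Real.exp (a / 2 - if x ∈ A then 1 else 0)) := by
    intro x
    by_cases hx : x ∈ A
    · simp [hφ, hx, ← ENNReal.ofReal_mul (Real.exp_pos _).le, ← Real.exp_add, sub_eq_add_neg]
    · simp [hφ, hx]
  refine (measure_mono ?_).trans ((pi_one_le_prod_le n ν hφm).trans ?_)
  · intro x hx
    simp only [Set.mem_ofPred_eq] at hx ⊢
    simp only [hφ']
    rw [← ENNReal.ofReal_prod_of_nonneg (fun _ _ => (Real.exp_pos _).le), ← Real.exp_sum,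
      ENNReal.one_le_ofReal, Real.one_le_exp_iff, Finset.sum_sub_distrib]
    have : (∑ i : Fin n, if x i ∈ A then (1 : ℝ) else 0)
        = (({i | x i ∈ A} : Set (Fin n)).ncard : ℝ) := by
      rw [Finset.sum_boole, Set.ncard_eq_toFinset_card']
      simp
    rw [this]
    simp only [Finset.sum_const, Finset.card_univ, Fintype.card_fin, nsmul_eq_mul]
    linarith
  · have hr : ν A = ENNReal.ofReal (ν.real A) := (ofReal_measureReal).symm
    have hrc : ν Aᶜ = ENNReal.ofReal (1 - ν.real A) := by
      rw [← probReal_compl_eq_one_sub hA, ofReal_measureReal]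
    have ha' : a ≤ ν.real A := by
      rw [hr] at ha
      exact (ENNReal.ofReal_le_ofReal_iff measureReal_nonneg).1 ha
    have h1 : ν.real A ≤ 1 := measureReal_le_one
    have hint : ∫⁻ x, φ x ∂ν = ENNReal.ofReal
        (Real.exp (a / 2) * (Real.exp (-1) * ν.real A + (1 - ν.real A))) := by
      rw [hφ]
      beta_reduce
      rw [lintegral_const_mul _ hψ,
        lintegral_add_left (measurable_const.indicator hA), lintegral_indicator_const hA,
        lintegral_indicator_const hA.compl, hr, hrc, one_mul,
        ← ENNReal.ofReal_mul (Real.exp_pos _).le,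
        ← ENNReal.ofReal_add (mul_nonneg (Real.exp_pos _).le measureReal_nonneg) (by linarith),
        ← ENNReal.ofReal_mul (Real.exp_pos _).le]
    -- The resulting factor 1 - (5/8)a is at most e^{-5a/8}; against the tilt e^{a/2} the exponent
    -- a/8 remains.
    have he : Real.exp (-1) ≤ 3 / 8 := by
      have := Real.exp_neg_one_lt_d9; linarith
    have hle : Real.exp (a / 2) * (Real.exp (-1) * ν.real A + (1 - ν.real A))
        ≤ Real.exp (-(a / 8)) := by
      have h2 : Real.exp (-1) * ν.real A + (1 - ν.real A) ≤ Real.exp (-(5 / 8 * a)) := by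
        refine le_trans ?_ (Real.add_one_le_exp _)
        nlinarith [measureReal_nonneg (μ := ν) (s := A)]
      calc _ ≤ Real.exp (a / 2) * Real.exp (-(5 / 8 * a)) := by gcongr
        _ = Real.exp (-(a / 8)) := by rw [← Real.exp_add]; ring_nf
    rw [hint]
    calc _ ≤ ENNReal.ofReal (Real.exp (-(a / 8))) ^ n := by gcongr
      _ = _ := by
        rw [← ENNReal.ofReal_pow (Real.exp_pos _).le, ← Real.exp_nat_mul]; ring_nf

/-- A set of a product space is small if all of its sections over the first factor are. -/
lemma prod_le_of_forall_section_le (μ : Measure α) (ν : Measure β) [IsProbabilityMeasure μ]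
    [SFinite ν] {s : Set (α × β)} (hs : MeasurableSet s) {ε : ℝ≥0∞}
    (h : ∀ a, ν (Prod.mk a ⁻¹' s) ≤ ε) : μ.prod ν s ≤ ε := by
  rw [Measure.prod_apply hs]
  calc _ ≤ ∫⁻ _, ε ∂μ := lintegral_mono h
    _ = ε := by simp

/-- The symmetric version of `prod_le_of_forall_section_le`. -/
lemma prod_le_of_forall_section_le' (μ : Measure α) (ν : Measure β) [SFinite μ]
    [IsProbabilityMeasure ν] {s : Set (α × β)} (hs : MeasurableSet s) {ε : ℝ≥0∞}
    (h : ∀ b, μ ((fun a => (a, b)) ⁻¹' s) ≤ ε) : μ.prod ν s ≤ ε := by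
  rw [Measure.prod_apply_symm hs]
  calc _ ≤ ∫⁻ _, ε ∂ν := lintegral_mono h
    _ = ε := by simp

lemma pi_eval_preimage {ι : Type*} [Fintype ι] (ν : Measure α) [IsProbabilityMeasure ν] (i : ι)
    {s : Set α} (hs : MeasurableSet s) :
    Measure.pi (fun _ : ι => ν) {x | x i ∈ s} = ν s :=
  (measurePreserving_eval (fun _ : ι => ν) i).measure_preimage hs.nullMeasurableSet

/-- Two distinct coordinates of a product measure with equal factors are independent. -/
lemma pi_eval_pair_preimage {ι : Type*} [Fintype ι] (ν : Measure α) [IsProbabilityMeasure ν]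
    {i k : ι} (hik : i ≠ k) {s : Set (α × α)} (hs : MeasurableSet s) :
    Measure.pi (fun _ : ι => ν) {x | (x i, x k) ∈ s} = ν.prod ν s := by
  have hind : iIndepFun (fun (i : ι) (x : ι → α) => x i) (Measure.pi fun _ : ι => ν) :=
    iIndepFun_pi (X := fun _ => id) fun _ => aemeasurable_id
  have h := (indepFun_iff_map_prod_eq_prod_map_map (measurable_pi_apply i).aemeasurable
    (measurable_pi_apply k).aemeasurable).1 (hind.indepFun hik)
  rw [(measurePreserving_eval (fun _ : ι => ν) i).map_eq,
    (measurePreserving_eval (fun _ : ι => ν) k).map_eq] at h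
  rw [← h, Measure.map_apply ((measurable_pi_apply i).prodMk (measurable_pi_apply k)) hs]
  rfl

end MeasureBounds

/-! ### Tails of linear functionals and norms of Gaussian vectors. -/

section Gaussian

variable {d : ℕ} {s : ℝ}

instance isProbabilityMeasure_gaussianNoise : IsProbabilityMeasure (gaussianNoise d s) :=
  Measure.isProbabilityMeasure_map (by fun_prop)

lemma stdGaussian_map_inner (u : Vec d) :
    (stdGaussian (Vec d)).map (fun z => inner ℝ u z) = gaussianReal 0 (‖u‖₊ ^ 2) := by
  have h := IsGaussian.map_eq_gaussianReal (μ := stdGaussian (Vec d)) (innerSL ℝ u)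
  rw [integral_strongDual_stdGaussian, variance_dual_stdGaussian, innerSL_apply_norm] at h
  have : (‖u‖ ^ 2).toNNReal = ‖u‖₊ ^ 2 := by
    rw [← coe_nnnorm, ← NNReal.coe_pow, Real.toNNReal_coe]
  rw [this] at h
  exact h

lemma gaussianReal_abs_gt_le (v : NNReal) {l : ℝ} (hl : 0 ≤ l) :
    gaussianReal 0 v {x | Real.sqrt v * l < |x|} ≤ ENNReal.ofReal (2 * Real.exp (-(l ^ 2 / 2))) := by
  have hsub : HasSubgaussianMGF id v (gaussianReal 0 v) := by
    refine ⟨fun t => integrable_exp_mul_gaussianReal t, fun t => ?_⟩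
    rw [mgf_id_gaussianReal]; simp
  have hneg := hsub.neg
  have key : ∀ X : ℝ → ℝ, HasSubgaussianMGF X v (gaussianReal 0 v) → v ≠ 0 →
      gaussianReal 0 v {x | Real.sqrt v * l ≤ X x} ≤ ENNReal.ofReal (Real.exp (-(l ^ 2 / 2))) := by
    intro X hX hv
    have := hX.measure_ge_le (ε := Real.sqrt v * l) (by positivity)
    rw [← ofReal_measureReal]
    refine ENNReal.ofReal_le_ofReal (this.trans_eq ?_)
    congr 1
    rw [mul_pow, Real.sq_sqrt v.coe_nonneg]
    have : (v : ℝ) ≠ 0 := by exact_mod_cast hv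
    field_simp
  -- At variance 0 the strict inequality makes the event null; the Chernoff exponent would divide by
  -- `v`.
  by_cases hv : v = 0
  · subst hv; simp
  have hle : {x : ℝ | Real.sqrt v * l < |x|} ⊆
      {x | Real.sqrt v * l ≤ id x} ∪ {x | Real.sqrt v * l ≤ (-id) x} := by
    intro x hx
    rcases lt_abs.1 (show Real.sqrt v * l < |x| from hx) with h | h
    · exact Or.inl h.le
    · exact Or.inr h.le
  refine (measure_mono hle).trans ((measure_union_le _ _).trans ?_)
  rw [two_mul, ENNReal.ofReal_add (Real.exp_pos _).le (Real.exp_pos _).le]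
  exact add_le_add (key _ hsub hv) (key _ hneg hv)

lemma measurable_inner_left (u : Vec d) : Measurable fun z : Vec d => inner ℝ u z := by fun_prop

/-- The tail of a linear functional of a Gaussian vector. -/
lemma gaussianNoise_abs_inner_gt_le (hs : 0 ≤ s) (u : Vec d) {l : ℝ} (hl : 0 ≤ l) :
    gaussianNoise d s {x | s * ‖u‖ * l < |inner ℝ u x|} ≤
      ENNReal.ofReal (2 * Real.exp (-(l ^ 2 / 2))) := by
  have hm : MeasurableSet {x : Vec d | s * ‖u‖ * l < |inner ℝ u x|} :=
    measurableSet_lt measurable_const (measurable_inner_left u).abs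
  rw [gaussianNoise, Measure.map_apply (by fun_prop) hm]
  have hm2 : MeasurableSet {x : ℝ | Real.sqrt ((‖u‖₊ ^ 2 : NNReal) : ℝ) * l < |x|} :=
    measurableSet_lt measurable_const measurable_id.abs
  have h := gaussianReal_abs_gt_le (‖u‖₊ ^ 2) hl
  rw [← stdGaussian_map_inner u, Measure.map_apply (measurable_inner_left u) hm2] at h
  refine le_trans (measure_mono ?_) h
  intro z hz
  simp only [Set.mem_preimage, Set.mem_ofPred_eq, inner_smul_right, abs_mul, abs_of_nonneg hs,
    NNReal.coe_pow, coe_nnnorm, Real.sqrt_sq (norm_nonneg u)] at hz ⊢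
  by_contra hc
  push Not at hc
  nlinarith [mul_le_mul_of_nonneg_left hc hs]

lemma gaussianNoise_map_neg : (gaussianNoise d s).map (fun x => -x) = gaussianNoise d s := by
  have h := stdGaussian_map (E := Vec d) (LinearIsometryEquiv.neg ℝ)
  have h' : (stdGaussian (Vec d)).map (fun x => -x) = stdGaussian (Vec d) := h
  conv_rhs => rw [gaussianNoise, ← h']
  rw [gaussianNoise, Measure.map_map (by fun_prop) (by fun_prop),
    Measure.map_map (by fun_prop) (by fun_prop)]
  congr 1
  ext1 x
  simp

/-- A half-space whose boundary passes through the origin has mass at least one half. -/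
lemma half_le_gaussianNoise_inner_nonneg (u : Vec d) :
    ENNReal.ofReal (1 / 2) ≤ gaussianNoise d s {x | 0 ≤ inner ℝ u x} := by
  set A : Set (Vec d) := {x | 0 ≤ inner ℝ u x}
  have hA : MeasurableSet A := measurableSet_le measurable_const (measurable_inner_left u)
  -- Negation preserves the law and carries the complement into the half-space.
  have h1 : gaussianNoise d s Aᶜ ≤ gaussianNoise d s A := by
    conv_rhs => rw [← gaussianNoise_map_neg, Measure.map_apply measurable_neg hA]
    refine measure_mono fun x hx => ?_
    simp only [A, Set.mem_compl_iff, Set.mem_ofPred_eq, not_le, Set.mem_preimage, inner_neg_right]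
      at hx ⊢
    linarith
  have h2 : (gaussianNoise d s).real Aᶜ ≤ (gaussianNoise d s).real A :=
    ENNReal.toReal_mono (measure_ne_top _ _) h1
  rw [probReal_compl_eq_one_sub hA] at h2
  rw [← ofReal_measureReal]
  exact ENNReal.ofReal_le_ofReal (by linarith)

lemma lintegral_exp_mul_sq_gaussianReal {b : ℝ} (hb : b < 1 / 2) :
    ∫⁻ x, ENNReal.ofReal (Real.exp (b * x ^ 2)) ∂(gaussianReal 0 1) =
      ENNReal.ofReal ((Real.sqrt (1 - 2 * b))⁻¹) := by
  have hb' : 0 < 1 / 2 - b := by linarith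
  rw [gaussianReal_of_var_ne_zero _ one_ne_zero,
    lintegral_withDensity_eq_lintegral_mul _ (measurable_gaussianPDF 0 1) (by fun_prop)]
  have : ∀ x : ℝ, (gaussianPDF 0 1 * fun x => ENNReal.ofReal (Real.exp (b * x ^ 2))) x =
      ENNReal.ofReal ((Real.sqrt (2 * Real.pi))⁻¹ * Real.exp (-(1 / 2 - b) * x ^ 2)) := by
    intro x
    rw [Pi.mul_apply, gaussianPDF, ← ENNReal.ofReal_mul (gaussianPDFReal_nonneg _ _ _),
      gaussianPDFReal]
    congr 1
    rw [mul_assoc, ← Real.exp_add]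
    simp only [NNReal.coe_one, mul_one, sub_zero]
    ring_nf
  simp_rw [this]
  rw [← ofReal_integral_eq_lintegral_ofReal ((integrable_exp_neg_mul_sq hb').const_mul _)
    (ae_of_all _ fun x => by positivity), integral_const_mul, integral_gaussian]
  congr 1
  rw [← Real.sqrt_inv, ← Real.sqrt_inv, ← Real.sqrt_mul (by positivity)]
  congr 1
  have : (1 - 2 * b) ≠ 0 := by linarith
  have : (1 / 2 - b) ≠ 0 := hb'.ne'
  have := Real.pi_ne_zero
  field_simp

/-- Chernoff's method for both tails of the chi-square law at once: positive `b` gives the upper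
tail and negative `b` the lower one. `hr` bounds the factor contributed by one coordinate. -/
lemma stdGaussian_norm_sq_le {b a r : ℝ} (hb : b < 1 / 2)
    (hr : Real.exp (-a) * (Real.sqrt (1 - 2 * b))⁻¹ ≤ Real.exp (-r)) :
    stdGaussian (Vec d) {z | a * d ≤ b * ‖z‖ ^ 2} ≤ ENNReal.ofReal (Real.exp (-(r * d))) := by
  have hm : MeasurableSet {z : Vec d | a * d ≤ b * ‖z‖ ^ 2} :=
    measurableSet_le measurable_const (by fun_prop)
  rw [← map_pi_eq_stdGaussian, Measure.map_apply (by fun_prop) hm]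
  set φ : ℝ → ℝ≥0∞ := fun x => ENNReal.ofReal (Real.exp (-a)) * ENNReal.ofReal (Real.exp (b * x ^ 2))
  have hφ : Measurable φ := by fun_prop
  refine (measure_mono ?_).trans ((pi_one_le_prod_le d (gaussianReal 0 1) hφ).trans ?_)
  · intro x hx
    simp only [Set.mem_preimage, Set.mem_ofPred_eq, EuclideanSpace.real_norm_sq_eq, φ,
      ← ENNReal.ofReal_mul (Real.exp_pos _).le, ← Real.exp_add] at hx ⊢
    rw [← ENNReal.ofReal_prod_of_nonneg (fun _ _ => (Real.exp_pos _).le), ← Real.exp_sum,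
      ENNReal.one_le_ofReal, Real.one_le_exp_iff, Finset.sum_add_distrib, ← Finset.mul_sum]
    simp only [Finset.sum_const, Finset.card_univ, Fintype.card_fin, nsmul_eq_mul]
    linarith
  · rw [lintegral_const_mul _ (by fun_prop), lintegral_exp_mul_sq_gaussianReal hb,
      ← ENNReal.ofReal_mul (Real.exp_pos _).le]
    calc _ ≤ ENNReal.ofReal (Real.exp (-r)) ^ d := by gcongr
      _ = _ := by
        rw [← ENNReal.ofReal_pow (Real.exp_pos _).le, ← Real.exp_nat_mul]; ring_nf

lemma gaussianNoise_norm_sq_gt_le :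
    gaussianNoise d s {x | 2 * (s ^ 2 * d) < ‖x‖ ^ 2} ≤ ENNReal.ofReal (Real.exp (-(d / 16))) := by
  have hm : MeasurableSet {x : Vec d | 2 * (s ^ 2 * d) < ‖x‖ ^ 2} :=
    measurableSet_lt measurable_const (by fun_prop)
  rw [gaussianNoise, Measure.map_apply (by fun_prop) hm]
  -- Here one coordinate contributes e^{-1/2}√2, which is below e^{-1/16} because e^{7/16} > √2.
  have h := stdGaussian_norm_sq_le (d := d) (b := 1 / 4) (a := 1 / 2) (r := 1 / 16) (by norm_num) (by
    have h1 : (1.4 : ℝ) ≤ Real.sqrt 2 := Real.le_sqrt_of_sq_le (by norm_num)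
    have h2 : (Real.sqrt (1 - 2 * (1 / 4)))⁻¹ = Real.sqrt 2 := by
      rw [← Real.sqrt_inv]; norm_num
    have h3 : Real.sqrt 2 ≤ 1.4143 := Real.sqrt_le_iff.2 ⟨by norm_num, by norm_num⟩
    rw [h2]
    have h4 : Real.exp (-(1 / 2)) * Real.exp (7 / 16) = Real.exp (-(1 / 16)) := by
      rw [← Real.exp_add]; norm_num
    rw [← h4]
    have h5 := Real.quadratic_le_exp_of_nonneg (x := 7 / 16) (by norm_num)
    gcongr
    linarith)
  refine (measure_mono fun z hz => ?_).trans (h.trans_eq (by ring_nf))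
  simp only [Set.mem_preimage, Set.mem_ofPred_eq, norm_smul, mul_pow, Real.norm_eq_abs, sq_abs]
    at hz ⊢
  by_contra hc
  push Not at hc
  nlinarith [sq_nonneg s]

lemma gaussianNoise_norm_sq_lt_le (hs : s ≠ 0) :
    gaussianNoise d s {x | ‖x‖ ^ 2 < s ^ 2 * d / 2} ≤ ENNReal.ofReal (Real.exp (-(d / 16))) := by
  have hm : MeasurableSet {x : Vec d | ‖x‖ ^ 2 < s ^ 2 * d / 2} :=
    measurableSet_lt (by fun_prop) measurable_const
  rw [gaussianNoise, Measure.map_apply (by fun_prop) hm]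
  -- Here one coordinate contributes e^{1/4}/√2, and e^{5/16} < √2.
  have h := stdGaussian_norm_sq_le (d := d) (b := -1 / 2) (a := -1 / 4) (r := 1 / 16)
    (by norm_num) (by
    have h1 : (1.4142 : ℝ) ≤ Real.sqrt 2 := Real.le_sqrt_of_sq_le (by norm_num)
    have h2 : (Real.sqrt (1 - 2 * (-1 / 2))) = Real.sqrt 2 := by norm_num
    have h4 : Real.exp (-(-1 / 4)) = Real.exp (-(1 / 16)) * Real.exp (5 / 16) := by
      rw [← Real.exp_add]; norm_num
    rw [h2, h4, mul_assoc]
    have h5 : Real.exp (5 / 16) ≤ 1.4142 := by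
      have := Real.exp_bound_div_one_sub_of_interval (x := 5 / 32) (by norm_num) (by norm_num)
      have h6 : Real.exp (5 / 16) = Real.exp (5 / 32) ^ 2 := by
        rw [← Real.exp_nat_mul]; norm_num
      rw [h6]
      calc _ ≤ (1 / (1 - 5 / 32) : ℝ) ^ 2 := by gcongr
        _ ≤ _ := by norm_num
    have h7 : Real.exp (5 / 16) * (Real.sqrt 2)⁻¹ ≤ 1 := by
      rw [← div_eq_mul_inv, div_le_one (by positivity)]; linarith
    exact mul_le_of_le_one_right (Real.exp_pos _).le h7)
  refine (measure_mono fun z hz => ?_).trans (h.trans_eq (by ring_nf))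
  simp only [Set.mem_preimage, Set.mem_ofPred_eq, norm_smul, mul_pow, Real.norm_eq_abs, sq_abs]
    at hz ⊢
  have hs2 : 0 < s ^ 2 := by positivity
  by_contra hc
  push Not at hc
  nlinarith

end Gaussian

/-! ### The laws of the model are probability measures. -/

section Laws

instance : IsProbabilityMeasure rademacher := by
  refine ⟨?_⟩
  simp only [rademacher, Measure.add_apply, Measure.smul_apply, measure_univ, smul_eq_mul, mul_one]
  rw [← ENNReal.ofReal_add (by norm_num) (by norm_num)]; norm_num

lemma isProbabilityMeasure_featureLaw {p : ℝ} (h0 : 0 ≤ p) (h1 : p ≤ 1) :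
    IsProbabilityMeasure (featureLaw p) := by
  refine ⟨?_⟩
  simp only [featureLaw, Measure.add_apply, Measure.smul_apply, measure_univ, smul_eq_mul, mul_one]
  rw [← ENNReal.ofReal_add (by linarith) h0]; norm_num

lemma isProbabilityMeasure_dataLaw {d : ℕ} {p σp : ℝ} (h0 : 0 ≤ p) (h1 : p ≤ 1) :
    IsProbabilityMeasure (dataLaw d p σp) := by
  have := isProbabilityMeasure_featureLaw h0 h1
  unfold dataLaw; infer_instance

instance (m d : ℕ) (σ0 : ℝ) : IsProbabilityMeasure (initLaw m d σ0) := by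
  unfold initLaw; infer_instance

end Laws

/-! ### Elementary facts on the activation, the loss and the partial networks. -/

section Preliminaries

lemma relu_nonneg (x : ℝ) : 0 ≤ relu x := le_max_right _ _

lemma le_relu (x : ℝ) : x ≤ relu x := le_max_left _ _

lemma relu_le_abs (x : ℝ) : relu x ≤ |x| := max_le (le_abs_self x) (abs_nonneg x)

lemma relu_le {x c : ℝ} (hc : 0 ≤ c) (h : x ≤ c) : relu x ≤ c := max_le h hc

lemma reluDeriv_nonneg (x : ℝ) : 0 ≤ reluDeriv x := by unfold reluDeriv; split_ifs <;> norm_num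

lemma reluDeriv_le_one (x : ℝ) : reluDeriv x ≤ 1 := by unfold reluDeriv; split_ifs <;> norm_num

lemma reluDeriv_of_nonneg {x : ℝ} (h : 0 ≤ x) : reluDeriv x = 1 := if_pos h

lemma sgn_mul_self (b : Bool) : sgn b * sgn b = 1 := by cases b <;> simp [sgn]

lemma abs_sgn (b : Bool) : |sgn b| = 1 := by cases b <;> simp [sgn]

lemma sgn_not (b : Bool) : sgn (!b) = -sgn b := by cases b <;> simp [sgn]

lemma deriv_logisticLoss (z : ℝ) : deriv logisticLoss z = -(1 / (1 + Real.exp z)) := by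
  have hpos : (1 : ℝ) + Real.exp (-z) ≠ 0 := by positivity
  have h : HasDerivAt logisticLoss ((Real.exp (-z) * -1) / (1 + Real.exp (-z))) z :=
    (((hasDerivAt_neg z).exp).const_add 1).log hpos
  rw [h.deriv, Real.exp_neg]
  have := Real.exp_pos z
  field_simp
  ring

end Preliminaries

section Network

variable {m d n : ℕ}

lemma sgn_mul_net (W : Weights m d) (y : Bool) (x : Fin 2 → Vec d) :
    sgn y * net W x = partialNet W y x - partialNet W (!y) x := by
  cases y <;> simp [net, sgn] <;> ring

lemma partialNet_nonneg (W : Weights m d) (j : Bool) (x : Fin 2 → Vec d) :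
    0 ≤ partialNet W j x :=
  mul_nonneg (by positivity)
    (Finset.sum_nonneg fun _ _ => Finset.sum_nonneg fun _ _ => relu_nonneg _)

lemma partialNet_le (hm : 0 < m) {W : Weights m d} {j : Bool} {x : Fin 2 → Vec d} {u : ℝ}
    (h : ∀ r, ∑ k, relu (inner ℝ (W j r) (x k)) ≤ u) : partialNet W j x ≤ u := by
  have hm' : (0 : ℝ) < m := by exact_mod_cast hm
  have h1 : ∑ r : Fin m, ∑ k, relu (inner ℝ (W j r) (x k)) ≤ m * u := by
    calc _ ≤ ∑ _r : Fin m, u := Finset.sum_le_sum fun r _ => h r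
      _ = m * u := by simp
  rw [partialNet, one_div, inv_mul_le_iff₀ hm']
  exact h1

lemma le_partialNet (hm : 0 < m) {W : Weights m d} {j : Bool} {x : Fin 2 → Vec d} {u : ℝ}
    (h : ∀ r, u ≤ ∑ k, relu (inner ℝ (W j r) (x k))) : u ≤ partialNet W j x := by
  have hm' : (0 : ℝ) < m := by exact_mod_cast hm
  have h1 : m * u ≤ ∑ r : Fin m, ∑ k, relu (inner ℝ (W j r) (x k)) := by
    calc m * u = ∑ _r : Fin m, u := by simp
      _ ≤ _ := Finset.sum_le_sum fun r _ => h r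
  rw [partialNet, one_div, ← div_eq_inv_mul, le_div_iff₀ hm']
  linarith

/-- A lower bound for the partial network when a quarter of the neurons respond to the noise
patch. -/
lemma le_partialNet_of_card (hm : 0 < m) {W : Weights m d} {j : Bool} {x : Fin 2 → Vec d} {u : ℝ}
    (hu : 0 ≤ u) (s : Finset (Fin m)) (hs : (m : ℝ) / 4 ≤ s.card)
    (h : ∀ r ∈ s, u ≤ inner ℝ (W j r) (x 1)) : u / 4 ≤ partialNet W j x := by
  have hm' : (0 : ℝ) < m := by exact_mod_cast hm
  have h1 : s.card * u ≤ ∑ r : Fin m, ∑ k, relu (inner ℝ (W j r) (x k)) := by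
    calc (s.card : ℝ) * u = ∑ _r ∈ s, u := by simp
      _ ≤ ∑ r ∈ s, ∑ k, relu (inner ℝ (W j r) (x k)) := by
        refine Finset.sum_le_sum fun r hr => ?_
        rw [Fin.sum_univ_two]
        linarith [h r hr, le_relu (inner ℝ (W j r) (x 1)), relu_nonneg (inner ℝ (W j r) (x 0))]
      _ ≤ _ := Finset.sum_le_univ_sum_of_nonneg fun r =>
        Finset.sum_nonneg fun _ _ => relu_nonneg _
  rw [partialNet, one_div, ← div_eq_inv_mul, le_div_iff₀ hm']
  nlinarith

end Network

/-! ### Gradient descent expressed through cumulative loss weights. -/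

section Dynamics

variable {m d n : ℕ} (μ : Fin 2 → Vec d) (η : ℝ) (S : Fin n → Sample d) (W0 : Weights m d)

/-- The margin `y_i f (W, x_i)` on the `i`-th training sample after `t` steps. -/
noncomputable def margin (t : ℕ) (i : Fin n) : ℝ :=
  sgn (S i).label * net (gdIter μ η S W0 t) ((S i).patch μ)

/-- The absolute value of the loss derivative on the `i`-th training sample after `t` steps. -/
noncomputable def lossWeight (t : ℕ) (i : Fin n) : ℝ := 1 / (1 + Real.exp (margin μ η S W0 t i))

/-- The sum of the loss weights of the `i`-th training sample over the first `t` steps. -/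
noncomputable def cumWeight (t : ℕ) (i : Fin n) : ℝ := ∑ s ∈ Finset.range t, lossWeight μ η S W0 s i

/-- The cumulative loss weights summed over the whole training set. -/
noncomputable def totalWeight (t : ℕ) : ℝ := ∑ i, cumWeight μ η S W0 t i

/-- The coefficient of `j • μ_l` in the weights after `t` steps. -/
noncomputable def signalCoeff (t : ℕ) (j : Bool) (r : Fin m) (l : Fin 2) : ℝ :=
  η / (n * m : ℝ) * ∑ s ∈ Finset.range t, ∑ i : Fin n,
    if (S i).feature = l then
      lossWeight μ η S W0 s i * reluDeriv (inner ℝ (gdIter μ η S W0 s j r) ((S i).patch μ 0))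
    else 0

/-- The coefficient of `ξ_i` in the weights after `t` steps. -/
noncomputable def noiseCoeff (t : ℕ) (j : Bool) (r : Fin m) (i : Fin n) : ℝ :=
  η / (n * m : ℝ) * (sgn j * sgn (S i).label) * ∑ s ∈ Finset.range t,
    lossWeight μ η S W0 s i * reluDeriv (inner ℝ (gdIter μ η S W0 s j r) (S i).noise)

variable {μ η S W0}

lemma lossWeight_pos (t : ℕ) (i : Fin n) : 0 < lossWeight μ η S W0 t i := by
  unfold lossWeight; positivity

lemma lossWeight_le_one (t : ℕ) (i : Fin n) : lossWeight μ η S W0 t i ≤ 1 := by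
  unfold lossWeight
  rw [div_le_one (by positivity)]
  linarith [Real.exp_pos (margin μ η S W0 t i)]

lemma cumWeight_zero (i : Fin n) : cumWeight μ η S W0 0 i = 0 := by simp [cumWeight]

lemma cumWeight_succ (t : ℕ) (i : Fin n) :
    cumWeight μ η S W0 (t + 1) i = cumWeight μ η S W0 t i + lossWeight μ η S W0 t i :=
  Finset.sum_range_succ _ _

lemma cumWeight_nonneg (t : ℕ) (i : Fin n) : 0 ≤ cumWeight μ η S W0 t i :=
  Finset.sum_nonneg fun _ _ => (lossWeight_pos _ _).le

lemma totalWeight_nonneg (t : ℕ) : 0 ≤ totalWeight μ η S W0 t :=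
  Finset.sum_nonneg fun _ _ => cumWeight_nonneg _ _

/-- Every gradient is a combination of the features and the training noises. The label enters the
feature term twice, once through the loss and once through the patch, and cancels; so the signal
coefficient carries only the sign j, while the noise coefficient keeps the product of j and the
label. -/
lemma gdIter_eq (t : ℕ) (j : Bool) (r : Fin m) :
    gdIter μ η S W0 t j r = W0 j r
      + sgn j • ∑ l : Fin 2, signalCoeff μ η S W0 t j r l • μ l
      + ∑ i : Fin n, noiseCoeff μ η S W0 t j r i • (S i).noise := by
  induction t with
  | zero => simp [gdIter, signalCoeff, noiseCoeff]
  | succ t ih =>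
    have hs : ∀ l, signalCoeff μ η S W0 (t + 1) j r l = signalCoeff μ η S W0 t j r l
        + η / (n * m : ℝ) * ∑ i : Fin n, if (S i).feature = l then
          lossWeight μ η S W0 t i * reluDeriv (inner ℝ (gdIter μ η S W0 t j r) ((S i).patch μ 0))
          else 0 := fun l => by
      simp only [signalCoeff, Finset.sum_range_succ, mul_add]
    have hn : ∀ i, noiseCoeff μ η S W0 (t + 1) j r i = noiseCoeff μ η S W0 t j r i
        + η / (n * m : ℝ) * (sgn j * sgn (S i).label) *
          (lossWeight μ η S W0 t i * reluDeriv (inner ℝ (gdIter μ η S W0 t j r) (S i).noise)) :=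
      fun i => by simp only [noiseCoeff, Finset.sum_range_succ, mul_add]
    simp only [hs, hn, add_smul, Finset.sum_add_distrib, smul_add]
    have hsum : ∑ l : Fin 2, (η / (n * m : ℝ) * ∑ i : Fin n, if (S i).feature = l then
          lossWeight μ η S W0 t i * reluDeriv (inner ℝ (gdIter μ η S W0 t j r) ((S i).patch μ 0))
          else 0) • μ l = ∑ i : Fin n, (η / (n * m : ℝ) * (lossWeight μ η S W0 t i *
            reluDeriv (inner ℝ (gdIter μ η S W0 t j r) ((S i).patch μ 0)))) •
              μ (S i).feature := by
      simp only [Finset.mul_sum, Finset.sum_smul]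
      rw [Finset.sum_comm]
      refine Finset.sum_congr rfl fun i _ => ?_
      simp [ite_smul]
    rw [hsum]
    have hstep : gdIter μ η S W0 (t + 1) j r = gdIter μ η S W0 t j r
        + sgn j • ∑ i : Fin n, (η / (n * m : ℝ) * (lossWeight μ η S W0 t i *
            reluDeriv (inner ℝ (gdIter μ η S W0 t j r) ((S i).patch μ 0)))) • μ (S i).feature
        + ∑ i : Fin n, (η / (n * m : ℝ) * (sgn j * sgn (S i).label) *
          (lossWeight μ η S W0 t i *
            reluDeriv (inner ℝ (gdIter μ η S W0 t j r) (S i).noise))) • (S i).noise := by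
      rw [gdIter, gdStep, sub_eq_add_neg, add_assoc]
      congr 1
      rw [← smul_neg, ← Finset.sum_neg_distrib, Finset.smul_sum, Finset.smul_sum,
        ← Finset.sum_add_distrib]
      refine Finset.sum_congr rfl fun i _ => ?_
      rw [deriv_logisticLoss, Fin.sum_univ_two]
      change _ • -((-(lossWeight μ η S W0 t i) * _) • _) = _
      have h0 : (S i).patch μ 0 = sgn (S i).label • μ (S i).feature := rfl
      have h1 : (S i).patch μ 1 = (S i).noise := rfl
      set A := reluDeriv (inner ℝ (gdIter μ η S W0 t j r) ((S i).patch μ 0))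
      rw [h0, h1]
      have hsg := sgn_mul_self (S i).label
      have h2 : sgn j • (η / (n * m : ℝ) * (lossWeight μ η S W0 t i * A)) • μ (S i).feature
          = (sgn j * (η / (n * m : ℝ) * (lossWeight μ η S W0 t i * A)) *
            (sgn (S i).label * sgn (S i).label)) • μ (S i).feature := by
        rw [hsg, mul_one, smul_smul]
      rw [h2]
      module
    rw [hstep, ih]
    abel

lemma inner_gdIter (t : ℕ) (j : Bool) (r : Fin m) (v : Vec d) :
    inner ℝ (gdIter μ η S W0 t j r) v = inner ℝ (W0 j r) v
      + sgn j * ∑ l : Fin 2, signalCoeff μ η S W0 t j r l * inner ℝ (μ l) v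
      + ∑ i : Fin n, noiseCoeff μ η S W0 t j r i * inner ℝ (S i).noise v := by
  rw [gdIter_eq]
  simp only [inner_add_left, real_inner_smul_left, sum_inner]

lemma isSignalNoiseDecomp_gdIter (hμ : ∀ l, μ l ≠ 0) (hS : ∀ i, (S i).noise ≠ 0) (t : ℕ) :
    IsSignalNoiseDecomp μ S W0 (gdIter μ η S W0 t)
      (fun j r l => signalCoeff μ η S W0 t j r l * ‖μ l‖ ^ 2,
        fun j r i => noiseCoeff μ η S W0 t j r i * ‖(S i).noise‖ ^ 2) := by
  intro j r
  have h1 : ∀ l, signalCoeff μ η S W0 t j r l * ‖μ l‖ ^ 2 / ‖μ l‖ ^ 2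
      = signalCoeff μ η S W0 t j r l := fun l =>
    mul_div_cancel_right₀ _ (pow_ne_zero _ (norm_ne_zero_iff.2 (hμ l)))
  have h2 : ∀ i, noiseCoeff μ η S W0 t j r i * ‖(S i).noise‖ ^ 2 / ‖(S i).noise‖ ^ 2
      = noiseCoeff μ η S W0 t j r i := fun i =>
    mul_div_cancel_right₀ _ (pow_ne_zero _ (norm_ne_zero_iff.2 (hS i)))
  simp only [h1, h2]
  exact gdIter_eq t j r

section Bounds

variable (hη : 0 ≤ η)
include hη

lemma signalCoeff_nonneg (t : ℕ) (j : Bool) (r : Fin m) (l : Fin 2) :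
    0 ≤ signalCoeff μ η S W0 t j r l := by
  refine mul_nonneg (by positivity) (Finset.sum_nonneg fun s _ => Finset.sum_nonneg fun i _ => ?_)
  split_ifs
  · exact mul_nonneg (lossWeight_pos _ _).le (reluDeriv_nonneg _)
  · exact le_rfl

lemma signalCoeff_le (t : ℕ) (j : Bool) (r : Fin m) (l : Fin 2) :
    signalCoeff μ η S W0 t j r l ≤ η / (n * m : ℝ) * totalWeight μ η S W0 t := by
  unfold signalCoeff totalWeight cumWeight
  rw [Finset.sum_comm (s := Finset.univ)]
  refine mul_le_mul_of_nonneg_left (Finset.sum_le_sum fun s _ => Finset.sum_le_sum fun i _ => ?_)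
    (by positivity)
  split_ifs
  · exact mul_le_of_le_one_right (lossWeight_pos _ _).le (reluDeriv_le_one _)
  · exact (lossWeight_pos _ _).le

lemma abs_noiseCoeff_le (t : ℕ) (j : Bool) (r : Fin m) (i : Fin n) :
    |noiseCoeff μ η S W0 t j r i| ≤ η / (n * m : ℝ) * cumWeight μ η S W0 t i := by
  unfold noiseCoeff cumWeight
  have h0 : 0 ≤ ∑ s ∈ Finset.range t,
      lossWeight μ η S W0 s i * reluDeriv (inner ℝ (gdIter μ η S W0 s j r) (S i).noise) :=
    Finset.sum_nonneg fun s _ => mul_nonneg (lossWeight_pos _ _).le (reluDeriv_nonneg _)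
  have h1 : 0 ≤ η / (n * m : ℝ) := by positivity
  rw [abs_mul, abs_mul, abs_mul, abs_sgn, abs_sgn, abs_of_nonneg h0, abs_of_nonneg h1]
  simp only [mul_one]
  exact mul_le_mul_of_nonneg_left (Finset.sum_le_sum fun s _ =>
    mul_le_of_le_one_right (lossWeight_pos _ _).le (reluDeriv_le_one _)) h1

/-- Neurons of the wrong sign can only unlearn a noise patch. This keeps the competing partial
network small in `le_margin`. -/
lemma noiseCoeff_not_label_nonpos (t : ℕ) (r : Fin m) (i : Fin n) :
    noiseCoeff μ η S W0 t (!(S i).label) r i ≤ 0 := by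
  unfold noiseCoeff
  have h0 : 0 ≤ ∑ s ∈ Finset.range t, lossWeight μ η S W0 s i *
      reluDeriv (inner ℝ (gdIter μ η S W0 s (!(S i).label) r) (S i).noise) :=
    Finset.sum_nonneg fun s _ => mul_nonneg (lossWeight_pos _ _).le (reluDeriv_nonneg _)
  have h1 : 0 ≤ η / (n * m : ℝ) := by positivity
  rw [sgn_not, neg_mul, sgn_mul_self]
  nlinarith

end Bounds

lemma noiseCoeff_of_active {t : ℕ} {i : Fin n} {r : Fin m}
    (h : ∀ s < t, 0 ≤ inner ℝ (gdIter μ η S W0 s (S i).label r) (S i).noise) :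
    noiseCoeff μ η S W0 t (S i).label r i = η / (n * m : ℝ) * cumWeight μ η S W0 t i := by
  unfold noiseCoeff cumWeight
  rw [sgn_mul_self, mul_one]
  congr 1
  refine Finset.sum_congr rfl fun s hs => ?_
  rw [reluDeriv_of_nonneg (h s (Finset.mem_range.1 hs)), mul_one]

end Dynamics

/-! ### Typical training sets: memorisation and balance of the loss weights. -/

open Classical in
/-- The typical properties of the initial weights and of the training set, for noise patches of
squared norm about `D`; the small number `e` measures all deviations. -/
structure TypicalTraining {m d n : ℕ} (μ : Fin 2 → Vec d) (S : Fin n → Sample d)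
    (W0 : Weights m d) (D e : ℝ) : Prop where
  m_pos : 0 < m
  n_pos : 0 < n
  D_pos : 0 < D
  e_pos : 0 < e
  e_le : e ≤ 1 / 10000000
  feature_ne : ∀ l, μ l ≠ 0
  orthogonal : inner ℝ (μ 0) (μ 1) = 0
  weak_le : ‖μ 1‖ ^ 2 ≤ e * ‖μ 0‖ ^ 2
  dim_ge : n * ‖μ 0‖ ^ 2 ≤ e * D
  le_norm_noise : ∀ i, D / 2 ≤ ‖(S i).noise‖ ^ 2
  norm_noise_le : ∀ i, ‖(S i).noise‖ ^ 2 ≤ 2 * D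
  noise_inner_noise : ∀ i k, i ≠ k → |inner ℝ (S i).noise (S k).noise| ≤ e * D / n
  feature_inner_noise : ∀ l i, |inner ℝ (μ l) (S i).noise| ≤ e * ‖μ l‖ ^ 2
  init_inner_noise : ∀ j r i, |inner ℝ (W0 j r) (S i).noise| ≤ e
  init_inner_feature : ∀ j r l, |inner ℝ (W0 j r) (μ l)| ≤ e * (n * ‖μ 0‖ ^ 2 / D)
  init_norm : ∀ j r, ‖W0 j r‖ ≤ Real.sqrt (n / D)
  active_neurons : ∀ i, (m : ℝ) / 4 ≤
    (Finset.univ.filter fun r => 0 ≤ inner ℝ (W0 (S i).label r) (S i).noise).card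
  active_samples : ∀ r, (n : ℝ) / 4 ≤
    (Finset.univ.filter fun i => 0 ≤ inner ℝ (W0 (S i).label r) (S i).noise).card
  strong_samples : ∀ y, (n : ℝ) / 8 ≤
    (Finset.univ.filter fun i => (S i).feature = 0 ∧ (S i).label = y).card

namespace TypicalTraining

variable {m d n : ℕ} {μ : Fin 2 → Vec d} {η : ℝ} {S : Fin n → Sample d} {W0 : Weights m d}
  {D e : ℝ} (H : TypicalTraining μ S W0 D e)
include H

lemma n_pos' : (0 : ℝ) < n := by exact_mod_cast H.n_pos

lemma m_pos' : (0 : ℝ) < m := by exact_mod_cast H.m_pos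

lemma norm_feature_le (l : Fin 2) : ‖μ l‖ ^ 2 ≤ ‖μ 0‖ ^ 2 := by
  fin_cases l
  · exact le_rfl
  · have := H.weak_le
    have := H.e_le
    have := sq_nonneg ‖μ 0‖
    simp only [Fin.mk_one]
    nlinarith

lemma feature_inner_noise' (l : Fin 2) (i : Fin n) :
    |inner ℝ (μ l) (S i).noise| ≤ e * ‖μ 0‖ ^ 2 :=
  (H.feature_inner_noise l i).trans
    (mul_le_mul_of_nonneg_left (H.norm_feature_le l) H.e_pos.le)

lemma feature_inner_of_ne {l l' : Fin 2} (h : l ≠ l') : inner ℝ (μ l) (μ l') = 0 := by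
  fin_cases l <;> fin_cases l'
  · exact absurd rfl h
  · exact H.orthogonal
  · simpa [real_inner_comm] using H.orthogonal
  · exact absurd rfl h

/-- Up to a small error, only the coefficient of `μ_l` acts on `μ_l`. -/
lemma abs_inner_feature_sub_le (hη : 0 ≤ η) (t : ℕ) (j : Bool) (r : Fin m) (l : Fin 2) :
    |inner ℝ (gdIter μ η S W0 t j r) (μ l) -
      (inner ℝ (W0 j r) (μ l) + sgn j * (signalCoeff μ η S W0 t j r l * ‖μ l‖ ^ 2))| ≤
      e * (η / (n * m : ℝ) * totalWeight μ η S W0 t * ‖μ 0‖ ^ 2) := by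
  have h0 : 0 ≤ η / (n * m : ℝ) := by positivity
  have h1 : ∑ l' : Fin 2, signalCoeff μ η S W0 t j r l' * inner ℝ (μ l') (μ l)
      = signalCoeff μ η S W0 t j r l * ‖μ l‖ ^ 2 := by
    rw [Finset.sum_eq_single l, real_inner_self_eq_norm_sq]
    · intro l' _ hl'
      rw [H.feature_inner_of_ne hl', mul_zero]
    · simp
  rw [inner_gdIter, h1, add_sub_cancel_left]
  refine (Finset.abs_sum_le_sum_abs _ _).trans ?_
  calc _ ≤ ∑ i : Fin n, η / (n * m : ℝ) * cumWeight μ η S W0 t i * (e * ‖μ 0‖ ^ 2) := by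
        refine Finset.sum_le_sum fun i _ => ?_
        rw [abs_mul]
        refine mul_le_mul (abs_noiseCoeff_le hη t j r i) ?_ (abs_nonneg _)
          (mul_nonneg h0 (cumWeight_nonneg _ _))
        rw [real_inner_comm]
        exact H.feature_inner_noise' l i
    _ = _ := by
        rw [totalWeight, ← Finset.sum_mul, ← Finset.mul_sum]; ring

/-- Up to a small error, only the coefficient of `ξ_i` acts on `ξ_i`. -/
lemma abs_inner_noise_sub_le (hη : 0 ≤ η) (t : ℕ) (j : Bool) (r : Fin m) (i : Fin n) :
    |inner ℝ (gdIter μ η S W0 t j r) (S i).noise -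
      (inner ℝ (W0 j r) (S i).noise + noiseCoeff μ η S W0 t j r i * ‖(S i).noise‖ ^ 2)| ≤
      2 * e * (η / (n * m : ℝ) * D * (totalWeight μ η S W0 t / n)) := by
  have h0 : 0 ≤ η / (n * m : ℝ) := by positivity
  have hn := H.n_pos'
  have hΛ := totalWeight_nonneg (μ := μ) (η := η) (S := S) (W0 := W0) t
  have hsum : ∑ k : Fin n, noiseCoeff μ η S W0 t j r k * inner ℝ (S k).noise (S i).noise
      = noiseCoeff μ η S W0 t j r i * ‖(S i).noise‖ ^ 2 + ∑ k ∈ Finset.univ.erase i,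
        noiseCoeff μ η S W0 t j r k * inner ℝ (S k).noise (S i).noise := by
    rw [← Finset.add_sum_erase _ _ (Finset.mem_univ i), real_inner_self_eq_norm_sq]
  rw [inner_gdIter, hsum]
  have h1 : |sgn j * ∑ l : Fin 2, signalCoeff μ η S W0 t j r l * inner ℝ (μ l) (S i).noise| ≤
      2 * (η / (n * m : ℝ) * totalWeight μ η S W0 t * (e * ‖μ 0‖ ^ 2)) := by
    rw [abs_mul, abs_sgn, one_mul]
    refine (Finset.abs_sum_le_sum_abs _ _).trans ?_
    calc _ ≤ ∑ _l : Fin 2, η / (n * m : ℝ) * totalWeight μ η S W0 t * (e * ‖μ 0‖ ^ 2) := by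
          refine Finset.sum_le_sum fun l _ => ?_
          rw [abs_mul, abs_of_nonneg (signalCoeff_nonneg hη t j r l)]
          exact mul_le_mul (signalCoeff_le hη t j r l) (H.feature_inner_noise' l i) (abs_nonneg _)
            (mul_nonneg h0 hΛ)
      _ = _ := by simp
  have h2 : |∑ k ∈ Finset.univ.erase i,
        noiseCoeff μ η S W0 t j r k * inner ℝ (S k).noise (S i).noise| ≤
      η / (n * m : ℝ) * totalWeight μ η S W0 t * (e * D / n) := by
    refine (Finset.abs_sum_le_sum_abs _ _).trans ?_
    have he := H.e_pos
    have hD := H.D_pos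
    calc _ ≤ ∑ k ∈ Finset.univ.erase i,
          η / (n * m : ℝ) * cumWeight μ η S W0 t k * (e * D / n) := by
          refine Finset.sum_le_sum fun k hk => ?_
          rw [abs_mul]
          exact mul_le_mul (abs_noiseCoeff_le hη t j r k)
            (H.noise_inner_noise k i (Finset.ne_of_mem_erase hk)) (abs_nonneg _)
            (mul_nonneg h0 (cumWeight_nonneg _ _))
      _ ≤ ∑ k, η / (n * m : ℝ) * cumWeight μ η S W0 t k * (e * D / n) :=
          Finset.sum_le_univ_sum_of_nonneg fun k =>
            mul_nonneg (mul_nonneg h0 (cumWeight_nonneg _ _)) (by positivity)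
      _ = _ := by
        rw [totalWeight, ← Finset.sum_mul, ← Finset.mul_sum]
  -- The features contribute only at second order in e: one factor is the feature-noise correlation,
  -- the other comes from ‖μ 0‖² ≤ eD/n.
  have h3 : 2 * (η / (n * m : ℝ) * totalWeight μ η S W0 t * (e * ‖μ 0‖ ^ 2)) ≤
      2 * e * (e * (η / (n * m : ℝ) * totalWeight μ η S W0 t * (D / n))) := by
    have h4 : ‖μ 0‖ ^ 2 ≤ e * (D / n) := by
      rw [← mul_div_assoc, le_div_iff₀ hn]; linarith [H.dim_ge]
    have h5 : 0 ≤ η / (n * m : ℝ) * totalWeight μ η S W0 t := mul_nonneg h0 hΛ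
    have := mul_le_mul_of_nonneg_left h4 (mul_nonneg (mul_nonneg (zero_le_two (α := ℝ)) H.e_pos.le) h5)
    linarith
  have h6 : 0 ≤ η / (n * m : ℝ) * totalWeight μ η S W0 t * (D / n) :=
    mul_nonneg (mul_nonneg h0 hΛ) (div_nonneg H.D_pos.le hn.le)
  have h7 : η / (n * m : ℝ) * totalWeight μ η S W0 t * (e * D / n)
      = e * (η / (n * m : ℝ) * totalWeight μ η S W0 t * (D / n)) := by ring
  have h8 : η / (n * m : ℝ) * D * (totalWeight μ η S W0 t / n)
      = η / (n * m : ℝ) * totalWeight μ η S W0 t * (D / n) := by ring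
  rw [h8]
  have he := H.e_le
  have he0 := H.e_pos
  have h9 : e * (e * (η / (n * m : ℝ) * totalWeight μ η S W0 t * (D / n))) ≤
      1 / 2 * (e * (η / (n * m : ℝ) * totalWeight μ η S W0 t * (D / n))) :=
    mul_le_mul_of_nonneg_right (by linarith) (mul_nonneg he0.le h6)
  rw [abs_le] at h1 h2 ⊢
  constructor <;> linarith

lemma abs_inner_feature_le (hη : 0 ≤ η) (t : ℕ) (j : Bool) (r : Fin m) (l : Fin 2) :
    |inner ℝ (gdIter μ η S W0 t j r) (μ l)| ≤ e * (n * ‖μ 0‖ ^ 2 / D) +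
      η / (n * m : ℝ) * totalWeight μ η S W0 t * (‖μ l‖ ^ 2 + e * ‖μ 0‖ ^ 2) := by
  have h := H.abs_inner_feature_sub_le hη t j r l
  have h1 := H.init_inner_feature j r l
  have h2 : |sgn j * (signalCoeff μ η S W0 t j r l * ‖μ l‖ ^ 2)| ≤
      η / (n * m : ℝ) * totalWeight μ η S W0 t * ‖μ l‖ ^ 2 := by
    rw [abs_mul, abs_sgn, one_mul, abs_of_nonneg (mul_nonneg (signalCoeff_nonneg hη t j r l)
      (sq_nonneg _))]
    exact mul_le_mul_of_nonneg_right (signalCoeff_le hη t j r l) (sq_nonneg _)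
  rw [abs_le] at h h1 h2 ⊢
  constructor <;> linarith

/-- Since n‖μ 0‖² ≤ eD, even the strong feature is negligible on the scale A of the memorised noise,
so features do not disturb the training margins. -/
lemma abs_inner_feature_le' (hη : 0 ≤ η) (t : ℕ) (j : Bool) (r : Fin m) (l : Fin 2) :
    |inner ℝ (gdIter μ η S W0 t j r) (μ l)| ≤ e +
      2 * e * (η / (n * m : ℝ) * D * (totalWeight μ η S W0 t / n)) := by
  refine (H.abs_inner_feature_le hη t j r l).trans ?_
  have hn := H.n_pos'
  have he := H.e_pos
  have he1 := H.e_le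
  have hD := H.D_pos
  have h0 : 0 ≤ η / (n * m : ℝ) * totalWeight μ η S W0 t :=
    mul_nonneg (by positivity) (totalWeight_nonneg t)
  have h1 : n * ‖μ 0‖ ^ 2 / D ≤ 1 := by
    rw [div_le_one hD]; nlinarith [H.dim_ge]
  have h4 : ‖μ 0‖ ^ 2 ≤ e * (D / n) := by
    rw [← mul_div_assoc, le_div_iff₀ hn]; linarith [H.dim_ge]
  have h5 : ‖μ l‖ ^ 2 + e * ‖μ 0‖ ^ 2 ≤ 2 * (e * (D / n)) := by
    have := H.norm_feature_le l
    nlinarith [sq_nonneg ‖μ 0‖]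
  have h6 := mul_le_mul_of_nonneg_left h5 h0
  have h7 : 2 * e * (η / (n * m : ℝ) * D * (totalWeight μ η S W0 t / n)) =
    η / (n * m : ℝ) * totalWeight μ η S W0 t * (2 * (e * (D / n))) := by ring
  nlinarith

/-- The cumulative loss weights of any two samples are comparable. -/
lemma totalWeight_div_le {t : ℕ} (hb : ∀ i k, cumWeight μ η S W0 t i ≤ 40 * cumWeight μ η S W0 t k)
    (i : Fin n) : totalWeight μ η S W0 t / n ≤ 40 * cumWeight μ η S W0 t i := by
  rw [div_le_iff₀ H.n_pos']
  calc _ ≤ ∑ _k : Fin n, 40 * cumWeight μ η S W0 t i := Finset.sum_le_sum fun k _ => hb k i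
    _ = _ := by simp; ring

lemma cumWeight_le {t : ℕ} (hb : ∀ i k, cumWeight μ η S W0 t i ≤ 40 * cumWeight μ η S W0 t k)
    (i : Fin n) : cumWeight μ η S W0 t i ≤ 40 * (totalWeight μ η S W0 t / n) := by
  rw [← mul_div_assoc, le_div_iff₀ H.n_pos', totalWeight, Finset.mul_sum]
  calc _ = ∑ _k : Fin n, cumWeight μ η S W0 t i := by simp; ring
    _ ≤ _ := Finset.sum_le_sum fun k _ => hb i k

/-- Balance replaces the average cumulative weight by that of sample i at the cost of a factor 40,
and 80e ≤ 1/1000. -/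
lemma error_le (hη : 0 ≤ η) {t : ℕ}
    (hb : ∀ i k, cumWeight μ η S W0 t i ≤ 40 * cumWeight μ η S W0 t k) (i : Fin n) :
    2 * e * (η / (n * m : ℝ) * D * (totalWeight μ η S W0 t / n)) ≤
      1 / 1000 * (η / (n * m : ℝ) * D * cumWeight μ η S W0 t i) := by
  have h1 : η / (n * m : ℝ) * D * (totalWeight μ η S W0 t / n) ≤
      η / (n * m : ℝ) * D * (40 * cumWeight μ η S W0 t i) :=
    mul_le_mul_of_nonneg_left (H.totalWeight_div_le hb i)
      (mul_nonneg (by positivity) H.D_pos.le)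
  have h2 : 0 ≤ η / (n * m : ℝ) * D * cumWeight μ η S W0 t i :=
    mul_nonneg (mul_nonneg (by positivity) H.D_pos.le) (cumWeight_nonneg _ _)
  have he := H.e_le
  have he0 := H.e_pos
  calc _ ≤ 2 * e * (η / (n * m : ℝ) * D * (40 * cumWeight μ η S W0 t i)) := by gcongr
    _ = 80 * e * (η / (n * m : ℝ) * D * cumWeight μ η S W0 t i) := by ring
    _ ≤ _ := by gcongr; linarith

/-- A neuron that was always active on ξ_i has stored all of Λ_i. As ‖ξ_i‖² ≥ D/2 this is worth half
of ηDΛ_i/(nm), the initial response only helps, and the cross terms cost 1/1000. Positivity of the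
bound is what keeps the neuron active in the induction of `balanced_and_active`. -/
lemma two_fifths_le_inner_noise (hη : 0 ≤ η) {t : ℕ}
    (hb : ∀ i k, cumWeight μ η S W0 t i ≤ 40 * cumWeight μ η S W0 t k) {i : Fin n} {r : Fin m}
    (h0 : 0 ≤ inner ℝ (W0 (S i).label r) (S i).noise)
    (h : ∀ s < t, 0 ≤ inner ℝ (gdIter μ η S W0 s (S i).label r) (S i).noise) :
    2 / 5 * (η / (n * m : ℝ) * D * cumWeight μ η S W0 t i) ≤
      inner ℝ (gdIter μ η S W0 t (S i).label r) (S i).noise := by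
  have h1 := (abs_le.1 (H.abs_inner_noise_sub_le hη t (S i).label r i)).1
  rw [noiseCoeff_of_active h] at h1
  have h2 := H.error_le hη hb i
  have h3 : η / (n * m : ℝ) * cumWeight μ η S W0 t i * (D / 2) ≤
      η / (n * m : ℝ) * cumWeight μ η S W0 t i * ‖(S i).noise‖ ^ 2 :=
    mul_le_mul_of_nonneg_left (H.le_norm_noise i)
      (mul_nonneg (by positivity) (cumWeight_nonneg _ _))
  have h4 : 0 ≤ η / (n * m : ℝ) * D * cumWeight μ η S W0 t i :=
    mul_nonneg (mul_nonneg (by positivity) H.D_pos.le) (cumWeight_nonneg _ _)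
  linarith

/-- No neuron can store more than Λ_i, which is worth at most 2ηDΛ_i/(nm) because ‖ξ_i‖² ≤ 2D; the
competing partial network is nonnegative and is dropped. -/
lemma margin_le (hη : 0 ≤ η) {t : ℕ}
    (hb : ∀ i k, cumWeight μ η S W0 t i ≤ 40 * cumWeight μ η S W0 t k) (i : Fin n) :
    margin μ η S W0 t i ≤ 21 / 10 * (η / (n * m : ℝ) * D * cumWeight μ η S W0 t i) + 1 / 10 := by
  have herr := H.error_le hη hb i
  have he := H.e_le
  have h4 : 0 ≤ η / (n * m : ℝ) * D * cumWeight μ η S W0 t i :=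
    mul_nonneg (mul_nonneg (by positivity) H.D_pos.le) (cumWeight_nonneg _ _)
  have h0 : 0 ≤ η / (n * m : ℝ) * cumWeight μ η S W0 t i :=
    mul_nonneg (by positivity) (cumWeight_nonneg _ _)
  rw [margin, sgn_mul_net]
  have hp : partialNet (gdIter μ η S W0 t) (S i).label ((S i).patch μ) ≤
      21 / 10 * (η / (n * m : ℝ) * D * cumWeight μ η S W0 t i) + 1 / 10 := by
    refine partialNet_le H.m_pos fun r => ?_
    rw [Fin.sum_univ_two]
    have h1 : relu (inner ℝ (gdIter μ η S W0 t (S i).label r) ((S i).patch μ 0)) ≤ e +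
        2 * e * (η / (n * m : ℝ) * D * (totalWeight μ η S W0 t / n)) := by
      refine (relu_le_abs _).trans ?_
      change |inner ℝ _ (sgn (S i).label • μ (S i).feature)| ≤ _
      rw [inner_smul_right, abs_mul, abs_sgn, one_mul]
      exact H.abs_inner_feature_le' hη t _ r _
    have h2 : relu (inner ℝ (gdIter μ η S W0 t (S i).label r) ((S i).patch μ 1)) ≤
        2 * (η / (n * m : ℝ) * D * cumWeight μ η S W0 t i) + e
          + 1 / 1000 * (η / (n * m : ℝ) * D * cumWeight μ η S W0 t i) := by
      refine relu_le (by linarith [H.e_pos]) ?_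
      change inner ℝ _ (S i).noise ≤ _
      have h5 := (abs_le.1 (H.abs_inner_noise_sub_le hη t (S i).label r i)).2
      have h6 := (abs_le.1 (H.init_inner_noise (S i).label r i)).2
      have h7 : noiseCoeff μ η S W0 t (S i).label r i * ‖(S i).noise‖ ^ 2 ≤
          η / (n * m : ℝ) * cumWeight μ η S W0 t i * (2 * D) :=
        mul_le_mul ((le_abs_self _).trans (abs_noiseCoeff_le hη t _ r i)) (H.norm_noise_le i)
          (sq_nonneg _) h0
      linarith
    linarith
  linarith [partialNet_nonneg (gdIter μ η S W0 t) (!(S i).label) ((S i).patch μ)]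

/-- The quarter of the neurons that start active contributes (2/5)/4 = 1/10 of ηDΛ_i/(nm). The
neurons of the other sign have not stored ξ_i, so they respond only through errors, which take at
most 1/100 of it and the additive 1/10. -/
lemma le_margin (hη : 0 ≤ η) {t : ℕ}
    (hb : ∀ i k, cumWeight μ η S W0 t i ≤ 40 * cumWeight μ η S W0 t k)
    (h : ∀ s < t, ∀ i r, 0 ≤ inner ℝ (W0 (S i).label r) (S i).noise →
      0 ≤ inner ℝ (gdIter μ η S W0 s (S i).label r) (S i).noise) (i : Fin n) :
    9 / 100 * (η / (n * m : ℝ) * D * cumWeight μ η S W0 t i) - 1 / 10 ≤ margin μ η S W0 t i := by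
  have herr := H.error_le hη hb i
  have he := H.e_le
  have h4 : 0 ≤ η / (n * m : ℝ) * D * cumWeight μ η S W0 t i :=
    mul_nonneg (mul_nonneg (by positivity) H.D_pos.le) (cumWeight_nonneg _ _)
  rw [margin, sgn_mul_net]
  have hp : 2 / 5 * (η / (n * m : ℝ) * D * cumWeight μ η S W0 t i) / 4 ≤
      partialNet (gdIter μ η S W0 t) (S i).label ((S i).patch μ) := by
    refine le_partialNet_of_card H.m_pos (by positivity) _ (H.active_neurons i) fun r hr => ?_
    have hr' := (Finset.mem_filter.1 hr).2
    exact H.two_fifths_le_inner_noise hη hb hr' fun s hs => h s hs i r hr'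
  have hq : partialNet (gdIter μ η S W0 t) (!(S i).label) ((S i).patch μ) ≤
      1 / 100 * (η / (n * m : ℝ) * D * cumWeight μ η S W0 t i) + 1 / 10 := by
    refine partialNet_le H.m_pos fun r => ?_
    rw [Fin.sum_univ_two]
    have h1 : relu (inner ℝ (gdIter μ η S W0 t (!(S i).label) r) ((S i).patch μ 0)) ≤ e +
        2 * e * (η / (n * m : ℝ) * D * (totalWeight μ η S W0 t / n)) := by
      refine (relu_le_abs _).trans ?_
      change |inner ℝ _ (sgn (S i).label • μ (S i).feature)| ≤ _
      rw [inner_smul_right, abs_mul, abs_sgn, one_mul]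
      exact H.abs_inner_feature_le' hη t _ r _
    have h2 : relu (inner ℝ (gdIter μ η S W0 t (!(S i).label) r) ((S i).patch μ 1)) ≤
        e + 1 / 1000 * (η / (n * m : ℝ) * D * cumWeight μ η S W0 t i) := by
      refine relu_le (by linarith [H.e_pos]) ?_
      change inner ℝ _ (S i).noise ≤ _
      have h5 := (abs_le.1 (H.abs_inner_noise_sub_le hη t (!(S i).label) r i)).2
      have h6 := (abs_le.1 (H.init_inner_noise (!(S i).label) r i)).2
      have h7 : noiseCoeff μ η S W0 t (!(S i).label) r i * ‖(S i).noise‖ ^ 2 ≤ 0 :=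
        mul_nonpos_of_nonpos_of_nonneg (noiseCoeff_not_label_nonpos hη t r i) (sq_nonneg _)
      linarith
    linarith
  linarith

/-- The initial margins are at most 1/10, so the first step alone contributes this much. It allows a
single increment, which is at most 1, to be absorbed into a multiple of the cumulative weight. -/
lemma one_third_le_cumWeight (hη : 0 ≤ η) {t : ℕ} (ht : 0 < t) (i : Fin n) :
    1 / 3 ≤ cumWeight μ η S W0 t i := by
  have h0 : margin μ η S W0 0 i ≤ 1 / 10 := by
    have := H.margin_le (η := η) (t := 0) hη (by simp [cumWeight_zero]) i
    simpa [cumWeight_zero] using this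
  have h1 : 1 / 3 ≤ lossWeight μ η S W0 0 i := by
    unfold lossWeight
    have h2 : Real.exp (margin μ η S W0 0 i) ≤ 2 := by
      have h3 := Real.exp_bound_div_one_sub_of_interval (x := 1 / 10) (by norm_num) (by norm_num)
      have h4 := Real.exp_le_exp.2 h0
      norm_num at h3
      linarith
    exact one_div_le_one_div_of_le (by positivity) (by linarith)
  refine h1.trans ?_
  exact Finset.single_le_sum (f := fun s => lossWeight μ η S W0 s i)
    (fun s _ => (lossWeight_pos s i).le) (Finset.mem_range.2 ht)

/-- All cumulative loss weights stay comparable, and neurons which respond to a noise patch of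
their label at initialization do so forever. -/
theorem balanced_and_active (hη : 0 ≤ η) (t : ℕ) :
    (∀ i k, cumWeight μ η S W0 t i ≤ 40 * cumWeight μ η S W0 t k) ∧
    (∀ s < t, ∀ i r, 0 ≤ inner ℝ (W0 (S i).label r) (S i).noise →
      0 ≤ inner ℝ (gdIter μ η S W0 s (S i).label r) (S i).noise) := by
  induction t with
  | zero => simp [cumWeight_zero]
  | succ t ih =>
    obtain ⟨hb, ha⟩ := ih
    refine ⟨fun i k => ?_, fun s hs i r hr => ?_⟩
    · have hgi := lossWeight_le_one (μ := μ) (η := η) (S := S) (W0 := W0) t i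
      have hgk := lossWeight_pos (μ := μ) (η := η) (S := S) (W0 := W0) t k
      -- If the current loss weights respect the ratio 40, the bound is inherited by addition.
      -- Otherwise k has the larger margin, and the two-sided margin bounds improve the ratio to Λ_i
      -- ≤ 30Λ_k; the slack 10Λ_k ≥ 10/3 absorbs the next increment.
      by_cases hg : lossWeight μ η S W0 t i ≤ 40 * lossWeight μ η S W0 t k
      · rw [cumWeight_succ, cumWeight_succ]
        linarith [hb i k]
      · push Not at hg
        -- At t = 0 all cumulative weights vanish, so the slack must come from the first increment
        -- of k.
        rcases Nat.eq_zero_or_pos t with rfl | ht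
        · have := H.one_third_le_cumWeight (η := η) hη (t := 0 + 1) (by norm_num) k
          rw [cumWeight_succ (i := i), cumWeight_zero]
          linarith
        have hk3 := H.one_third_le_cumWeight (η := η) hη ht k
        have hi1 := H.le_margin hη hb ha i
        have hk1 := H.margin_le hη hb k
        set z := η / (n * m : ℝ) * D with hz
        have hz0 : 0 ≤ z := mul_nonneg (by positivity) H.D_pos.le
        set Fi := margin μ η S W0 t i
        set Fk := margin μ η S W0 t k
        have hexp : 40 * (1 + Real.exp Fi) < 1 + Real.exp Fk := by
          have e1 : lossWeight μ η S W0 t i = 1 / (1 + Real.exp Fi) := rfl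
          have e2 : lossWeight μ η S W0 t k = 1 / (1 + Real.exp Fk) := rfl
          rw [e1, e2, ← mul_div_assoc, mul_one, div_lt_div_iff₀ (by positivity) (by positivity)]
            at hg
          linarith
        have hFk : 1 ≤ Fk := by
          have h3 : Real.exp 1 < Real.exp Fk := by
            linarith [Real.exp_one_lt_d9, Real.exp_pos Fi]
          exact (Real.exp_lt_exp.1 h3).le
        have hFik : Fi ≤ Fk := by
          have h3 : Real.exp Fi < Real.exp Fk := by linarith [Real.exp_pos Fi]
          exact (Real.exp_lt_exp.1 h3).le
        -- A margin of k that is at least 1 forces zΛ_k ≥ 3/7, so the additive errors 2/10 are at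
        -- most (6/10)zΛ_k.
        have hzL : 9 / 100 * (z * cumWeight μ η S W0 t i) ≤
            27 / 10 * (z * cumWeight μ η S W0 t k) := by linarith
        have hzk : 0 < z * cumWeight μ η S W0 t k := by linarith
        have hzpos : 0 < z := lt_of_le_of_ne hz0 fun h => by simp [← h] at hzk
        have hL : cumWeight μ η S W0 t i ≤ 30 * cumWeight μ η S W0 t k := by
          refine le_of_mul_le_mul_left ?_ hzpos
          linarith
        rw [cumWeight_succ, cumWeight_succ]
        linarith
    · rcases Nat.lt_succ_iff_lt_or_eq.1 hs with hs' | rfl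
      · exact ha s hs' i r hr
      · refine le_trans ?_ (H.two_fifths_le_inner_noise hη hb hr fun s' hs' => ha s' hs' i r hr)
        exact mul_nonneg (by norm_num)
          (mul_nonneg (mul_nonneg (by positivity) H.D_pos.le) (cumWeight_nonneg _ _))

lemma balanced (hη : 0 ≤ η) (t : ℕ) (i k : Fin n) :
    cumWeight μ η S W0 t i ≤ 40 * cumWeight μ η S W0 t k := (H.balanced_and_active hη t).1 i k

/-- As long as the cumulative loss weight is small, the loss weight is bounded below. -/
lemma le_lossWeight (hη : 0 ≤ η) {t : ℕ} {i : Fin n}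
    (h : η / (n * m : ℝ) * D * cumWeight μ η S W0 t i ≤ 1) :
    1 / 20 ≤ lossWeight μ η S W0 t i := by
  have h1 := H.margin_le hη (H.balanced hη t) i
  have h2 : margin μ η S W0 t i ≤ 22 / 10 := by linarith
  have h3 : Real.exp (22 / 10) ≤ 19 := by
    have h4 : Real.exp (22 / 10) ≤ Real.exp 1 * Real.exp 1 * Real.exp (1 / 5) := by
      rw [← Real.exp_add, ← Real.exp_add]; norm_num
    have h5 := Real.exp_bound_div_one_sub_of_interval (x := 1 / 5) (by norm_num) (by norm_num)
    have h6 := Real.exp_one_lt_d9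
    have h7 := Real.exp_pos 1
    norm_num at h5
    have h8 : Real.exp 1 * Real.exp 1 ≤ 2.8 * 2.8 := by
      apply mul_le_mul <;> linarith
    have h9 : Real.exp 1 * Real.exp 1 * Real.exp (1 / 5) ≤ 2.8 * 2.8 * (5 / 4) := by
      apply mul_le_mul h8 (by simpa using h5) (Real.exp_pos _).le (by norm_num)
    linarith
  unfold lossWeight
  have h10 := (Real.exp_le_exp.2 h2).trans h3
  exact one_div_le_one_div_of_le (by positivity) (by linarith)

/-- Until ηDΛ_i/(nm) exceeds 1 the loss weight is at least 1/20, so growth is linear; afterwards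
monotonicity suffices. This turns a lower bound on the querying time into a lower bound on A. -/
lemma min_le_cumWeight (hη : 0 ≤ η) (t : ℕ) (i : Fin n) :
    min 1 (η / (n * m : ℝ) * D * t / 20) ≤ η / (n * m : ℝ) * D * cumWeight μ η S W0 t i := by
  have hz0 : 0 ≤ η / (n * m : ℝ) * D := mul_nonneg (by positivity) H.D_pos.le
  induction t with
  | zero => simp [cumWeight_zero]
  | succ t ih =>
    rw [cumWeight_succ, mul_add]
    have hg := mul_nonneg hz0 (lossWeight_pos (μ := μ) (η := η) (S := S) (W0 := W0) t i).le
    by_cases h : η / (n * m : ℝ) * D * cumWeight μ η S W0 t i ≤ 1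
    · have h1 := mul_le_mul_of_nonneg_left (H.le_lossWeight hη h) hz0
      push_cast
      rcases min_le_iff.1 ih with h2 | h2
      · exact (min_le_left _ _).trans (by linarith)
      · exact (min_le_right _ _).trans (by linarith)
    · exact (min_le_left _ _).trans (by linarith)

end TypicalTraining

/-! ### Learning of the strong feature, uniqueness of the decomposition, norm of the weights. -/

namespace TypicalTraining

variable {m d n : ℕ} {μ : Fin 2 → Vec d} {η : ℝ} {S : Fin n → Sample d} {W0 : Weights m d}
  {D e : ℝ} (H : TypicalTraining μ S W0 D e)
include H

/-- Each label has at least n/8 strong samples, and by balance each of them carries at least 1/40 of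
the average weight. -/
lemma totalWeight_le_sum_strong (hη : 0 ≤ η) (t : ℕ) (y : Bool) :
    totalWeight μ η S W0 t / 320 ≤
      ∑ i with (S i).feature = 0 ∧ (S i).label = y, cumWeight μ η S W0 t i := by
  classical
  have hn := H.n_pos'
  have h1 : ((Finset.univ.filter fun i => (S i).feature = 0 ∧ (S i).label = y).card : ℝ) *
      (totalWeight μ η S W0 t / n / 40) ≤
      ∑ i with (S i).feature = 0 ∧ (S i).label = y, cumWeight μ η S W0 t i := by
    rw [← nsmul_eq_mul]
    refine Finset.card_nsmul_le_sum _ _ _ fun i _ => ?_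
    linarith [H.totalWeight_div_le (H.balanced hη t) i]
  have h2 : (n : ℝ) / 8 ≤
      (Finset.univ.filter fun i => (S i).feature = 0 ∧ (S i).label = y).card := by
    convert H.strong_samples y
  have h3 : 0 ≤ totalWeight μ η S W0 t / n / 40 :=
    div_nonneg (div_nonneg (totalWeight_nonneg t) hn.le) (by norm_num)
  refine le_trans ?_ ((mul_le_mul_of_nonneg_right h2 h3).trans h1)
  refine le_of_eq ?_
  field_simp
  ring

lemma sgn_mul_inner_feature_ge (hη : 0 ≤ η) (t : ℕ) (j : Bool) (r : Fin m) :
    signalCoeff μ η S W0 t j r 0 * ‖μ 0‖ ^ 2 - e * (n * ‖μ 0‖ ^ 2 / D)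
      - e * (η / (n * m : ℝ) * totalWeight μ η S W0 t * ‖μ 0‖ ^ 2) ≤
      sgn j * inner ℝ (gdIter μ η S W0 t j r) (μ 0) := by
  have h1 := H.abs_inner_feature_sub_le hη t j r 0
  have h2 := H.init_inner_feature j r 0
  rw [abs_le] at h1 h2
  cases j <;> simp only [sgn, Bool.false_eq_true, if_true, if_false] at h1 ⊢ <;> linarith

/-- Every neuron learns the strong feature at a rate comparable to the loss weights. -/
theorem sum_strong_le_signalCoeff (hη : 0 ≤ η) (t : ℕ) (j : Bool) (r : Fin m) :
    η / (n * m : ℝ) * (1 / 160 *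
      ∑ i with (S i).feature = 0 ∧ (S i).label = j, cumWeight μ η S W0 t i) ≤
      signalCoeff μ η S W0 t j r 0 := by
  classical
  have hh : 0 ≤ η / (n * m : ℝ) := by positivity
  have hn := H.n_pos'
  induction t with
  | zero => simp [cumWeight_zero, signalCoeff]
  | succ t ih =>
    -- Whatever the sign of the response to `μ 0`, all strong samples of one label activate the
    -- neuron, and samples of either label increase the same coefficient.
    have hstep : ∀ y : Bool, 0 ≤ sgn y * inner ℝ (gdIter μ η S W0 t j r) (μ 0) →
        signalCoeff μ η S W0 t j r 0 + η / (n * m : ℝ) *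
          ∑ i with (S i).feature = 0 ∧ (S i).label = y, lossWeight μ η S W0 t i ≤
        signalCoeff μ η S W0 (t + 1) j r 0 := by
      intro y hy
      rw [signalCoeff, signalCoeff, Finset.sum_range_succ, mul_add]
      refine add_le_add le_rfl (mul_le_mul_of_nonneg_left ?_ hh)
      rw [Finset.sum_filter]
      refine Finset.sum_le_sum fun i _ => ?_
      by_cases h1 : (S i).feature = 0
      · by_cases h2 : (S i).label = y
        · have h3 : 0 ≤ inner ℝ (gdIter μ η S W0 t j r) ((S i).patch μ 0) := by
            change 0 ≤ inner ℝ _ (sgn (S i).label • μ (S i).feature)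
            rw [inner_smul_right, h1, h2]; exact hy
          simp [h1, h2, reluDeriv_of_nonneg h3]
        · simp only [h1, h2, and_false, if_false, if_true]
          exact mul_nonneg (lossWeight_pos _ _).le (reluDeriv_nonneg _)
      · simp [h1]
    simp only [cumWeight_succ, Finset.sum_add_distrib]
    have hg0 : 0 ≤ ∑ i with (S i).feature = 0 ∧ (S i).label = j, lossWeight μ η S W0 t i :=
      Finset.sum_nonneg fun i _ => (lossWeight_pos _ _).le
    by_cases hj : 0 ≤ sgn j * inner ℝ (gdIter μ η S W0 t j r) (μ 0)
    · have h1 := hstep j hj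
      have h2 := mul_nonneg hh hg0
      linarith
    -- A neuron points the wrong way only while the learned part, bounded below by the induction
    -- hypothesis, has not outgrown the initialisation. Training is then so early that every loss
    -- weight is at least 1/20, and the n/8 strong samples of the other label supply n/160. This
    -- covers the required increment, 1/160 of a sum that is at most n.
    · push Not at hj
      have h1 := hstep (!j) (by rw [sgn_not]; linarith)
      have he := H.e_pos
      have he1 := H.e_le
      have hD := H.D_pos
      have hμ : 0 < ‖μ 0‖ ^ 2 := by have := norm_pos_iff.2 (H.feature_ne 0); positivity
      have h2 := H.sgn_mul_inner_feature_ge hη t j r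
      set x := η / (n * m : ℝ) * totalWeight μ η S W0 t with hx
      have hx0 : 0 ≤ x := mul_nonneg hh (totalWeight_nonneg t)
      have h3 : x / 51200 ≤ signalCoeff μ η S W0 t j r 0 := by
        have := mul_le_mul_of_nonneg_left (H.totalWeight_le_sum_strong hη t j) hh
        linarith
      have h4 : x * D / n ≤ 1 / 40 := by
        have h5 : x / 51200 * ‖μ 0‖ ^ 2 < e * (n * ‖μ 0‖ ^ 2 / D) + e * (x * ‖μ 0‖ ^ 2) := by
          have := mul_le_mul_of_nonneg_right h3 hμ.le
          linarith
        have h6 : x / 51200 < e * (n / D) + e * x := by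
          refine lt_of_mul_lt_mul_right (a := ‖μ 0‖ ^ 2) ?_ hμ.le
          calc _ < _ := h5
            _ = _ := by ring
        have h7 : x / 52000 < 1 / 10000000 * (n / D) := by
          have h8 : e * (n / D) ≤ 1 / 10000000 * (n / D) :=
            mul_le_mul_of_nonneg_right he1 (div_nonneg hn.le hD.le)
          have h9 : e * x ≤ 1 / 10000000 * x := mul_le_mul_of_nonneg_right he1 hx0
          linarith
        rw [div_le_iff₀ hn]
        have h8 : 1 / 10000000 * ((n : ℝ) / D) = (1 / 10000000 * n) / D := by ring
        rw [h8, lt_div_iff₀ hD] at h7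
        linarith
      have h5 : ∀ i, 1 / 20 ≤ lossWeight μ η S W0 t i := by
        intro i
        refine H.le_lossWeight hη ?_
        have h6 := mul_le_mul_of_nonneg_left (H.cumWeight_le (H.balanced hη t) i)
          (mul_nonneg hh hD.le)
        have h7 : η / (n * m : ℝ) * D * (40 * (totalWeight μ η S W0 t / n)) = 40 * (x * D / n) := by
          rw [hx]; ring
        linarith
      have h6 : (n : ℝ) / 160 ≤
          ∑ i with (S i).feature = 0 ∧ (S i).label = !j, lossWeight μ η S W0 t i := by
        have h7 := Finset.card_nsmul_le_sum
          (Finset.univ.filter fun i => (S i).feature = 0 ∧ (S i).label = !j) _ (1 / 20)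
          fun i _ => h5 i
        have h8 : (n : ℝ) / 8 ≤
            (Finset.univ.filter fun i => (S i).feature = 0 ∧ (S i).label = !j).card := by
          convert H.strong_samples (!j)
        rw [nsmul_eq_mul] at h7
        linarith
      have h7 : ∑ i with (S i).feature = 0 ∧ (S i).label = j, lossWeight μ η S W0 t i ≤ n := by
        calc _ ≤ ∑ i, lossWeight μ η S W0 t i :=
              Finset.sum_le_univ_sum_of_nonneg fun i => (lossWeight_pos _ _).le
          _ ≤ ∑ _i : Fin n, (1 : ℝ) := Finset.sum_le_sum fun i _ => lossWeight_le_one _ _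
          _ = n := by simp
      have h8 := mul_le_mul_of_nonneg_left h6 hh
      have h9 := mul_le_mul_of_nonneg_left h7 hh
      linarith

lemma le_signalCoeff_strong (hη : 0 ≤ η) (t : ℕ) (j : Bool) (r : Fin m) :
    η / (n * m : ℝ) * totalWeight μ η S W0 t / 51200 ≤ signalCoeff μ η S W0 t j r 0 := by
  have h1 := H.sum_strong_le_signalCoeff hη t j r
  have h2 := mul_le_mul_of_nonneg_left (H.totalWeight_le_sum_strong hη t j)
    (show 0 ≤ η / (n * m : ℝ) by positivity)
  linarith

lemma min_le_totalWeight (hη : 0 ≤ η) (t : ℕ) :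
    min 1 (η / (n * m : ℝ) * D * t / 20) ≤
      η / (n * m : ℝ) * D * (totalWeight μ η S W0 t / n) := by
  rw [← mul_div_assoc, le_div_iff₀ H.n_pos', totalWeight, Finset.mul_sum]
  calc _ = ∑ _i : Fin n, min 1 (η / (n * m : ℝ) * D * t / 20) := by simp; ring
    _ ≤ _ := Finset.sum_le_sum fun i _ => H.min_le_cumWeight hη t i

/-- A combination of the features and the noise patches vanishes only if it is trivial. -/
lemma eq_zero_of_combination (x : Fin 2 → ℝ) (y : Fin n → ℝ)
    (h : ∑ l, x l • μ l + ∑ i, y i • (S i).noise = 0) : x = 0 ∧ y = 0 := by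
  have hn := H.n_pos'
  have he := H.e_pos
  have he1 := H.e_le
  have hD := H.D_pos
  have : Nonempty (Fin n) := ⟨⟨0, H.n_pos⟩⟩
  -- Diagonal dominance at the largest noise coefficient: pairing with the features bounds `x` by a
  -- small multiple of n|y i|, and pairing with ξ_i then forces y i = 0.
  obtain ⟨i, hi⟩ := Finite.exists_max fun i => |y i|
  have hin : ∀ v : Vec d, ∑ l, x l * inner ℝ (μ l) v + ∑ i, y i * inner ℝ (S i).noise v = 0 := by
    intro v
    have := congrArg (fun u => inner ℝ u v) h
    simpa only [inner_add_left, sum_inner, real_inner_smul_left, inner_zero_left] using this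
  have hx : ∀ l, |x l| ≤ n * |y i| * e := by
    intro l
    have hμ : 0 < ‖μ l‖ ^ 2 := by have := norm_pos_iff.2 (H.feature_ne l); positivity
    have h1 := hin (μ l)
    have h2 : ∑ l' : Fin 2, x l' * inner ℝ (μ l') (μ l) = x l * ‖μ l‖ ^ 2 := by
      rw [Finset.sum_eq_single l, real_inner_self_eq_norm_sq]
      · intro l' _ hl'
        rw [H.feature_inner_of_ne hl', mul_zero]
      · simp
    rw [h2] at h1
    have h3 : |∑ k, y k * inner ℝ (S k).noise (μ l)| ≤ n * |y i| * e * ‖μ l‖ ^ 2 := by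
      refine (Finset.abs_sum_le_sum_abs _ _).trans ?_
      calc _ ≤ ∑ _k : Fin n, |y i| * (e * ‖μ l‖ ^ 2) := by
            refine Finset.sum_le_sum fun k _ => ?_
            rw [abs_mul, real_inner_comm]
            exact mul_le_mul (hi k) (H.feature_inner_noise l k) (abs_nonneg _) (abs_nonneg _)
        _ = _ := by simp; ring
    refine le_of_mul_le_mul_right ?_ hμ
    calc |x l| * ‖μ l‖ ^ 2 = |x l * ‖μ l‖ ^ 2| := by rw [abs_mul, abs_of_pos hμ]
      _ = |∑ k, y k * inner ℝ (S k).noise (μ l)| := by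
        rw [eq_neg_of_add_eq_zero_left h1, abs_neg]
      _ ≤ _ := h3
  have hy : y i = 0 := by
    have h1 := hin (S i).noise
    rw [← Finset.add_sum_erase _ _ (Finset.mem_univ i), real_inner_self_eq_norm_sq] at h1
    have h2 : |∑ l, x l * inner ℝ (μ l) (S i).noise| ≤ 2 * (|y i| * (e * D)) := by
      refine (Finset.abs_sum_le_sum_abs _ _).trans ?_
      calc _ ≤ ∑ _l : Fin 2, |y i| * (e * D) := by
            refine Finset.sum_le_sum fun l _ => ?_
            rw [abs_mul]
            calc _ ≤ n * |y i| * e * (e * ‖μ 0‖ ^ 2) :=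
                  mul_le_mul (hx l) (H.feature_inner_noise' l i) (abs_nonneg _) (by positivity)
              _ = |y i| * e * e * (n * ‖μ 0‖ ^ 2) := by ring
              _ ≤ |y i| * e * e * (e * D) := mul_le_mul_of_nonneg_left H.dim_ge (by positivity)
              _ ≤ |y i| * e * 1 * (1 * D) := by gcongr <;> linarith
              _ = _ := by ring
        _ = _ := by simp
    have h3 : |∑ k ∈ Finset.univ.erase i, y k * inner ℝ (S k).noise (S i).noise| ≤
        |y i| * (e * D) := by
      refine (Finset.abs_sum_le_sum_abs _ _).trans ?_
      calc _ ≤ ∑ k ∈ Finset.univ.erase i, |y i| * (e * D / n) := by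
            refine Finset.sum_le_sum fun k hk => ?_
            rw [abs_mul]
            exact mul_le_mul (hi k) (H.noise_inner_noise k i (Finset.ne_of_mem_erase hk))
              (abs_nonneg _) (abs_nonneg _)
        _ ≤ ∑ _k : Fin n, |y i| * (e * D / n) :=
            Finset.sum_le_univ_sum_of_nonneg fun k => by positivity
        _ = _ := by
          simp only [Finset.sum_const, Finset.card_univ, Fintype.card_fin, nsmul_eq_mul]
          field_simp
    have h4 : |y i| * (D / 2) ≤ |y i * ‖(S i).noise‖ ^ 2| := by
      rw [abs_mul, abs_of_nonneg (sq_nonneg ‖(S i).noise‖)]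
      exact mul_le_mul_of_nonneg_left (H.le_norm_noise i) (abs_nonneg _)
    have h5 : |y i * ‖(S i).noise‖ ^ 2| ≤ 3 * (|y i| * (e * D)) := by
      have h6 : y i * ‖(S i).noise‖ ^ 2 = -(∑ l, x l * inner ℝ (μ l) (S i).noise) -
        ∑ k ∈ Finset.univ.erase i, y k * inner ℝ (S k).noise (S i).noise := by linarith
      rw [h6]
      refine (abs_sub _ _).trans ?_
      rw [abs_neg]; linarith
    by_contra hne
    have h7 : 0 < |y i| * D := mul_pos (abs_pos.2 hne) hD
    nlinarith
  constructor
  · funext l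
    have := hx l
    rw [hy, abs_zero, mul_zero, zero_mul] at this
    simpa using this
  · funext k
    have := hi k
    rw [hy, abs_zero] at this
    simpa using this

lemma noise_ne_zero (i : Fin n) : (S i).noise ≠ 0 := by
  intro h
  have := H.le_norm_noise i
  rw [h, norm_zero] at this
  linarith [H.D_pos]

lemma isSignalNoiseDecomp_unique {W : Weights m d}
    {c c' : (Bool → Fin m → Fin 2 → ℝ) × (Bool → Fin m → Fin n → ℝ)}
    (hc : IsSignalNoiseDecomp μ S W0 W c) (hc' : IsSignalNoiseDecomp μ S W0 W c') : c = c' := by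
  have key : ∀ j r, (∀ l, c.1 j r l = c'.1 j r l) ∧ ∀ i, c.2 j r i = c'.2 j r i := by
    intro j r
    have h1 := (hc j r).symm.trans (hc' j r)
    have h2 : ∑ l, (sgn j * (c.1 j r l / ‖μ l‖ ^ 2 - c'.1 j r l / ‖μ l‖ ^ 2)) • μ l +
        ∑ i, (c.2 j r i / ‖(S i).noise‖ ^ 2 - c'.2 j r i / ‖(S i).noise‖ ^ 2) • (S i).noise = 0 := by
      simp only [mul_smul, ← Finset.smul_sum, sub_smul, Finset.sum_sub_distrib, smul_sub]
      rw [add_assoc, add_assoc, add_right_inj] at h1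
      rw [← sub_eq_zero] at h1
      rw [← h1]; abel
    obtain ⟨h3, h4⟩ := H.eq_zero_of_combination _ _ h2
    constructor
    · intro l
      have h5 := congrFun h3 l
      have hμ : ‖μ l‖ ^ 2 ≠ 0 := pow_ne_zero _ (norm_ne_zero_iff.2 (H.feature_ne l))
      have hs : sgn j ≠ 0 := by cases j <;> simp [sgn]
      simp only [Pi.zero_apply, mul_eq_zero, hs, false_or] at h5
      rw [← sub_div, div_eq_zero_iff, or_iff_left hμ, sub_eq_zero] at h5
      exact h5
    · intro i
      have h5 := congrFun h4 i
      have hξ : ‖(S i).noise‖ ^ 2 ≠ 0 := pow_ne_zero _ (norm_ne_zero_iff.2 (H.noise_ne_zero i))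
      simp only [Pi.zero_apply] at h5
      rw [← sub_div, div_eq_zero_iff, or_iff_left hξ, sub_eq_zero] at h5
      exact h5
  refine Prod.ext ?_ ?_
  · funext j r l; exact (key j r).1 l
  · funext j r i; exact (key j r).2 i

/-- Near orthogonality gives growth like √n instead of n: each row of the Gram matrix has absolute
sum at most (2 + e)D ≤ 3D, and 3 ≤ 2². -/
lemma norm_sum_noise_le (y : Fin n → ℝ) {B : ℝ} (hB : ∀ i, |y i| ≤ B) :
    ‖∑ i, y i • (S i).noise‖ ≤ 2 * (B * Real.sqrt (n * D)) := by
  have hn := H.n_pos'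
  have he := H.e_pos
  have he1 := H.e_le
  have hD := H.D_pos
  have hB0 : 0 ≤ B := (abs_nonneg _).trans (hB ⟨0, H.n_pos⟩)
  refine le_of_sq_le_sq ?_ (by positivity)
  rw [mul_pow, mul_pow, Real.sq_sqrt (by positivity), ← real_inner_self_eq_norm_sq, sum_inner]
  have h1 : ∀ i, inner ℝ (y i • (S i).noise) (∑ k, y k • (S k).noise) ≤ B ^ 2 * (3 * D) := by
    intro i
    rw [inner_sum, ← Finset.add_sum_erase _ _ (Finset.mem_univ i)]
    have h2 : inner ℝ (y i • (S i).noise) (y i • (S i).noise) ≤ B ^ 2 * (2 * D) := by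
      rw [real_inner_smul_left, real_inner_smul_right, real_inner_self_eq_norm_sq, ← mul_assoc,
        ← sq, ← sq_abs]
      exact mul_le_mul (pow_le_pow_left₀ (abs_nonneg _) (hB i) 2) (H.norm_noise_le i)
        (sq_nonneg _) (by positivity)
    have h3 : ∑ k ∈ Finset.univ.erase i, inner ℝ (y i • (S i).noise) (y k • (S k).noise) ≤
        B ^ 2 * (e * D) := by
      calc _ ≤ ∑ k ∈ Finset.univ.erase i, B ^ 2 * (e * D / n) := by
            refine Finset.sum_le_sum fun k hk => ?_
            rw [real_inner_smul_left, real_inner_smul_right, ← mul_assoc]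
            refine (le_abs_self _).trans ?_
            rw [abs_mul, abs_mul, sq]
            exact mul_le_mul (mul_le_mul (hB i) (hB k) (abs_nonneg _) hB0)
              (H.noise_inner_noise i k (Finset.ne_of_mem_erase hk).symm) (abs_nonneg _)
              (by positivity)
        _ ≤ ∑ _k : Fin n, B ^ 2 * (e * D / n) :=
            Finset.sum_le_univ_sum_of_nonneg fun k => by positivity
        _ = _ := by
          simp only [Finset.sum_const, Finset.card_univ, Fintype.card_fin, nsmul_eq_mul]
          field_simp
    have h4 : B ^ 2 * (e * D) ≤ B ^ 2 * (1 * D) := by gcongr; linarith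
    linarith
  calc _ ≤ ∑ _i : Fin n, B ^ 2 * (3 * D) := Finset.sum_le_sum fun i _ => h1 i
    _ = n * (B ^ 2 * (3 * D)) := by simp
    _ ≤ _ := by
      have : 0 ≤ n * (B ^ 2 * D) := by positivity
      linarith

/-- The norm of the weights is controlled by the cumulative loss weights. -/
lemma norm_gdIter_le (hη : 0 ≤ η) (t : ℕ) (j : Bool) (r : Fin m) :
    ‖gdIter μ η S W0 t j r‖ ≤
      (1 + 82 * (η / (n * m : ℝ) * D * (totalWeight μ η S W0 t / n))) * Real.sqrt (n / D) := by
  have hn := H.n_pos'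
  have he1 := H.e_le
  have hD := H.D_pos
  have hh : 0 ≤ η / (n * m : ℝ) := by positivity
  have hΛ := totalWeight_nonneg (μ := μ) (η := η) (S := S) (W0 := W0) t
  set q := Real.sqrt (n / D) with hq
  have hq2 : q * q = n / D := Real.mul_self_sqrt (by positivity)
  have hq0 : 0 < q := Real.sqrt_pos.2 (by positivity)
  have hμ : ‖μ 0‖ * q ≤ 1 := by
    have h1 : (‖μ 0‖ * q) ^ 2 ≤ 1 := by
      rw [mul_pow, sq q, hq2, ← mul_div_assoc, div_le_one hD]
      nlinarith [H.dim_ge]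
    nlinarith [norm_nonneg (μ 0)]
  have hμl : ∀ l, ‖μ l‖ ≤ ‖μ 0‖ := fun l =>
    le_of_sq_le_sq (H.norm_feature_le l) (norm_nonneg _)
  have hDn : D * (1 / n) * (q * q) = 1 := by rw [hq2]; field_simp
  set x := η / (n * m : ℝ) * totalWeight μ η S W0 t with hx
  have hx0 : 0 ≤ x := mul_nonneg hh hΛ
  have hA : η / (n * m : ℝ) * D * (totalWeight μ η S W0 t / n) = x * (D * (1 / n)) := by
    rw [hx]; ring
  rw [hA, gdIter_eq]
  have h1 : ‖sgn j • ∑ l : Fin 2, signalCoeff μ η S W0 t j r l • μ l‖ ≤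
      2 * (x * (D * (1 / n)) * q) := by
    rw [norm_smul, Real.norm_eq_abs, abs_sgn, one_mul]
    refine (norm_sum_le _ _).trans ?_
    calc _ ≤ ∑ _l : Fin 2, x * (D * (1 / n)) * q := by
          refine Finset.sum_le_sum fun l _ => ?_
          rw [norm_smul, Real.norm_eq_abs, abs_of_nonneg (signalCoeff_nonneg hη t j r l)]
          calc _ ≤ x * ‖μ 0‖ := mul_le_mul (signalCoeff_le hη t j r l) (hμl l) (norm_nonneg _) hx0
            _ = x * (D * (1 / n) * (q * q)) * ‖μ 0‖ := by rw [hDn, mul_one]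
            _ = x * (D * (1 / n)) * q * (‖μ 0‖ * q) := by ring
            _ ≤ x * (D * (1 / n)) * q * 1 := by gcongr
            _ = _ := mul_one _
      _ = _ := by simp
  have h2 : ‖∑ i : Fin n, noiseCoeff μ η S W0 t j r i • (S i).noise‖ ≤
      80 * (x * (D * (1 / n)) * q) := by
    -- By balance each noise coefficient is at most 40 times the average, and the near-orthogonal
    -- sum doubles this; together with the two features this makes 82.
    have h3 := H.norm_sum_noise_le (fun i => noiseCoeff μ η S W0 t j r i)
      (B := 40 * (x / n)) fun i => by
        refine (abs_noiseCoeff_le hη t j r i).trans ?_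
        have := mul_le_mul_of_nonneg_left (H.cumWeight_le (H.balanced hη t) i) hh
        calc _ ≤ _ := this
          _ = _ := by rw [hx]; ring
    have h4 : Real.sqrt (n * D) = D * q := by
      rw [Real.sqrt_eq_iff_mul_self_eq (by positivity) (by positivity)]
      calc n * D = D * D * (n / D) := by field_simp
        _ = D * q * (D * q) := by rw [← hq2]; ring
    rw [h4] at h3
    calc _ ≤ _ := h3
      _ = _ := by ring
  have h5 := H.init_norm j r
  calc _ ≤ ‖W0 j r‖ + ‖sgn j • ∑ l : Fin 2, signalCoeff μ η S W0 t j r l • μ l‖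
        + ‖∑ i : Fin n, noiseCoeff μ η S W0 t j r i • (S i).noise‖ := norm_add₃_le
    _ ≤ q + 2 * (x * (D * (1 / n)) * q) + 80 * (x * (D * (1 / n)) * q) := by gcongr
    _ = _ := by ring

end TypicalTraining

/-! ### Deterministic comparison of query scores. -/

section Separation

lemma fin_two_eq_zero_of_ne_one {l : Fin 2} (h : l ≠ 1) : l = 0 := by omega

/-- If every weak sample scores strictly lower than every strong one, then the samples of lowest
score are chosen among the weak ones first. -/
lemma isLowest_of_separated {d N k : ℕ} {P : Fin N → Sample d} {score : Fin N → ℝ}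
    {v : Fin 2 → ℝ} (hv : v 1 < v 0)
    (h : ∀ a b, (P a).feature = 0 → (P b).feature = 1 → score b < score a) {Q : Finset (Fin N)}
    (hQ : IsLowest score k Q) :
    IsLowest (fun a => v (P a).feature) k Q ∧ (k ≤ (weakSamples P).card → Q ⊆ weakSamples P) := by
  have hsep : ∀ a ∈ Q, ∀ b ∉ Q, (P b).feature = 1 → (P a).feature = 1 := by
    intro a ha b hb hb1
    by_contra ha1
    exact (hQ.2 a ha b hb).not_gt (h a b (fin_two_eq_zero_of_ne_one ha1) hb1)
  refine ⟨⟨hQ.1, fun a ha b hb => ?_⟩, fun hk => ?_⟩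
  · by_cases hb1 : (P b).feature = 1
    · simp only [hsep a ha b hb hb1, hb1, le_refl]
    · simp only [fin_two_eq_zero_of_ne_one hb1]
      by_cases ha1 : (P a).feature = 1
      · rw [ha1]; exact hv.le
      · rw [fin_two_eq_zero_of_ne_one ha1]
  · intro a ha
    by_contra hna
    have ha1 : (P a).feature ≠ 1 := by simpa [weakSamples] using hna
    -- A selected strong sample `a` forces every weak sample into `Q`, hence into the k - 1
    -- remaining places.
    have hsub : weakSamples P ⊆ Q.erase a := by
      intro b hb
      have hb1 : (P b).feature = 1 := by simpa [weakSamples] using hb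
      refine Finset.mem_erase.2 ⟨fun hab => ha1 (hab ▸ hb1), ?_⟩
      by_contra hbQ
      exact ha1 (hsep a ha b hbQ hb1)
    have h1 := Finset.card_le_card hsub
    have h2 := Finset.card_erase_lt_of_mem ha
    have h3 := hQ.1
    omega

/-- The confidence is strictly increasing in the absolute value of the margin. -/
lemma confidence_lt_of_abs_lt {m d : ℕ} {μ : Fin 2 → Vec d} {W : Weights m d} {x x' : Sample d}
    (h : |sgn x'.label * net W (x'.patch μ)| < sgn x.label * net W (x.patch μ)) :
    confidence μ W x' < confidence μ W x := by
  unfold confidence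
  set u := sgn x'.label * net W (x'.patch μ)
  set v := sgn x.label * net W (x.patch μ)
  have h1 : ∀ w : ℝ, w < v → 1 / (1 + Real.exp (-w)) < 1 / (1 + Real.exp (-v)) := by
    intro w hw
    refine one_div_lt_one_div_of_lt (by positivity) ?_
    have := Real.exp_lt_exp.2 (neg_lt_neg hw)
    linarith
  -- The complementary probability is the logistic function at -u, so only |u| matters.
  have h2 : 1 - 1 / (1 + Real.exp (-u)) = 1 / (1 + Real.exp (-(-u))) := by
    rw [neg_neg, Real.exp_neg]
    have := Real.exp_pos u
    field_simp
    ring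
  rw [h2]
  refine lt_of_lt_of_le (max_lt (h1 u ?_) (h1 (-u) ?_)) (le_max_left _ _)
  · exact (le_abs_self u).trans_lt h
  · exact (neg_le_abs u).trans_lt h

/-- Below the mean, the smaller value is the farther one. As this happens in every coordinate, all
exponents q are handled at once. -/
lemma featureDist_lt {m d n : ℕ} (hm : 0 < m) {μ : Fin 2 → Vec d} {W : Weights m d}
    {S : Fin n → Sample d} {x x' : Sample d} {q : ℝ} (hq : 1 ≤ q)
    (h1 : ∀ r, featureMap μ W x' r < featureMap μ W x r)
    (h2 : ∀ r, featureMap μ W x r ≤ (1 / (n : ℝ)) * ∑ i : Fin n, featureMap μ W (S i) r) :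
    featureDist μ q W S x < featureDist μ q W S x' := by
  have hq0 : 0 < q := by linarith
  have : Nonempty (Fin m) := ⟨⟨0, hm⟩⟩
  refine Real.rpow_lt_rpow (Finset.sum_nonneg fun r _ => Real.rpow_nonneg (abs_nonneg _) _) ?_
    (by positivity)
  refine Finset.sum_lt_sum_of_nonempty Finset.univ_nonempty fun r _ => ?_
  refine Real.rpow_lt_rpow (abs_nonneg _) ?_ hq0
  have h3 := h1 r
  have h4 := h2 r
  rw [abs_of_nonpos (by linarith), abs_of_nonpos (by linarith)]
  linarith

lemma featureMap_eq {m d : ℕ} {μ : Fin 2 → Vec d} (W : Weights m d) (x : Sample d) (r : Fin m) :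
    featureMap μ W x r = relu (sgn x.label * inner ℝ (W true r) (μ x.feature))
      + relu (inner ℝ (W true r) x.noise)
      + (relu (sgn x.label * inner ℝ (W false r) (μ x.feature))
        + relu (inner ℝ (W false r) x.noise)) := by
  simp only [featureMap, Fintype.sum_bool, Fin.sum_univ_two]
  simp only [Sample.patch, Matrix.cons_val_zero, Matrix.cons_val_one, inner_smul_right]

lemma sum_relu_patch {m d : ℕ} {μ : Fin 2 → Vec d} (W : Weights m d) (x : Sample d) (j : Bool) (r : Fin m) :
    ∑ k, relu (inner ℝ (W j r) (x.patch μ k)) =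
      relu (sgn x.label * inner ℝ (W j r) (μ x.feature)) + relu (inner ℝ (W j r) x.noise) := by
  rw [Fin.sum_univ_two]
  simp only [Sample.patch, Matrix.cons_val_zero, Matrix.cons_val_one, inner_smul_right]

end Separation

/-! ### Responses of the trained network and success of the queries. -/

namespace TypicalTraining

variable {m d n N : ℕ} {μ : Fin 2 → Vec d} {η : ℝ} {S : Fin n → Sample d} {W0 : Weights m d}
  {D e : ℝ} (H : TypicalTraining μ S W0 D e)
include H

/-- Since A·n‖μ 0‖²/D = G, a lower bound on A makes the initialisation a small relative error
against G. -/
lemma init_inner_feature_le {t : ℕ}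
    (hA : e ≤ 1 / 10000000 * (η / (n * m : ℝ) * D * (totalWeight μ η S W0 t / n))) :
    e * (n * ‖μ 0‖ ^ 2 / D) ≤
      1 / 10000000 * (η / (n * m : ℝ) * totalWeight μ η S W0 t * ‖μ 0‖ ^ 2) := by
  have hn := H.n_pos'
  have hD := H.D_pos
  refine (mul_le_mul_of_nonneg_right hA (by positivity)).trans_eq ?_
  field_simp

/-- The room between 51200 and 60000 pays for the initialisation and for the correlation of the
feature with the training noise. -/
lemma strong_response (hη : 0 ≤ η) {t : ℕ}
    (hA : e ≤ 1 / 10000000 * (η / (n * m : ℝ) * D * (totalWeight μ η S W0 t / n)))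
    (j : Bool) (r : Fin m) :
    η / (n * m : ℝ) * totalWeight μ η S W0 t * ‖μ 0‖ ^ 2 / 60000 ≤
      sgn j * inner ℝ (gdIter μ η S W0 t j r) (μ 0) := by
  have h1 := H.sgn_mul_inner_feature_ge hη t j r
  have h2 := H.init_inner_feature_le hA
  have h3 := mul_le_mul_of_nonneg_right (H.le_signalCoeff_strong hη t j r) (sq_nonneg ‖μ 0‖)
  have h4 : 0 ≤ η / (n * m : ℝ) * totalWeight μ η S W0 t * ‖μ 0‖ ^ 2 :=
    mul_nonneg (mul_nonneg (by positivity) (totalWeight_nonneg t)) (sq_nonneg _)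
  have h5 := mul_le_mul_of_nonneg_right H.e_le h4
  linarith

lemma abs_strong_response_le (hη : 0 ≤ η) {t : ℕ}
    (hA : e ≤ 1 / 10000000 * (η / (n * m : ℝ) * D * (totalWeight μ η S W0 t / n)))
    (j : Bool) (r : Fin m) :
    |inner ℝ (gdIter μ η S W0 t j r) (μ 0)| ≤
      11 / 10 * (η / (n * m : ℝ) * totalWeight μ η S W0 t * ‖μ 0‖ ^ 2) := by
  have h1 := H.abs_inner_feature_le hη t j r 0
  have h2 := H.init_inner_feature_le hA
  have h4 : 0 ≤ η / (n * m : ℝ) * totalWeight μ η S W0 t * ‖μ 0‖ ^ 2 :=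
    mul_nonneg (mul_nonneg (by positivity) (totalWeight_nonneg t)) (sq_nonneg _)
  have h5 := mul_le_mul_of_nonneg_right H.e_le h4
  linarith

/-- The trivial bound x on the weak coefficient is enough because ‖μ 1‖² ≤ e‖μ 0‖². The three units
of error are this term, the initialisation and the training noise. -/
lemma abs_weak_response_le (hη : 0 ≤ η) {t : ℕ}
    (hA : e ≤ 1 / 10000000 * (η / (n * m : ℝ) * D * (totalWeight μ η S W0 t / n)))
    (j : Bool) (r : Fin m) :
    |inner ℝ (gdIter μ η S W0 t j r) (μ 1)| ≤
      3 / 10000000 * (η / (n * m : ℝ) * totalWeight μ η S W0 t * ‖μ 0‖ ^ 2) := by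
  have h1 := H.abs_inner_feature_le hη t j r 1
  have h2 := H.init_inner_feature_le hA
  have h0 : 0 ≤ η / (n * m : ℝ) * totalWeight μ η S W0 t :=
    mul_nonneg (by positivity) (totalWeight_nonneg t)
  have h4 := mul_nonneg h0 (sq_nonneg ‖μ 0‖)
  have h5 := mul_le_mul_of_nonneg_right H.e_le h4
  have h6 := mul_le_mul_of_nonneg_left H.weak_le h0
  linarith

/-- The mean feature map of the training set is dominated by the memorized noise. -/
lemma le_mean_featureMap (hη : 0 ≤ η) (t : ℕ) (r : Fin m) :
    η / (n * m : ℝ) * D * (totalWeight μ η S W0 t / n) / 400 ≤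
      (1 / (n : ℝ)) * ∑ i : Fin n, featureMap μ (gdIter μ η S W0 t) (S i) r := by
  classical
  have hn := H.n_pos'
  set A := η / (n * m : ℝ) * D * (totalWeight μ η S W0 t / n) with hA
  have hh : 0 ≤ η / (n * m : ℝ) * D := mul_nonneg (by positivity) H.D_pos.le
  have hA0 : 0 ≤ A := mul_nonneg hh (div_nonneg (totalWeight_nonneg t) hn.le)
  have hnn : ∀ i, 0 ≤ featureMap μ (gdIter μ η S W0 t) (S i) r := fun i =>
    Finset.sum_nonneg fun _ _ => Finset.sum_nonneg fun _ _ => relu_nonneg _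
  -- Activity gives the factor 2/5 and balance 1/40, hence 1/100; only a quarter of the samples is
  -- guaranteed to be active, hence 1/400 for the mean.
  have h1 : ∀ i ∈ Finset.univ.filter fun i => 0 ≤ inner ℝ (W0 (S i).label r) (S i).noise,
      A / 100 ≤ featureMap μ (gdIter μ η S W0 t) (S i) r := by
    intro i hi
    obtain ⟨hb, ha⟩ := H.balanced_and_active hη t
    have hi' := (Finset.mem_filter.1 hi).2
    have h2 := H.two_fifths_le_inner_noise hη hb hi' fun s hs => ha s hs i r hi'
    have h3 : A ≤ 40 * (η / (n * m : ℝ) * D * cumWeight μ η S W0 t i) := by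
      have := mul_le_mul_of_nonneg_left (H.totalWeight_div_le hb i) hh
      linarith
    have h4 : ∑ k, relu (inner ℝ (gdIter μ η S W0 t (S i).label r) ((S i).patch μ k)) ≤
        featureMap μ (gdIter μ η S W0 t) (S i) r :=
      Finset.single_le_sum (f := fun j =>
        ∑ k, relu (inner ℝ (gdIter μ η S W0 t j r) ((S i).patch μ k)))
        (fun _ _ => Finset.sum_nonneg fun _ _ => relu_nonneg _) (Finset.mem_univ _)
    rw [sum_relu_patch] at h4
    have h5 := le_relu (inner ℝ (gdIter μ η S W0 t (S i).label r) (S i).noise)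
    have h6 := relu_nonneg (sgn (S i).label *
      inner ℝ (gdIter μ η S W0 t (S i).label r) (μ (S i).feature))
    linarith
  have h2 := Finset.card_nsmul_le_sum _ _ _ h1
  have h3 := Finset.sum_le_univ_sum_of_nonneg
    (s := Finset.univ.filter fun i => 0 ≤ inner ℝ (W0 (S i).label r) (S i).noise) hnn
  have h4 := H.active_samples r
  rw [nsmul_eq_mul] at h2
  rw [one_div, ← div_eq_inv_mul, le_div_iff₀ hn]
  have h5 := mul_le_mul_of_nonneg_right h4 (show 0 ≤ A / 100 by positivity)
  have h6 : A / 400 * n = n / 4 * (A / 100) := by ring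
  rw [h6]
  refine (h5.trans ?_).trans h3
  convert h2

/-- The querying stage succeeds after typical training if the pool noise acts weakly on the trained
network. -/
theorem queryingEvent (hη : 0 ≤ η) {t : ℕ} {p : ℝ} (k : ℕ) {P : Fin N → Sample d}
    (hA : e ≤ 1 / 10000000 * (η / (n * m : ℝ) * D * (totalWeight μ η S W0 t / n)))
    (hW : p * N / 2 ≤ ((weakSamples P).card : ℝ))
    (hP : ∀ a j r, |inner ℝ (gdIter μ η S W0 t j r) (P a).noise| ≤
      1 / 10000000 * (η / (n * m : ℝ) * totalWeight μ η S W0 t * ‖μ 0‖ ^ 2)) :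
    QueryingEvent μ p k W0 (gdIter μ η S W0 t) S P := by
  have hn := H.n_pos'
  have hm := H.m_pos'
  have hD := H.D_pos
  have he := H.e_pos
  have hdec := isSignalNoiseDecomp_gdIter (η := η) (W0 := W0) H.feature_ne H.noise_ne_zero t
  refine ⟨⟨_, hdec, fun c hc => H.isSignalNoiseDecomp_unique hc hdec⟩, hW, fun γ ρ hγρ => ?_⟩
  have hγ := congrArg Prod.fst (H.isSignalNoiseDecomp_unique hγρ hdec)
  dsimp only at hγ
  set x := η / (n * m : ℝ) * totalWeight μ η S W0 t with hx
  set G := x * ‖μ 0‖ ^ 2 with hG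
  have hApos : 0 < η / (n * m : ℝ) * D * (totalWeight μ η S W0 t / n) := by linarith
  have hxA : η / (n * m : ℝ) * D * (totalWeight μ η S W0 t / n) = x * D / n := by
    rw [hx]; ring
  have hx0 : 0 < x := by
    by_contra hc
    push Not at hc
    have : x * D / n ≤ 0 := div_nonpos_of_nonpos_of_nonneg (mul_nonpos_of_nonpos_of_nonneg hc hD.le)
      hn.le
    linarith
  have hμ : 0 < ‖μ 0‖ ^ 2 := by have := norm_pos_iff.2 (H.feature_ne 0); positivity
  have hG0 : 0 < G := mul_pos hx0 hμ
  have hstrong := H.strong_response hη hA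
  have hstrong' := H.abs_strong_response_le hη hA
  have hweak := H.abs_weak_response_le hη hA
  set W := gdIter μ η S W0 t with hWt
  -- the average coefficients
  have havg : avgCoeff γ 1 < avgCoeff γ 0 := by
    -- The comparison holds neuron by neuron: the weak coefficient is at most x‖μ 1‖² ≤ eG, the
    -- strong one at least G/51200.
    have h1 : ∀ j r, γ j r 1 < γ j r 0 := by
      intro j r
      rw [hγ]
      have h2 := mul_le_mul_of_nonneg_right (H.le_signalCoeff_strong hη t j r) hμ.le
      have h3 := mul_le_mul (signalCoeff_le (S := S) (W0 := W0) (μ := μ) hη t j r 1) H.weak_le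
        (sq_nonneg _) hx0.le
      have h4 : e * G ≤ 1 / 10000000 * G := mul_le_mul_of_nonneg_right H.e_le hG0.le
      have h5 : x * (e * ‖μ 0‖ ^ 2) = e * G := by rw [hG]; ring
      have h6 : x / 51200 * ‖μ 0‖ ^ 2 = G / 51200 := by rw [hG]; ring
      rw [← hx] at h2 h3
      rw [h6] at h2
      rw [h5] at h3
      dsimp only
      linarith
    have : Nonempty (Fin m) := ⟨⟨0, H.m_pos⟩⟩
    refine mul_lt_mul_of_pos_left ?_ (by positivity)
    exact Finset.sum_lt_sum_of_nonempty Finset.univ_nonempty fun j _ =>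
      Finset.sum_lt_sum_of_nonempty Finset.univ_nonempty fun r _ => h1 j r
  refine ⟨havg, fun Q hQ => ?_⟩
  have hsg : ∀ (y : Bool) (z : ℝ), |sgn y * z| = |z| := fun y z => by
    rw [abs_mul, abs_sgn, one_mul]
  have hnoise : ∀ a j r, relu (inner ℝ (W j r) (P a).noise) ≤ 1 / 10000000 * G := fun a j r =>
    (relu_le_abs _).trans (hP a j r)
  have hweakrelu : ∀ a j r, (P a).feature = 1 →
      relu (sgn (P a).label * inner ℝ (W j r) (μ (P a).feature)) ≤ 3 / 10000000 * G := by
    intro a j r ha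
    rw [ha]
    refine (relu_le_abs _).trans ?_
    rw [hsg]; exact hweak j r
  rcases hQ with hQ | ⟨q, hq, hQ⟩
  -- On a strong sample the partial network of the label is at least G/60000 and the other one sees
  -- only noise. On a weak sample both partial networks lie between 0 and a tiny multiple of G,
  -- which bounds the absolute margin.
  · refine isLowest_of_separated (v := avgCoeff γ) havg (fun a b ha hb => ?_) hQ
    refine confidence_lt_of_abs_lt ?_
    have hb1 : ∀ j, partialNet W j ((P b).patch μ) ≤ 4 / 10000000 * G := fun j =>
      partialNet_le H.m_pos fun r => by
        rw [sum_relu_patch]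
        linarith [hnoise b j r, hweakrelu b j r hb]
    have hb0 := fun j => partialNet_nonneg W j ((P b).patch μ)
    have ha1 : G / 60000 ≤ partialNet W (P a).label ((P a).patch μ) :=
      le_partialNet H.m_pos fun r => by
        rw [sum_relu_patch, ha]
        linarith [hstrong (P a).label r, relu_nonneg (inner ℝ (W (P a).label r) (P a).noise),
          le_relu (sgn (P a).label * inner ℝ (W (P a).label r) (μ 0))]
    have ha2 : partialNet W (!(P a).label) ((P a).patch μ) ≤ 1 / 10000000 * G :=
      partialNet_le H.m_pos fun r => by
        rw [sum_relu_patch, ha]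
        have h1 : relu (sgn (P a).label * inner ℝ (W (!(P a).label) r) (μ 0)) ≤ 0 := by
          refine relu_le le_rfl ?_
          have h2 := hstrong (!(P a).label) r
          rw [sgn_not] at h2
          linarith
        linarith [hnoise a (!(P a).label) r]
    rw [sgn_mul_net, sgn_mul_net]
    have hlt : |partialNet W (P b).label ((P b).patch μ) -
        partialNet W (!(P b).label) ((P b).patch μ)| ≤ 4 / 10000000 * G := by
      rw [abs_le]
      constructor <;> linarith [hb1 (P b).label, hb1 (!(P b).label), hb0 (P b).label,
        hb0 (!(P b).label)]
    linarith
  -- In each coordinate the neuron whose sign is the label already puts the strong sample above the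
  -- weak one. Both stay below the mean, since the strong value is at most 3G ≤ 3eA while the mean
  -- is at least A/400.
  · refine isLowest_of_separated (v := avgCoeff γ) havg (fun a b ha hb => ?_) hQ
    refine neg_lt_neg (featureDist_lt H.m_pos hq (fun r => ?_) fun r => ?_)
    · have hb1 : featureMap μ W (P b) r ≤ 8 / 10000000 * G := by
        rw [featureMap_eq]
        linarith [hnoise b true r, hnoise b false r, hweakrelu b true r hb,
          hweakrelu b false r hb]
      have ha1 : G / 60000 ≤ featureMap μ W (P a) r := by
        have h1 : ∑ k, relu (inner ℝ (W (P a).label r) ((P a).patch μ k)) ≤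
            featureMap μ W (P a) r :=
          Finset.single_le_sum (f := fun j => ∑ k, relu (inner ℝ (W j r) ((P a).patch μ k)))
            (fun _ _ => Finset.sum_nonneg fun _ _ => relu_nonneg _) (Finset.mem_univ _)
        rw [sum_relu_patch, ha] at h1
        linarith [hstrong (P a).label r, relu_nonneg (inner ℝ (W (P a).label r) (P a).noise),
          le_relu (sgn (P a).label * inner ℝ (W (P a).label r) (μ 0))]
      linarith
    · refine le_trans ?_ (H.le_mean_featureMap hη t r)
      have h1 : ∀ j, relu (sgn (P a).label * inner ℝ (W j r) (μ (P a).feature)) ≤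
          11 / 10 * G := by
        intro j
        rw [ha]
        refine (relu_le_abs _).trans ?_
        rw [hsg]; exact hstrong' j r
      have h2 : featureMap μ W (P a) r ≤ 3 * G := by
        rw [featureMap_eq]
        linarith [hnoise a true r, hnoise a false r, h1 true, h1 false]
      have h3 : G ≤ e * (x * D / n) := by
        rw [hG, ← mul_div_assoc, le_div_iff₀ hn]
        have := mul_le_mul_of_nonneg_left H.dim_ge hx0.le
        linarith
      have h4 : e * (x * D / n) ≤ 1 / 10000000 * (x * D / n) :=
        mul_le_mul_of_nonneg_right H.e_le (by rw [← hxA]; exact hApos.le)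
      rw [hxA] at hApos ⊢
      linarith

end TypicalTraining

/-! ### Measurability of the trained weights. -/

section Measurability

variable {m d n : ℕ}

@[fun_prop]
lemma measurable_noise : Measurable (Sample.noise : Sample d → Vec d) :=
  measurable_snd.comp measurable_snd

@[fun_prop]
lemma measurable_label : Measurable (Sample.label : Sample d → Bool) := measurable_fst

@[fun_prop]
lemma measurable_feature : Measurable (Sample.feature : Sample d → Fin 2) :=
  measurable_fst.comp measurable_snd

@[fun_prop]
lemma measurable_sgn : Measurable sgn := measurable_of_countable _

@[fun_prop]
lemma measurable_relu : Measurable relu := measurable_id.max measurable_const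

@[fun_prop]
lemma measurable_reluDeriv : Measurable reluDeriv :=
  Measurable.ite (measurableSet_le measurable_const measurable_id) measurable_const
    measurable_const

@[fun_prop]
lemma measurable_deriv_logisticLoss : Measurable (deriv logisticLoss) := measurable_deriv _

lemma measurable_patch (μ : Fin 2 → Vec d) (k : Fin 2) :
    Measurable fun x : Sample d => x.patch μ k := by
  have hμ : Measurable μ := measurable_of_countable _
  fin_cases k
  · exact (measurable_sgn.comp measurable_label).smul (hμ.comp measurable_feature)
  · exact measurable_noise

@[fun_prop]
lemma measurable_sample_apply (i : Fin n) : Measurable fun z : TrainData m d n => z.2 i :=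
  (measurable_pi_apply i).comp measurable_snd

@[fun_prop]
lemma measurable_weight_apply (j : Bool) (r : Fin m) :
    Measurable fun z : TrainData m d n => z.1 j r :=
  (measurable_pi_apply r).comp ((measurable_pi_apply j).comp measurable_fst)

lemma measurable_gdIter (μ : Fin 2 → Vec d) (η : ℝ) (t : ℕ) (j : Bool) (r : Fin m) :
    Measurable fun z : TrainData m d n => gdIter μ η z.2 z.1 t j r := by
  induction t generalizing j r with
  | zero => exact measurable_weight_apply j r
  | succ t ih =>
    have hp : ∀ (i : Fin n) (k : Fin 2),
        Measurable fun z : TrainData m d n => (z.2 i).patch μ k := fun i k =>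
      (measurable_patch μ k).comp (measurable_sample_apply i)
    have hin : ∀ (i : Fin n) (k : Fin 2) (j : Bool) (r : Fin m),
        Measurable fun z : TrainData m d n =>
          inner ℝ (gdIter μ η z.2 z.1 t j r) ((z.2 i).patch μ k) := fun i k j r =>
      (ih j r).inner (hp i k)
    have hl : ∀ i : Fin n, Measurable fun z : TrainData m d n => sgn (z.2 i).label := fun i =>
      measurable_sgn.comp (measurable_label.comp (measurable_sample_apply i))
    have hnet : ∀ i : Fin n, Measurable fun z : TrainData m d n =>
        net (gdIter μ η z.2 z.1 t) ((z.2 i).patch μ) := fun i => by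
      unfold net partialNet
      refine Finset.measurable_sum _ fun j _ => measurable_const.mul (measurable_const.mul
        (Finset.measurable_sum _ fun r _ => Finset.measurable_sum _ fun k _ => ?_))
      exact measurable_relu.comp (hin i k j r)
    simp only [gdIter, gdStep]
    refine (ih j r).sub (Measurable.fun_const_smul (Finset.measurable_sum _ fun i _ => ?_) _)
    refine Measurable.fun_smul ?_ (Finset.measurable_sum _ fun k _ => ?_)
    · exact (measurable_deriv_logisticLoss.comp ((hl i).mul (hnet i))).mul
        (measurable_const.mul (hl i))
    · exact (measurable_reluDeriv.comp (hin i k j r)).smul (hp i k)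

/-- Time is countable, so measurability at each fixed time gives joint measurability. It is needed
to condition on the stopped weights when bounding their response to the pool noise. -/
lemma measurable_gdIter_stoppedAt (μ : Fin 2 → Vec d) (η : ℝ) {τ : TrainData m d n → ℕ}
    (hτ : Measurable τ) (j : Bool) (r : Fin m) :
    Measurable fun z : TrainData m d n => gdIter μ η z.2 z.1 (τ z) j r := by
  have h : Measurable fun q : ℕ × TrainData m d n => gdIter μ η q.2.2 q.2.1 q.1 j r :=
    measurable_from_prod_countable_right fun t => measurable_gdIter μ η t j r
  exact h.comp (hτ.prodMk measurable_id)

/-- The weight vectors of the sign given by the label of a sample. -/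
lemma measurable_weight_label (i : Fin n) (r : Fin m) :
    Measurable fun z : TrainData m d n => z.1 (z.2 i).label r := by
  have h : Measurable fun q : Bool × TrainData m d n => q.2.1 q.1 r :=
    measurable_from_prod_countable_right fun j => measurable_weight_apply j r
  exact h.comp ((measurable_label.comp (measurable_sample_apply i)).prodMk measurable_id)

lemma measurable_card_filter {Ω ι : Type*} [MeasurableSpace Ω] [Fintype ι] {p : ι → Ω → Prop}
    (hp : ∀ i, MeasurableSet {ω | p i ω}) :
    Measurable fun ω => (({i | p i ω} : Set ι).ncard : ℝ) := by
  classical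
  have : (fun ω => (({i | p i ω} : Set ι).ncard : ℝ)) =
      fun ω => ∑ i, if p i ω then (1 : ℝ) else 0 := by
    funext ω
    rw [Finset.sum_boole, Set.ncard_eq_toFinset_card']
    simp
  rw [this]
  exact Finset.measurable_sum _ fun i _ => Measurable.ite (hp i) measurable_const measurable_const

end Measurability

/-! ### Union bounds and marginals of the joint law. -/

section UnionBound

lemma measure_exists_le {Ω ι : Type*} [MeasurableSpace Ω] [Fintype ι] (ν : Measure Ω)
    {p : ι → Ω → Prop} {ε : ℝ} (h : ∀ i, ν {ω | p i ω} ≤ ENNReal.ofReal ε) :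
    ν {ω | ∃ i, p i ω} ≤ ENNReal.ofReal (Fintype.card ι * ε) := by
  have h1 : {ω | ∃ i, p i ω} = ⋃ i, {ω | p i ω} := by ext; simp
  rw [h1]
  refine (measure_iUnion_fintype_le ν _).trans ((Finset.sum_le_sum fun i _ => h i).trans_eq ?_)
  rw [Finset.sum_const, nsmul_eq_mul, ENNReal.ofReal_mul (by positivity), Finset.card_univ,
    ENNReal.ofReal_natCast]

lemma le_prod_of_forall_le_section {α β : Type*} [MeasurableSpace α] [MeasurableSpace β]
    (μ : Measure α) (ν : Measure β) [IsProbabilityMeasure μ] [SFinite ν] {s : Set (α × β)}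
    (hs : MeasurableSet s) {ε : ℝ≥0∞} (h : ∀ a, ε ≤ ν (Prod.mk a ⁻¹' s)) : ε ≤ μ.prod ν s := by
  rw [Measure.prod_apply hs]
  calc ε = ∫⁻ _, ε ∂μ := by simp
    _ ≤ _ := lintegral_mono h

end UnionBound

section Marginals

variable {m d n : ℕ} {p σp σ0 : ℝ}

/-- The joint law of the initial weights and the training set. -/
noncomputable def trainLaw (m d n : ℕ) (p σp σ0 : ℝ) : Measure (TrainData m d n) :=
  (initLaw m d σ0).prod (Measure.pi fun _ => dataLaw d p σp)

lemma initLaw_apply (j : Bool) {A : Set (Fin m → Vec d)} (hA : MeasurableSet A) :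
    initLaw m d σ0 {W | W j ∈ A} = Measure.pi (fun _ : Fin m => gaussianNoise d σ0) A :=
  pi_eval_preimage _ j hA

lemma initLaw_apply_apply (j : Bool) (r : Fin m) {A : Set (Vec d)} (hA : MeasurableSet A) :
    initLaw m d σ0 {W | W j r ∈ A} = gaussianNoise d σ0 A := by
  have h : MeasurableSet {w : Fin m → Vec d | w r ∈ A} := measurable_pi_apply r hA
  exact (initLaw_apply j h).trans (pi_eval_preimage _ r hA)

variable (h0 : 0 ≤ p) (h1 : p ≤ 1)
include h0 h1

lemma dataLaw_noise (A : Set (Vec d)) :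
    dataLaw d p σp {x | x.noise ∈ A} = gaussianNoise d σp A := by
  have := isProbabilityMeasure_featureLaw h0 h1
  have h2 : {x : Sample d | x.noise ∈ A} = Set.univ ×ˢ (Set.univ ×ˢ A) := by
    ext x; simp [Sample.noise]
  rw [h2, dataLaw, Measure.prod_prod, Measure.prod_prod, measure_univ, measure_univ, one_mul,
    one_mul]

lemma sampleLaw_noise (i : Fin n) {A : Set (Vec d)} (hA : MeasurableSet A) :
    Measure.pi (fun _ : Fin n => dataLaw d p σp) {S | (S i).noise ∈ A} = gaussianNoise d σp A := by
  have := isProbabilityMeasure_dataLaw (d := d) (σp := σp) h0 h1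
  have h : MeasurableSet {x : Sample d | x.noise ∈ A} := measurable_noise hA
  exact (pi_eval_preimage _ i h).trans (dataLaw_noise h0 h1 A)

lemma dataLaw_strong (hp : p ≤ 1 / 2) (y : Bool) :
    ENNReal.ofReal (1 / 4) ≤ dataLaw d p σp {x | x.feature = 0 ∧ x.label = y} := by
  have := isProbabilityMeasure_featureLaw h0 h1
  have h2 : {x : Sample d | x.feature = 0 ∧ x.label = y} = {y} ×ˢ ({0} ×ˢ Set.univ) := by
    ext x; simp [Sample.feature, Sample.label, and_comm]
  have h3 : rademacher {y} = ENNReal.ofReal (1 / 2) := by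
    cases y <;> simp [rademacher]
  have h4 : featureLaw p {0} = ENNReal.ofReal (1 - p) := by simp [featureLaw]
  rw [h2, dataLaw, Measure.prod_prod, Measure.prod_prod, measure_univ, mul_one, h3, h4,
    ← ENNReal.ofReal_mul (by norm_num)]
  exact ENNReal.ofReal_le_ofReal (by linarith)

lemma dataLaw_weak : dataLaw d p σp {x | x.feature = 1} = ENNReal.ofReal p := by
  have := isProbabilityMeasure_featureLaw h0 h1
  have h2 : {x : Sample d | x.feature = 1} = Set.univ ×ˢ ({1} ×ˢ Set.univ) := by
    ext x; simp [Sample.feature]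
  have h4 : featureLaw p {1} = ENNReal.ofReal p := by simp [featureLaw]
  rw [h2, dataLaw, Measure.prod_prod, Measure.prod_prod, measure_univ, measure_univ, mul_one,
    one_mul, h4]

lemma dataLaw_active (w : Bool → Vec d) :
    ENNReal.ofReal (1 / 2) ≤ dataLaw d p σp {x | 0 ≤ inner ℝ (w x.label) x.noise} := by
  have := isProbabilityMeasure_featureLaw h0 h1
  have hw : Measurable w := measurable_of_countable _
  have hm : MeasurableSet {x : Sample d | 0 ≤ inner ℝ (w x.label) x.noise} :=
    measurableSet_le measurable_const ((hw.comp measurable_label).inner measurable_noise)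
  refine le_prod_of_forall_le_section _ _ hm fun y => ?_
  have h2 : Prod.mk y ⁻¹' {x : Sample d | 0 ≤ inner ℝ (w x.label) x.noise} =
      Set.univ ×ˢ {x | 0 ≤ inner ℝ (w y) x} := by
    ext x; simp [Sample.noise, Sample.label]
  rw [h2, Measure.prod_prod, measure_univ, one_mul]
  exact half_le_gaussianNoise_inner_nonneg (w y)

end Marginals

/-! ### Probabilities of the exceptional training events. -/

section TrainingEvents

variable {m d n : ℕ} {p σp σ0 : ℝ} (h0 : 0 ≤ p) (h1 : p ≤ 1)
include h0 h1

lemma trainLaw_samples {B : Set (Fin n → Sample d)} (hB : MeasurableSet B) :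
    trainLaw m d n p σp σ0 {z | z.2 ∈ B} = Measure.pi (fun _ : Fin n => dataLaw d p σp) B := by
  have := isProbabilityMeasure_dataLaw (d := d) (σp := σp) h0 h1
  exact measurePreserving_snd.measure_preimage hB.nullMeasurableSet

lemma trainLaw_weights {B : Set (Weights m d)} (hB : MeasurableSet B) :
    trainLaw m d n p σp σ0 {z | z.1 ∈ B} = initLaw m d σ0 B := by
  have := isProbabilityMeasure_dataLaw (d := d) (σp := σp) h0 h1
  exact measurePreserving_fst.measure_preimage hB.nullMeasurableSet

lemma trainLaw_noise (i : Fin n) {A : Set (Vec d)} (hA : MeasurableSet A) :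
    trainLaw m d n p σp σ0 {z | (z.2 i).noise ∈ A} = gaussianNoise d σp A := by
  have h : MeasurableSet {S : Fin n → Sample d | (S i).noise ∈ A} :=
    (measurable_noise.comp (measurable_pi_apply i)) hA
  exact (trainLaw_samples h0 h1 h).trans (sampleLaw_noise h0 h1 i hA)

lemma trainLaw_weight (j : Bool) (r : Fin m) {A : Set (Vec d)} (hA : MeasurableSet A) :
    trainLaw m d n p σp σ0 {z | z.1 j r ∈ A} = gaussianNoise d σ0 A := by
  have h : MeasurableSet {W : Weights m d | W j r ∈ A} :=
    ((measurable_pi_apply r).comp (measurable_pi_apply j)) hA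
  exact (trainLaw_weights h0 h1 h).trans (initLaw_apply_apply j r hA)

lemma trainLaw_norm_noise (hσ : σp ≠ 0) :
    trainLaw m d n p σp σ0 {z | ∃ i, ‖(z.2 i).noise‖ ^ 2 < σp ^ 2 * d / 2 ∨
      2 * (σp ^ 2 * d) < ‖(z.2 i).noise‖ ^ 2} ≤
      ENNReal.ofReal (n * (2 * Real.exp (-(d / 16)))) := by
  have h := measure_exists_le (trainLaw m d n p σp σ0)
    (p := fun i z => ‖(z.2 i).noise‖ ^ 2 < σp ^ 2 * d / 2 ∨
      2 * (σp ^ 2 * d) < ‖(z.2 i).noise‖ ^ 2) (ε := 2 * Real.exp (-(d / 16))) fun i => ?_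
  · rwa [Fintype.card_fin] at h
  have hA : MeasurableSet ({x : Vec d | ‖x‖ ^ 2 < σp ^ 2 * d / 2} ∪
      {x | 2 * (σp ^ 2 * d) < ‖x‖ ^ 2}) :=
    (measurableSet_lt (by fun_prop) measurable_const).union
      (measurableSet_lt measurable_const (by fun_prop))
  refine (trainLaw_noise h0 h1 i hA).trans_le ((measure_union_le _ _).trans ?_)
  rw [two_mul (Real.exp _), ENNReal.ofReal_add (Real.exp_pos _).le (Real.exp_pos _).le]
  exact add_le_add (gaussianNoise_norm_sq_lt_le hσ) gaussianNoise_norm_sq_gt_le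

lemma trainLaw_norm_weight :
    trainLaw m d n p σp σ0 {z | ∃ q : Bool × Fin m, 2 * (σ0 ^ 2 * d) < ‖z.1 q.1 q.2‖ ^ 2} ≤
      ENNReal.ofReal (2 * m * Real.exp (-(d / 16))) := by
  have h := measure_exists_le (trainLaw m d n p σp σ0)
    (p := fun (q : Bool × Fin m) z => 2 * (σ0 ^ 2 * d) < ‖z.1 q.1 q.2‖ ^ 2)
    (ε := Real.exp (-(d / 16))) fun q => ?_
  · simpa using h
  have hA : MeasurableSet {x : Vec d | 2 * (σ0 ^ 2 * d) < ‖x‖ ^ 2} :=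
    measurableSet_lt measurable_const (by fun_prop)
  exact (trainLaw_weight h0 h1 q.1 q.2 hA).trans_le gaussianNoise_norm_sq_gt_le

lemma trainLaw_feature_noise (hσ : 0 ≤ σp) (μ : Fin 2 → Vec d) {l : ℝ} (hl : 0 ≤ l) :
    trainLaw m d n p σp σ0 {z | ∃ q : Fin 2 × Fin n,
      σp * ‖μ q.1‖ * l < |inner ℝ (μ q.1) (z.2 q.2).noise|} ≤
      ENNReal.ofReal (2 * n * (2 * Real.exp (-(l ^ 2 / 2)))) := by
  have h := measure_exists_le (trainLaw m d n p σp σ0)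
    (p := fun (q : Fin 2 × Fin n) z => σp * ‖μ q.1‖ * l < |inner ℝ (μ q.1) (z.2 q.2).noise|)
    (ε := 2 * Real.exp (-(l ^ 2 / 2))) fun q => ?_
  · simpa using h
  have hA : MeasurableSet {x : Vec d | σp * ‖μ q.1‖ * l < |inner ℝ (μ q.1) x|} :=
    measurableSet_lt measurable_const (by fun_prop)
  exact (trainLaw_noise h0 h1 q.2 hA).trans_le (gaussianNoise_abs_inner_gt_le hσ (μ q.1) hl)

lemma trainLaw_weight_feature (hσ : 0 ≤ σ0) (μ : Fin 2 → Vec d) {l : ℝ} (hl : 0 ≤ l) :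
    trainLaw m d n p σp σ0 {z | ∃ q : Fin 2 × Bool × Fin m,
      σ0 * ‖μ q.1‖ * l < |inner ℝ (μ q.1) (z.1 q.2.1 q.2.2)|} ≤
      ENNReal.ofReal (4 * m * (2 * Real.exp (-(l ^ 2 / 2)))) := by
  have h := measure_exists_le (trainLaw m d n p σp σ0)
    (p := fun (q : Fin 2 × Bool × Fin m) z =>
      σ0 * ‖μ q.1‖ * l < |inner ℝ (μ q.1) (z.1 q.2.1 q.2.2)|)
    (ε := 2 * Real.exp (-(l ^ 2 / 2))) fun q => ?_
  · refine h.trans_eq ?_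
    congr 2
    simp; ring
  have hA : MeasurableSet {x : Vec d | σ0 * ‖μ q.1‖ * l < |inner ℝ (μ q.1) x|} :=
    measurableSet_lt measurable_const (by fun_prop)
  exact (trainLaw_weight h0 h1 q.2.1 q.2.2 hA).trans_le
    (gaussianNoise_abs_inner_gt_le hσ (μ q.1) hl)

/-- With the samples fixed, the response of a weight is Gaussian with deviation σ0‖ξ‖. The threshold
therefore contains the realised norm, which is controlled by a separate event. -/
lemma trainLaw_weight_noise (hσ : 0 ≤ σ0) {l : ℝ} (hl : 0 ≤ l) :
    trainLaw m d n p σp σ0 {z | ∃ q : Fin n × Bool × Fin m,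
      σ0 * ‖(z.2 q.1).noise‖ * l < |inner ℝ (z.2 q.1).noise (z.1 q.2.1 q.2.2)|} ≤
      ENNReal.ofReal (2 * m * n * (2 * Real.exp (-(l ^ 2 / 2)))) := by
  have := isProbabilityMeasure_dataLaw (d := d) (σp := σp) h0 h1
  have h := measure_exists_le (trainLaw m d n p σp σ0)
    (p := fun (q : Fin n × Bool × Fin m) z =>
      σ0 * ‖(z.2 q.1).noise‖ * l < |inner ℝ (z.2 q.1).noise (z.1 q.2.1 q.2.2)|)
    (ε := 2 * Real.exp (-(l ^ 2 / 2))) fun q => ?_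
  · refine h.trans_eq ?_
    congr 2
    simp; ring
  have hm : MeasurableSet {z : TrainData m d n |
      σ0 * ‖(z.2 q.1).noise‖ * l < |inner ℝ (z.2 q.1).noise (z.1 q.2.1 q.2.2)|} :=
    measurableSet_lt (by fun_prop) (by fun_prop)
  refine prod_le_of_forall_section_le' _ _ hm fun S => ?_
  have hA : MeasurableSet {x : Vec d |
      σ0 * ‖(S q.1).noise‖ * l < |inner ℝ (S q.1).noise x|} :=
    measurableSet_lt measurable_const (by fun_prop)
  exact (initLaw_apply_apply q.2.1 q.2.2 hA).trans_le
    (gaussianNoise_abs_inner_gt_le hσ (S q.1).noise hl)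

/-- Two different samples are independent, so with the first one fixed this is again a linear
functional of a Gaussian vector. -/
lemma trainLaw_noise_noise (hσ : 0 ≤ σp) {l : ℝ} (hl : 0 ≤ l) :
    trainLaw m d n p σp σ0 {z | ∃ q : Fin n × Fin n, q.1 ≠ q.2 ∧
      σp * ‖(z.2 q.1).noise‖ * l < |inner ℝ (z.2 q.1).noise (z.2 q.2).noise|} ≤
      ENNReal.ofReal (n * n * (2 * Real.exp (-(l ^ 2 / 2)))) := by
  have := isProbabilityMeasure_dataLaw (d := d) (σp := σp) h0 h1
  have h := measure_exists_le (trainLaw m d n p σp σ0)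
    (p := fun (q : Fin n × Fin n) z => q.1 ≠ q.2 ∧
      σp * ‖(z.2 q.1).noise‖ * l < |inner ℝ (z.2 q.1).noise (z.2 q.2).noise|)
    (ε := 2 * Real.exp (-(l ^ 2 / 2))) fun q => ?_
  · simpa using h
  by_cases hq : q.1 = q.2
  · simp [hq]
  simp only [ne_eq, hq, not_false_eq_true, true_and]
  have hm : MeasurableSet {x : Sample d × Sample d |
      σp * ‖x.1.noise‖ * l < |inner ℝ x.1.noise x.2.noise|} :=
    measurableSet_lt (by fun_prop) (by fun_prop)
  have hm' : MeasurableSet {S : Fin n → Sample d | (S q.1, S q.2) ∈ {x : Sample d × Sample d |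
      σp * ‖x.1.noise‖ * l < |inner ℝ x.1.noise x.2.noise|}} :=
    ((measurable_pi_apply q.1).prodMk (measurable_pi_apply q.2)) hm
  refine (trainLaw_samples h0 h1 hm').trans_le ?_
  rw [pi_eval_pair_preimage _ hq hm]
  refine prod_le_of_forall_section_le _ _ hm fun x => ?_
  exact (dataLaw_noise h0 h1 {y | σp * ‖x.noise‖ * l < |inner ℝ x.noise y|}).trans_le
    (gaussianNoise_abs_inner_gt_le hσ x.noise hl)

/-- With the samples fixed, the neurons of one sign are independent and each is active with
probability at least 1/2. The union over both signs covers whatever label the sample has. -/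
lemma trainLaw_active_neurons :
    trainLaw m d n p σp σ0 {z | ∃ q : Bool × Fin n,
      (({r | 0 ≤ inner ℝ (z.2 q.2).noise (z.1 q.1 r)} : Set (Fin m)).ncard : ℝ) < 1 / 2 * m / 2} ≤
      ENNReal.ofReal (2 * n * Real.exp (-(1 / 2 * m / 8))) := by
  have := isProbabilityMeasure_dataLaw (d := d) (σp := σp) h0 h1
  have h := measure_exists_le (trainLaw m d n p σp σ0)
    (p := fun (q : Bool × Fin n) z =>
      (({r | 0 ≤ inner ℝ (z.2 q.2).noise (z.1 q.1 r)} : Set (Fin m)).ncard : ℝ) < 1 / 2 * m / 2)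
    (ε := Real.exp (-(1 / 2 * m / 8))) fun q => ?_
  · simpa using h
  have hm : MeasurableSet {z : TrainData m d n |
      (({r | 0 ≤ inner ℝ (z.2 q.2).noise (z.1 q.1 r)} : Set (Fin m)).ncard : ℝ) < 1 / 2 * m / 2} :=
    measurableSet_lt (measurable_card_filter fun r =>
      measurableSet_le measurable_const (by fun_prop)) measurable_const
  refine prod_le_of_forall_section_le' _ _ hm fun S => ?_
  have hA : MeasurableSet {x : Vec d | 0 ≤ inner ℝ (S q.2).noise x} :=
    measurableSet_le measurable_const (by fun_prop)
  have hm' : MeasurableSet {w : Fin m → Vec d |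
      (({r | w r ∈ {x : Vec d | 0 ≤ inner ℝ (S q.2).noise x}} : Set (Fin m)).ncard : ℝ)
        < 1 / 2 * m / 2} :=
    measurableSet_lt (measurable_card_filter fun r => (measurable_pi_apply r) hA) measurable_const
  exact (initLaw_apply q.1 hm').trans_le
    (pi_card_filter_lt_le m _ hA (half_le_gaussianNoise_inner_nonneg _))

/-- The conditioning is reversed here: with the weights fixed, the samples are independent, and the
noise of each is symmetric given its label. -/
lemma trainLaw_active_samples :
    trainLaw m d n p σp σ0 {z | ∃ r : Fin m,
      (({i | 0 ≤ inner ℝ (z.1 (z.2 i).label r) (z.2 i).noise} : Set (Fin n)).ncard : ℝ)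
        < 1 / 2 * n / 2} ≤
      ENNReal.ofReal (m * Real.exp (-(1 / 2 * n / 8))) := by
  have := isProbabilityMeasure_dataLaw (d := d) (σp := σp) h0 h1
  have h := measure_exists_le (trainLaw m d n p σp σ0)
    (p := fun (r : Fin m) z =>
      (({i | 0 ≤ inner ℝ (z.1 (z.2 i).label r) (z.2 i).noise} : Set (Fin n)).ncard : ℝ)
        < 1 / 2 * n / 2)
    (ε := Real.exp (-(1 / 2 * n / 8))) fun r => ?_
  · simpa using h
  have hm : MeasurableSet {z : TrainData m d n |
      (({i | 0 ≤ inner ℝ (z.1 (z.2 i).label r) (z.2 i).noise} : Set (Fin n)).ncard : ℝ)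
        < 1 / 2 * n / 2} :=
    measurableSet_lt (measurable_card_filter fun i => measurableSet_le measurable_const
      ((measurable_weight_label i r).inner (by fun_prop))) measurable_const
  refine prod_le_of_forall_section_le _ _ hm fun W => ?_
  have hw : Measurable fun j => W j r := measurable_of_countable _
  have hA : MeasurableSet {x : Sample d | 0 ≤ inner ℝ (W x.label r) x.noise} :=
    measurableSet_le measurable_const ((hw.comp measurable_label).inner measurable_noise)
  exact pi_card_filter_lt_le n _ hA (dataLaw_active h0 h1 fun j => W j r)

lemma trainLaw_strong_samples (hp : p ≤ 1 / 2) :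
    trainLaw m d n p σp σ0 {z | ∃ y : Bool,
      (({i | (z.2 i).feature = 0 ∧ (z.2 i).label = y} : Set (Fin n)).ncard : ℝ)
        < 1 / 4 * n / 2} ≤
      ENNReal.ofReal (2 * Real.exp (-(1 / 4 * n / 8))) := by
  have := isProbabilityMeasure_dataLaw (d := d) (σp := σp) h0 h1
  have h := measure_exists_le (trainLaw m d n p σp σ0)
    (p := fun (y : Bool) z =>
      (({i | (z.2 i).feature = 0 ∧ (z.2 i).label = y} : Set (Fin n)).ncard : ℝ) < 1 / 4 * n / 2)
    (ε := Real.exp (-(1 / 4 * n / 8))) fun y => ?_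
  · simpa using h
  have hA : MeasurableSet {x : Sample d | x.feature = 0 ∧ x.label = y} :=
    (measurable_feature (measurableSet_singleton 0)).inter
      (measurable_label (measurableSet_singleton y))
  have hm : MeasurableSet {S : Fin n → Sample d |
      (({i | S i ∈ {x : Sample d | x.feature = 0 ∧ x.label = y}} : Set (Fin n)).ncard : ℝ)
        < 1 / 4 * n / 2} :=
    measurableSet_lt (measurable_card_filter fun i => (measurable_pi_apply i) hA) measurable_const
  exact (trainLaw_samples h0 h1 hm).trans_le
    (pi_card_filter_lt_le n _ hA (dataLaw_strong h0 h1 hp y))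

end TrainingEvents

/-! ### Probabilities of the exceptional pool events. -/

section PoolEvents

variable {m d n N : ℕ} {p σp σ0 : ℝ} (h0 : 0 ≤ p) (h1 : p ≤ 1)
include h0 h1

lemma isProbabilityMeasure_experimentLaw :
    IsProbabilityMeasure (experimentLaw m d n N p σp σ0) := by
  have := isProbabilityMeasure_dataLaw (d := d) (σp := σp) h0 h1
  unfold experimentLaw; infer_instance

/-- An event which only concerns the training data has the same probability under the joint law. -/
lemma experimentLaw_train_le (B : Set (TrainData m d n)) :
    experimentLaw m d n N p σp σ0 {ω | ω.1 ∈ B} ≤ trainLaw m d n p σp σ0 B := by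
  have := isProbabilityMeasure_dataLaw (d := d) (σp := σp) h0 h1
  have h2 : {ω : TrainData m d n × (Fin N → Sample d) | ω.1 ∈ B} = B ×ˢ Set.univ := by
    ext; simp
  rw [h2, experimentLaw, Measure.prod_prod, measure_univ, mul_one]
  rfl

lemma experimentLaw_weak_samples :
    experimentLaw m d n N p σp σ0 {ω | ((weakSamples ω.2).card : ℝ) < p * N / 2} ≤
      ENNReal.ofReal (Real.exp (-(p * N / 8))) := by
  have := isProbabilityMeasure_dataLaw (d := d) (σp := σp) h0 h1
  have h2 : {ω : TrainData m d n × (Fin N → Sample d) |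
      ((weakSamples ω.2).card : ℝ) < p * N / 2} = Set.univ ×ˢ {P : Fin N → Sample d |
      (({a | P a ∈ {x : Sample d | x.feature = 1}} : Set (Fin N)).ncard : ℝ) < p * N / 2} := by
    ext ω
    simp [weakSamples, Set.ncard_eq_toFinset_card']
  rw [h2, experimentLaw, Measure.prod_prod, measure_univ, one_mul]
  exact pi_card_filter_lt_le N _ (measurable_feature (measurableSet_singleton 1))
    (dataLaw_weak h0 h1).ge

/-- Given the trained weights, the pool noise acts on all neurons at the Gaussian scale. -/
lemma experimentLaw_pool_noise (hσ : 0 ≤ σp) {V : TrainData m d n → Weights m d}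
    (hV : ∀ j r, Measurable fun z => V z j r) {l : ℝ} (hl : 0 ≤ l) :
    experimentLaw m d n N p σp σ0 {ω | ∃ q : Fin N × Bool × Fin m,
      σp * ‖V ω.1 q.2.1 q.2.2‖ * l < |inner ℝ (V ω.1 q.2.1 q.2.2) (ω.2 q.1).noise|} ≤
      ENNReal.ofReal (2 * m * N * (2 * Real.exp (-(l ^ 2 / 2)))) := by
  have := isProbabilityMeasure_dataLaw (d := d) (σp := σp) h0 h1
  have h := measure_exists_le (experimentLaw m d n N p σp σ0)
    (p := fun (q : Fin N × Bool × Fin m) ω =>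
      σp * ‖V ω.1 q.2.1 q.2.2‖ * l < |inner ℝ (V ω.1 q.2.1 q.2.2) (ω.2 q.1).noise|)
    (ε := 2 * Real.exp (-(l ^ 2 / 2))) fun q => ?_
  · refine h.trans_eq ?_
    congr 2
    simp; ring
  have hVm : Measurable fun ω : TrainData m d n × (Fin N → Sample d) => V ω.1 q.2.1 q.2.2 :=
    (hV q.2.1 q.2.2).comp measurable_fst
  have hPm : Measurable fun ω : TrainData m d n × (Fin N → Sample d) => (ω.2 q.1).noise :=
    measurable_noise.comp ((measurable_pi_apply q.1).comp measurable_snd)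
  have hm : MeasurableSet {ω : TrainData m d n × (Fin N → Sample d) |
      σp * ‖V ω.1 q.2.1 q.2.2‖ * l < |inner ℝ (V ω.1 q.2.1 q.2.2) (ω.2 q.1).noise|} :=
    measurableSet_lt ((measurable_const.mul hVm.norm).mul measurable_const)
      (hVm.inner hPm).abs
  refine prod_le_of_forall_section_le _ _ hm fun z => ?_
  have hA : MeasurableSet {x : Vec d |
      σp * ‖V z q.2.1 q.2.2‖ * l < |inner ℝ (V z q.2.1 q.2.2) x|} :=
    measurableSet_lt measurable_const (by fun_prop)
  exact (sampleLaw_noise h0 h1 q.1 hA).trans_le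
    (gaussianNoise_abs_inner_gt_le hσ (V z q.2.1 q.2.2) hl)

end PoolEvents

/-! ### From the parameter conditions to the deterministic estimates. -/

section Arithmetic

lemma one_le_log_div {a δ : ℝ} (ha : 1 ≤ a) (hδ : 0 < δ) (hδ' : δ ≤ 1 / 3) :
    1 ≤ Real.log (a / δ) := by
  rw [Real.le_log_iff_exp_le (by positivity)]
  have h1 : 3 ≤ a / δ := by
    rw [le_div_iff₀ hδ]; linarith
  linarith [Real.exp_one_lt_d9]

/-- The Gaussian tail at the level `2 √(log (a / δ))`. -/
lemma exp_neg_sq_log {a δ : ℝ} (ha : 1 ≤ a) (hδ : 0 < δ) (hδ' : δ ≤ 1 / 3) :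
    Real.exp (-((2 * Real.sqrt (Real.log (a / δ))) ^ 2 / 2)) = (δ / a) ^ 2 := by
  have h0 : 0 < a / δ := by positivity
  have h1 := one_le_log_div ha hδ hδ'
  rw [mul_pow, Real.sq_sqrt (by linarith)]
  have : -((2 : ℝ) ^ 2 * Real.log (a / δ) / 2) = Real.log ((δ / a) ^ 2) := by
    rw [Real.log_pow, ← inv_div a δ, Real.log_inv]; push_cast; ring
  rw [this, Real.exp_log (by positivity)]

lemma exp_neg_le_div {a δ x : ℝ} (ha : 0 < a) (hδ : 0 < δ) (h : Real.log (a / δ) ≤ x) :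
    Real.exp (-x) ≤ δ / a := by
  have h1 : Real.exp (-x) ≤ Real.exp (-Real.log (a / δ)) := Real.exp_le_exp.2 (by linarith)
  rwa [Real.exp_neg (Real.log _), Real.exp_log (by positivity), inv_div] at h1

end Arithmetic

namespace Params

variable {θ : Params} {K C : ℝ}

lemma Basic.one_le_n0 (hB : θ.Basic) : (1 : ℝ) ≤ θ.n0 := by exact_mod_cast hB.n0_pos

lemma Basic.one_le_m (hB : θ.Basic) : (1 : ℝ) ≤ θ.m := by exact_mod_cast hB.m_pos

lemma Basic.n0_le_ntilde (hB : θ.Basic) : (θ.n0 : ℝ) ≤ θ.ntilde := by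
  have := hB.sizes
  exact_mod_cast (show θ.n0 ≤ θ.ntilde by omega)

lemma Basic.one_le_log_Tstar (hB : θ.Basic) : 1 ≤ Real.log θ.Tstar := by
  have := hB.Tstar_ge
  rw [Real.le_log_iff_exp_le (by linarith)]
  linarith [Real.exp_one_lt_d9]

lemma Training.dim_ge (hB : θ.Basic) (hT : θ.Training K C) (hC : 0 < C) (hδ : θ.δ ≤ 1 / 3) :
    C * (θ.n0 ^ 2 * Real.log (θ.ntilde * θ.m / θ.δ)) ≤ θ.d := by
  have hn := hB.one_le_n0
  have hm := hB.one_le_m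
  have hnt := hB.n0_le_ntilde
  have hT1 := hB.one_le_log_Tstar
  have hX := one_le_log_div (a := θ.ntilde * θ.m) (by nlinarith) hB.δ_pos hδ
  refine le_trans (mul_le_mul_of_nonneg_left ?_ hC.le) hT.d_ge_sq
  have h1 : (1 : ℝ) ≤ Real.log θ.Tstar ^ 2 := by nlinarith
  calc (θ.n0 : ℝ) ^ 2 * Real.log (θ.ntilde * θ.m / θ.δ)
      ≤ θ.ntilde ^ 2 * Real.log (θ.ntilde * θ.m / θ.δ) := by gcongr
    _ ≤ _ := le_mul_of_one_le_right (by positivity) h1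

lemma Training.dim_ge_norm (hB : θ.Basic) (hT : θ.Training K C) (hC : 0 < C) (l : Fin 2) :
    C * (θ.n0 * ‖θ.μ l‖ ^ 2) ≤ θ.σp ^ 2 * θ.d := by
  have hs := hB.σp_pos
  have h1 := hT.d_ge_norm l
  have h2 : θ.ntilde * ‖θ.μ l‖ ^ 2 / θ.σp ^ 2 ≤
      θ.ntilde * ‖θ.μ l‖ ^ 2 / θ.σp ^ 2 * Real.log θ.Tstar :=
    le_mul_of_one_le_right (by positivity) hB.one_le_log_Tstar
  have h3 : C * (θ.n0 * ‖θ.μ l‖ ^ 2 / θ.σp ^ 2) ≤ θ.d := by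
    refine le_trans (mul_le_mul_of_nonneg_left (le_trans ?_ h2) hC.le) h1
    have := hB.n0_le_ntilde
    gcongr
  calc C * (θ.n0 * ‖θ.μ l‖ ^ 2) = θ.σp ^ 2 * (C * (θ.n0 * ‖θ.μ l‖ ^ 2 / θ.σp ^ 2)) := by
        field_simp
    _ ≤ _ := by gcongr

lemma Training.d_pos (hB : θ.Basic) (hT : θ.Training K C) (hC : 0 < C) (hδ : θ.δ ≤ 1 / 3) :
    (0 : ℝ) < θ.d := by
  refine lt_of_lt_of_le ?_ (hT.dim_ge hB hC hδ)
  have hn := hB.one_le_n0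
  have hm := hB.one_le_m
  have hnt := hB.n0_le_ntilde
  have hX := one_le_log_div (a := θ.ntilde * θ.m) (by nlinarith) hB.δ_pos hδ
  positivity

lemma log_n0_le (hB : θ.Basic) :
    Real.log (θ.n0 / θ.δ) ≤ Real.log (θ.ntilde * θ.m / θ.δ) := by
  have hn := hB.one_le_n0
  have hm := hB.one_le_m
  have hnt := hB.n0_le_ntilde
  have hδ := hB.δ_pos
  refine Real.log_le_log (by positivity) ?_
  gcongr
  nlinarith

/-- The gap makes the strong feature large compared to the noise level of the memorization. -/
lemma NormGap.norm_sq_ge (hG : θ.NormGap C) :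
    C * (θ.σp ^ 2 * Real.sqrt (θ.d / θ.n0 * Real.log (θ.m / θ.δ'))) ≤ ‖θ.μ 0‖ ^ 2 := by
  have : C * (θ.σp ^ 2 * Real.sqrt (θ.d / θ.n0 * Real.log (θ.m / θ.δ'))) ≤
    ‖θ.μ 0‖ ^ 2 - ‖θ.μ 1‖ ^ 2 := hG
  linarith [sq_nonneg ‖θ.μ 1‖]

/-- The weak norm bound puts ‖μ 1‖² below √K σp²√(d/n0), while the gap puts ‖μ 0‖² above C
σp²√(d/n0), because log(m/δ') ≥ 1. -/
lemma weak_sq_le (hB : θ.Basic) (hF : θ.FeatureNorms K C) (hG : θ.NormGap C) (hK : 0 < K)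
    (hC : 0 < C) (hδ' : θ.δ' ≤ 1 / 3) {e : ℝ} (he : Real.sqrt K ≤ e * C) :
    ‖θ.μ 1‖ ^ 2 ≤ e * ‖θ.μ 0‖ ^ 2 := by
  have hn := hB.one_le_n0
  have hY := one_le_log_div hB.one_le_m hB.δ'_pos hδ'
  have he0 : 0 ≤ e := by
    by_contra hc
    push Not at hc
    linarith [Real.sqrt_nonneg K, mul_neg_of_neg_of_pos hc hC]
  have h1 : ‖θ.μ 1‖ ^ 2 ≤ Real.sqrt K * (θ.σp ^ 2 * Real.sqrt (θ.d / θ.n0)) := by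
    refine le_of_sq_le_sq ?_ (by positivity)
    rw [mul_pow, mul_pow, Real.sq_sqrt hK.le, Real.sq_sqrt (by positivity)]
    calc (‖θ.μ 1‖ ^ 2) ^ 2 = ‖θ.μ 1‖ ^ 4 := by ring
      _ ≤ _ := hF.weak
      _ = _ := by ring
  have h2 : Real.sqrt (θ.d / θ.n0) ≤ Real.sqrt (θ.d / θ.n0 * Real.log (θ.m / θ.δ')) :=
    Real.sqrt_le_sqrt (le_mul_of_one_le_right (by positivity) hY)
  calc ‖θ.μ 1‖ ^ 2 ≤ Real.sqrt K * (θ.σp ^ 2 * Real.sqrt (θ.d / θ.n0)) := h1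
    _ ≤ e * C * (θ.σp ^ 2 * Real.sqrt (θ.d / θ.n0 * Real.log (θ.m / θ.δ'))) := by gcongr
    _ = e * (C * (θ.σp ^ 2 * Real.sqrt (θ.d / θ.n0 * Real.log (θ.m / θ.δ')))) := by ring
    _ ≤ _ := mul_le_mul_of_nonneg_left hG.norm_sq_ge he0

/-- The Gaussian correlation has size σp²√(d log(n0/δ)), which d ≥ C n0² log(n0/δ) puts below
σp²d/n0 with a factor √C to spare. -/
lemma noise_correlation_le (hB : θ.Basic) (hT : θ.Training K C) (hδ : θ.δ ≤ 1 / 3) {e x : ℝ}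
    (he : 0 < e) (heC : 4 ≤ e * Real.sqrt C) (hC : 0 < C)
    (hx : x ^ 2 ≤ 2 * (θ.σp ^ 2 * θ.d)) :
    θ.σp * x * (2 * Real.sqrt (Real.log (θ.n0 / θ.δ))) ≤ e * (θ.σp ^ 2 * θ.d) / θ.n0 := by
  have hn := hB.one_le_n0
  have hs := hB.σp_pos
  have hX := one_le_log_div hn hB.δ_pos hδ
  have hd := hT.d_pos hB hC hδ
  set a := Real.sqrt (Real.log (θ.n0 / θ.δ)) with ha
  set u := Real.sqrt θ.d with hu
  have ha0 : 0 ≤ a := Real.sqrt_nonneg _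
  have hu0 : 0 ≤ u := Real.sqrt_nonneg _
  have hu2 : u * u = θ.d := Real.mul_self_sqrt hd.le
  have ha2 : a ^ 2 = Real.log (θ.n0 / θ.δ) := Real.sq_sqrt (by linarith)
  have hxu : x ≤ 2 * (θ.σp * u) := by
    refine le_of_sq_le_sq (hx.trans ?_) (by positivity)
    have : (2 * (θ.σp * u)) ^ 2 = 4 * (θ.σp ^ 2 * θ.d) := by rw [← hu2]; ring
    rw [this]
    have : 0 ≤ θ.σp ^ 2 * θ.d := by positivity
    linarith
  have h1 : Real.sqrt C * (θ.n0 * a) ≤ u := by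
    refine le_of_sq_le_sq ?_ hu0
    rw [mul_pow, Real.sq_sqrt hC.le, mul_pow, ha2, sq u, hu2]
    refine le_trans (mul_le_mul_of_nonneg_left ?_ hC.le) (hT.dim_ge hB hC hδ)
    exact mul_le_mul_of_nonneg_left (log_n0_le hB) (by positivity)
  rw [le_div_iff₀ (by linarith), ← hu2]
  have h2 : 4 * (θ.n0 * a) ≤ e * u := by
    calc 4 * (θ.n0 * a) ≤ e * Real.sqrt C * (θ.n0 * a) := by gcongr
      _ = e * (Real.sqrt C * (θ.n0 * a)) := by ring
      _ ≤ _ := by gcongr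
  calc θ.σp * x * (2 * a) * θ.n0 ≤ θ.σp * (2 * (θ.σp * u)) * (2 * a) * θ.n0 := by gcongr
    _ = θ.σp ^ 2 * u * (4 * (θ.n0 * a)) := by ring
    _ ≤ θ.σp ^ 2 * u * (e * u) := by gcongr
    _ = _ := by ring

lemma feature_correlation_le (hB : θ.Basic) (hF : θ.FeatureNorms K C) (hδ : θ.δ ≤ 1 / 3) {e : ℝ}
    (he : 0 < e) (heC : 4 ≤ e * Real.sqrt C) (hC : 0 < C) (l : Fin 2) :
    θ.σp * ‖θ.μ l‖ * (2 * Real.sqrt (Real.log (θ.n0 / θ.δ))) ≤ e * ‖θ.μ l‖ ^ 2 := by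
  have hs := hB.σp_pos
  have hX := one_le_log_div hB.one_le_n0 hB.δ_pos hδ
  set a := Real.sqrt (Real.log (θ.n0 / θ.δ)) with ha
  have ha2 : a ^ 2 = Real.log (θ.n0 / θ.δ) := Real.sq_sqrt (by linarith)
  have h1 : Real.sqrt C * (θ.σp * a) ≤ ‖θ.μ l‖ := by
    refine le_of_sq_le_sq ?_ (norm_nonneg _)
    rw [mul_pow, Real.sq_sqrt hC.le, mul_pow, ha2]
    exact hF.norm_sq_ge l
  have ha0 : 0 ≤ a := Real.sqrt_nonneg _
  have h2 : 2 * (θ.σp * a) ≤ e * ‖θ.μ l‖ := by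
    calc 2 * (θ.σp * a) ≤ 4 * (θ.σp * a) := by
          have : 0 ≤ θ.σp * a := by positivity
          linarith
      _ ≤ e * Real.sqrt C * (θ.σp * a) := by gcongr
      _ = e * (Real.sqrt C * (θ.σp * a)) := by ring
      _ ≤ _ := by gcongr
  calc _ = 2 * (θ.σp * a) * ‖θ.μ l‖ := by ring
    _ ≤ e * ‖θ.μ l‖ * ‖θ.μ l‖ := by gcongr
    _ = _ := by ring

/-- Against a norm of order σp√d, the bound σ0 ≤ C⁻¹√n0/(σp d) leaves a multiple of C⁻¹√(n0 log/d),
and d dominates n0 times the logarithm. -/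
lemma init_noise_le (hB : θ.Basic) (hT : θ.Training K C) (hδ : θ.δ ≤ 1 / 3) {e x : ℝ}
    (heC : 4 ≤ e * C) (hC : 1 ≤ C) (hx0 : 0 ≤ x)
    (hx : x ^ 2 ≤ 2 * (θ.σp ^ 2 * θ.d)) :
    θ.σ0 * x * (2 * Real.sqrt (Real.log (θ.ntilde * θ.m / θ.δ))) ≤ e := by
  have hn := hB.one_le_n0
  have hs := hB.σp_pos
  have hσ0 := hB.σ0_pos
  have hnt := hB.n0_le_ntilde
  have hX := one_le_log_div (a := θ.ntilde * θ.m) (by nlinarith [hB.one_le_m]) hB.δ_pos hδ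
  have hC0 : 0 < C := by linarith
  have hd := hT.d_pos hB hC0 hδ
  set g := Real.sqrt (Real.log (θ.ntilde * θ.m / θ.δ)) with hg
  set u := Real.sqrt θ.d with hu
  set v := Real.sqrt θ.n0 with hv
  have hg0 : 0 ≤ g := Real.sqrt_nonneg _
  have hu0 : 0 < u := Real.sqrt_pos.2 hd
  have hv0 : 0 ≤ v := Real.sqrt_nonneg _
  have hu2 : u * u = θ.d := Real.mul_self_sqrt hd.le
  have hxu : x ≤ 2 * (θ.σp * u) := by
    refine le_of_sq_le_sq (hx.trans ?_) (by positivity)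
    have : (2 * (θ.σp * u)) ^ 2 = 4 * (θ.σp ^ 2 * θ.d) := by rw [← hu2]; ring
    rw [this]
    have : 0 ≤ θ.σp ^ 2 * θ.d := by positivity
    linarith
  have h1 : v * g ≤ u := by
    refine le_of_sq_le_sq ?_ hu0.le
    rw [mul_pow, sq u, hu2, Real.sq_sqrt (by linarith), Real.sq_sqrt (by linarith)]
    refine le_trans ?_ (hT.dim_ge hB hC0 hδ)
    have h2 : (θ.n0 : ℝ) ≤ θ.n0 ^ 2 := by nlinarith
    calc (θ.n0 : ℝ) * Real.log (θ.ntilde * θ.m / θ.δ)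
        ≤ θ.n0 ^ 2 * Real.log (θ.ntilde * θ.m / θ.δ) := by gcongr
      _ ≤ _ := le_mul_of_one_le_left (by positivity) hC
  calc θ.σ0 * x * (2 * g) ≤ C⁻¹ * (v / (θ.σp * θ.d)) * (2 * (θ.σp * u)) * (2 * g) := by
        gcongr
        exact hT.σ0_le_d
    _ = 4 * C⁻¹ * (v * g / u) := by
        rw [← hu2]; field_simp; ring
    _ ≤ 4 * C⁻¹ * 1 := by
        gcongr
        rw [div_le_one hu0]; exact h1
    _ ≤ e := by
        rw [mul_one, ← div_eq_mul_inv, div_le_iff₀ hC0]; exact heC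

/-- The target carries the factor n0‖μ 0‖²/D: one √n0 comes from the bound on σ0, the other from
log(m/δ) ≤ n0, and σp ≤ ‖μ 0‖ supplies the second power of the norm. -/
lemma init_feature_le (hB : θ.Basic) (hF : θ.FeatureNorms K C) (hT : θ.Training K C)
    (hδ : θ.δ ≤ 1 / 3) {e x : ℝ} (heC : 4 ≤ e * C) (hC : 1 ≤ C) (hx0 : 0 ≤ x)
    (hx : x ≤ ‖θ.μ 0‖) :
    θ.σ0 * x * (2 * Real.sqrt (Real.log (θ.m / θ.δ))) ≤
      e * (θ.n0 * ‖θ.μ 0‖ ^ 2 / (θ.σp ^ 2 * θ.d)) := by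
  have hn := hB.one_le_n0
  have hs := hB.σp_pos
  have hσ0 := hB.σ0_pos
  have hX := one_le_log_div hB.one_le_m hB.δ_pos hδ
  have hXn := one_le_log_div hn hB.δ_pos hδ
  have hC0 : 0 < C := by linarith
  have hd := hT.d_pos hB hC0 hδ
  set b := Real.sqrt (Real.log (θ.m / θ.δ)) with hb
  set v := Real.sqrt θ.n0 with hv
  have hb0 : 0 ≤ b := Real.sqrt_nonneg _
  have hv0 : 0 < v := Real.sqrt_pos.2 (by linarith)
  have hv2 : v * v = θ.n0 := Real.mul_self_sqrt (by linarith)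
  have hbv : b ≤ v := Real.sqrt_le_sqrt (by nlinarith [hT.n0_ge_log])
  have hsM : θ.σp ≤ ‖θ.μ 0‖ := by
    refine le_of_sq_le_sq (le_trans ?_ (hF.norm_sq_ge 0)) (norm_nonneg _)
    have h1 : θ.σp ^ 2 ≤ θ.σp ^ 2 * Real.log (θ.n0 / θ.δ) :=
      le_mul_of_one_le_right (sq_nonneg _) hXn
    exact h1.trans (le_mul_of_one_le_left (by positivity) hC)
  have hM0 : 0 < ‖θ.μ 0‖ := lt_of_lt_of_le hs hsM
  have he : 2 * C⁻¹ ≤ e := by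
    rw [← div_eq_mul_inv, div_le_iff₀ hC0]; linarith
  calc θ.σ0 * x * (2 * b) ≤ C⁻¹ * (v / (θ.σp * θ.d)) * ‖θ.μ 0‖ * (2 * v) := by
        gcongr
        exact hT.σ0_le_d
    _ = 2 * C⁻¹ * (v * v * ‖θ.μ 0‖ * θ.σp / (θ.σp ^ 2 * θ.d)) := by
        field_simp
    _ ≤ e * (v * v * ‖θ.μ 0‖ * ‖θ.μ 0‖ / (θ.σp ^ 2 * θ.d)) := by
        have : 0 ≤ e := le_trans (by positivity) he
        gcongr
    _ = _ := by rw [hv2]; ring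

lemma init_norm_le (hB : θ.Basic) (hT : θ.Training K C) (hδ : θ.δ ≤ 1 / 3) (hC : 2 ≤ C)
    {x : ℝ} (hx : x ^ 2 ≤ 2 * (θ.σ0 ^ 2 * θ.d)) :
    x ≤ Real.sqrt (θ.n0 / (θ.σp ^ 2 * θ.d)) := by
  have hn := hB.one_le_n0
  have hs := hB.σp_pos
  have hσ0 := hB.σ0_pos
  have hC0 : 0 < C := by linarith
  have hd := hT.d_pos hB hC0 hδ
  refine Real.le_sqrt_of_sq_le (hx.trans ?_)
  have h1 : θ.σ0 ≤ 1 / 2 * (Real.sqrt θ.n0 / (θ.σp * θ.d)) := by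
    refine hT.σ0_le_d.trans ?_
    gcongr
    rw [one_div]
    exact inv_anti₀ (by norm_num) hC
  calc 2 * (θ.σ0 ^ 2 * θ.d) ≤ 2 * ((1 / 2 * (Real.sqrt θ.n0 / (θ.σp * θ.d))) ^ 2 * θ.d) := by
        gcongr
    _ = 1 / 2 * (θ.n0 / (θ.σp ^ 2 * θ.d)) := by
        rw [mul_pow, div_pow (Real.sqrt _), Real.sq_sqrt (by linarith)]
        field_simp
    _ ≤ _ := by
        have : 0 ≤ θ.n0 / (θ.σp ^ 2 * θ.d) := by positivity
        linarith

/-- The response of the trained network to the pool noise is dominated by the learned strong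
feature. -/
lemma pool_noise_le (hB : θ.Basic) (hT : θ.Training K C) (hG : θ.NormGap C) (hδ : θ.δ ≤ 1 / 3)
    (hδ' : θ.δ' ≤ 1 / 3) {κ a0 A w e : ℝ} (hκ : 0 < κ) (ha0 : 0 < a0) (hA : a0 ≤ A)
    (hC : 0 < C) (he : 0 < e)
    (heC : (1 / a0 + 82) * Real.sqrt (2 * (κ + 1)) ≤ e * C)
    (hw : w ≤ (1 + 82 * A) * Real.sqrt (θ.n0 / (θ.σp ^ 2 * θ.d))) :
    θ.σp * w * Real.sqrt (2 * (κ + 1) * Real.log (θ.m / θ.δ')) ≤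
      e * (A * (θ.n0 * ‖θ.μ 0‖ ^ 2 / (θ.σp ^ 2 * θ.d))) := by
  have hn := hB.one_le_n0
  have hs := hB.σp_pos
  have hd := hT.d_pos hB hC hδ
  have hY := one_le_log_div hB.one_le_m hB.δ'_pos hδ'
  have hA0 : 0 < A := lt_of_lt_of_le ha0 hA
  set Y := Real.log (θ.m / θ.δ') with hYdef
  -- The lower bound on A absorbs the contribution of the initialisation to the norm of the weights.
  have h1 : 1 + 82 * A ≤ (1 / a0 + 82) * A := by
    have : 1 ≤ 1 / a0 * A := by
      rw [one_div, ← div_eq_inv_mul, le_div_iff₀ ha0]; linarith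
    linarith
  have h2 : Real.sqrt (2 * (κ + 1) * Y) = Real.sqrt (2 * (κ + 1)) * Real.sqrt Y :=
    Real.sqrt_mul (by positivity) _
  have h3 : θ.σp * Real.sqrt (θ.n0 / (θ.σp ^ 2 * θ.d)) = Real.sqrt (θ.n0 / θ.d) := by
    symm
    rw [Real.sqrt_eq_iff_mul_self_eq (by positivity) (by positivity)]
    have h4 := Real.mul_self_sqrt (show 0 ≤ θ.n0 / (θ.σp ^ 2 * θ.d) by positivity)
    calc (θ.n0 : ℝ) / θ.d = θ.σp ^ 2 * (θ.n0 / (θ.σp ^ 2 * θ.d)) := by field_simp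
      _ = _ := by rw [mul_mul_mul_comm, h4, sq]
  -- This is the gap condition multiplied by n0/(σp²d).
  have h5 : C * Real.sqrt (θ.n0 / θ.d) * Real.sqrt Y ≤
      θ.n0 * ‖θ.μ 0‖ ^ 2 / (θ.σp ^ 2 * θ.d) := by
    rw [le_div_iff₀ (by positivity)]
    have h6 := mul_le_mul_of_nonneg_left hG.norm_sq_ge (show (0 : ℝ) ≤ θ.n0 by positivity)
    refine le_trans (le_of_eq ?_) h6
    rw [Real.sqrt_mul (by positivity) Y, Real.sqrt_div (by positivity), Real.sqrt_div (by positivity)]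
    have hu2 := Real.mul_self_sqrt hd.le
    have hv2 := Real.mul_self_sqrt (show (0 : ℝ) ≤ θ.n0 by positivity)
    have hu0 : 0 < Real.sqrt θ.d := Real.sqrt_pos.2 hd
    have hv0 : 0 < Real.sqrt θ.n0 := Real.sqrt_pos.2 (by linarith)
    generalize Real.sqrt (θ.d : ℝ) = u at *
    generalize Real.sqrt (θ.n0 : ℝ) = v at *
    rw [← hu2, ← hv2]
    field_simp
  calc θ.σp * w * Real.sqrt (2 * (κ + 1) * Y)
      ≤ θ.σp * ((1 / a0 + 82) * A * Real.sqrt (θ.n0 / (θ.σp ^ 2 * θ.d))) *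
        Real.sqrt (2 * (κ + 1) * Y) := by
        gcongr
        exact hw.trans (by gcongr)
    _ = (1 / a0 + 82) * Real.sqrt (2 * (κ + 1)) * A *
        ((θ.σp * Real.sqrt (θ.n0 / (θ.σp ^ 2 * θ.d))) * Real.sqrt Y) := by rw [h2]; ring
    _ ≤ e * C * A * ((θ.σp * Real.sqrt (θ.n0 / (θ.σp ^ 2 * θ.d))) * Real.sqrt Y) := by gcongr
    _ = e * (A * (C * Real.sqrt (θ.n0 / θ.d) * Real.sqrt Y)) := by rw [h3]; ring
    _ ≤ _ := by gcongr

end Params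

/-! ### Assembly: failure probability and choice of constants. -/

namespace Params

variable {θ : Params} {K C e : ℝ}

/-- The training is typical outside of the union of the exceptional events. -/
lemma typicalTraining (hB : θ.Basic) (hF : θ.FeatureNorms K C) (hT : θ.Training K C)
    (hG : θ.NormGap C) (hδ : θ.δ ≤ 1 / 3) (hδ' : θ.δ' ≤ 1 / 3) (hK : 0 < K) (hC : 2 ≤ C)
    (he0 : 0 < e) (he1 : e ≤ 1 / 10000000) (heK : Real.sqrt K ≤ e * C) (he4 : 4 ≤ e * C)
    (hes : 4 ≤ e * Real.sqrt C) {z : TrainData θ.m θ.d θ.n0}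
    (g1 : ¬∃ i, ‖(z.2 i).noise‖ ^ 2 < θ.σp ^ 2 * θ.d / 2 ∨
      2 * (θ.σp ^ 2 * θ.d) < ‖(z.2 i).noise‖ ^ 2)
    (g2 : ¬∃ q : Bool × Fin θ.m, 2 * (θ.σ0 ^ 2 * θ.d) < ‖z.1 q.1 q.2‖ ^ 2)
    (g3 : ¬∃ q : Fin 2 × Fin θ.n0, θ.σp * ‖θ.μ q.1‖ *
      (2 * Real.sqrt (Real.log (θ.n0 / θ.δ))) < |inner ℝ (θ.μ q.1) (z.2 q.2).noise|)
    (g4 : ¬∃ q : Fin 2 × Bool × Fin θ.m, θ.σ0 * ‖θ.μ q.1‖ *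
      (2 * Real.sqrt (Real.log (θ.m / θ.δ))) < |inner ℝ (θ.μ q.1) (z.1 q.2.1 q.2.2)|)
    (g5 : ¬∃ q : Fin θ.n0 × Bool × Fin θ.m, θ.σ0 * ‖(z.2 q.1).noise‖ *
      (2 * Real.sqrt (Real.log (θ.ntilde * θ.m / θ.δ))) <
        |inner ℝ (z.2 q.1).noise (z.1 q.2.1 q.2.2)|)
    (g6 : ¬∃ q : Fin θ.n0 × Fin θ.n0, q.1 ≠ q.2 ∧ θ.σp * ‖(z.2 q.1).noise‖ *
      (2 * Real.sqrt (Real.log (θ.n0 / θ.δ))) < |inner ℝ (z.2 q.1).noise (z.2 q.2).noise|)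
    (g7 : ¬∃ q : Bool × Fin θ.n0,
      (({r | 0 ≤ inner ℝ (z.2 q.2).noise (z.1 q.1 r)} : Set (Fin θ.m)).ncard : ℝ)
        < 1 / 2 * θ.m / 2)
    (g8 : ¬∃ r : Fin θ.m,
      (({i | 0 ≤ inner ℝ (z.1 (z.2 i).label r) (z.2 i).noise} : Set (Fin θ.n0)).ncard : ℝ)
        < 1 / 2 * θ.n0 / 2)
    (g9 : ¬∃ y : Bool,
      (({i | (z.2 i).feature = 0 ∧ (z.2 i).label = y} : Set (Fin θ.n0)).ncard : ℝ)
        < 1 / 4 * θ.n0 / 2) :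
    TypicalTraining θ.μ z.2 z.1 (θ.σp ^ 2 * θ.d) e := by
  classical
  push Not at g1 g2 g3 g4 g5 g6 g7 g8 g9
  have hC0 : 0 < C := by linarith
  have hd := hT.d_pos hB hC0 hδ
  have hs := hB.σp_pos
  have hn := hB.one_le_n0
  have hD : 0 < θ.σp ^ 2 * θ.d := by positivity
  have hweak := weak_sq_le hB hF hG hK hC0 hδ' heK
  have hXn := one_le_log_div hn hB.δ_pos hδ
  have hμ : ∀ l, θ.μ l ≠ 0 := fun l h => by
    have h1 := hF.norm_sq_ge l
    rw [h, norm_zero] at h1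
    have h2 : 0 < C * (θ.σp ^ 2 * Real.log (θ.n0 / θ.δ)) := by positivity
    norm_num at h1
    linarith
  have hμ0 : ∀ l, ‖θ.μ l‖ ≤ ‖θ.μ 0‖ := by
    intro l
    fin_cases l
    · exact le_rfl
    · refine le_of_sq_le_sq (hweak.trans ?_) (norm_nonneg _)
      nlinarith [sq_nonneg ‖θ.μ 0‖]
  refine
    { m_pos := hB.m_pos
      n_pos := hB.n0_pos
      D_pos := hD
      e_pos := he0
      e_le := he1
      feature_ne := hμ
      orthogonal := hB.orthogonal
      weak_le := hweak
      dim_ge := ?_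
      le_norm_noise := fun i => (g1 i).1
      norm_noise_le := fun i => (g1 i).2
      noise_inner_noise := fun i k hik => (g6 (i, k) hik).trans
        (noise_correlation_le hB hT hδ he0 hes hC0 (g1 i).2)
      feature_inner_noise := fun l i => (g3 (l, i)).trans
        (feature_correlation_le hB hF hδ he0 hes hC0 l)
      init_inner_noise := fun j r i => ?_
      init_inner_feature := fun j r l => ?_
      init_norm := fun j r => init_norm_le hB hT hδ hC (g2 (j, r))
      active_neurons := fun i => ?_
      active_samples := fun r => ?_
      strong_samples := fun y => ?_ }
  · have h1 := hT.dim_ge_norm hB hC0 0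
    have h2 : 1 ≤ e * C := by linarith
    calc (θ.n0 : ℝ) * ‖θ.μ 0‖ ^ 2 ≤ e * C * (θ.n0 * ‖θ.μ 0‖ ^ 2) :=
          le_mul_of_one_le_left (by positivity) h2
      _ = e * (C * (θ.n0 * ‖θ.μ 0‖ ^ 2)) := by ring
      _ ≤ _ := mul_le_mul_of_nonneg_left h1 he0.le
  · rw [real_inner_comm]
    exact (g5 (i, j, r)).trans
      (init_noise_le hB hT hδ he4 (by linarith) (norm_nonneg _) (g1 i).2)
  · rw [real_inner_comm]
    exact (g4 (l, j, r)).trans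
      (init_feature_le hB hF hT hδ he4 (by linarith) (norm_nonneg _) (hμ0 l))
  · refine (show (θ.m : ℝ) / 4 = 1 / 2 * θ.m / 2 by ring).trans_le
      ((g7 ((z.2 i).label, i)).trans_eq ?_)
    rw [Set.ncard_eq_toFinset_card']
    exact congrArg (fun s : Finset _ => (s.card : ℝ)) (by ext; simp [real_inner_comm])
  · refine (show (θ.n0 : ℝ) / 4 = 1 / 2 * θ.n0 / 2 by ring).trans_le ((g8 r).trans_eq ?_)
    rw [Set.ncard_eq_toFinset_card']
    exact congrArg (fun s : Finset _ => (s.card : ℝ)) (by ext; simp)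
  · refine (show (θ.n0 : ℝ) / 8 = 1 / 4 * θ.n0 / 2 by ring).trans_le ((g9 y).trans_eq ?_)
    rw [Set.ncard_eq_toFinset_card']
    exact congrArg (fun s : Finset _ => (s.card : ℝ)) (by ext; simp)

/-- Training is typical with high probability. -/
lemma trainLaw_not_typical_le (hB : θ.Basic) (hF : θ.FeatureNorms K C) (hT : θ.Training K C)
    (hG : θ.NormGap C) (hδ : θ.δ ≤ 1 / 3) (hδ' : θ.δ' ≤ 1 / 3) (hK : 0 < K) (hC : 32 ≤ C)
    (he0 : 0 < e) (he1 : e ≤ 1 / 10000000) (heK : Real.sqrt K ≤ e * C) (he4 : 4 ≤ e * C)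
    (hes : 4 ≤ e * Real.sqrt C) :
    trainLaw θ.m θ.d θ.n0 θ.p θ.σp θ.σ0
      {z | ¬TypicalTraining θ.μ z.2 z.1 (θ.σp ^ 2 * θ.d) e} ≤ ENNReal.ofReal (27 * θ.δ) := by
  have hC0 : 0 < C := by linarith
  have hn := hB.one_le_n0
  have hm := hB.one_le_m
  have hnt := hB.n0_le_ntilde
  have hδ0 := hB.δ_pos
  have hp := hB.p_pos
  have hp2 := hB.p_lt
  have hp1 : θ.p ≤ 1 := by linarith
  have hnm : 1 ≤ (θ.ntilde : ℝ) * θ.m := by nlinarith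
  have hXn := one_le_log_div hn hδ0 hδ
  have hXm := one_le_log_div hm hδ0 hδ
  have hX := one_le_log_div hnm hδ0 hδ
  have hdX : 16 * Real.log (θ.ntilde * θ.m / θ.δ) ≤ θ.d := by
    refine le_trans ?_ (hT.dim_ge hB hC0 hδ)
    have h2 : (1 : ℝ) ≤ θ.n0 ^ 2 := by nlinarith
    calc 16 * Real.log (θ.ntilde * θ.m / θ.δ) ≤ C * (1 * Real.log (θ.ntilde * θ.m / θ.δ)) := by
          rw [one_mul]; gcongr; linarith
      _ ≤ _ := by gcongr
  have hed : Real.exp (-(θ.d / 16 : ℝ)) ≤ θ.δ / (θ.ntilde * θ.m) :=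
    exp_neg_le_div (by linarith) hδ0 (by linarith)
  have hem : Real.exp (-(1 / 2 * θ.m / 8 : ℝ)) ≤ θ.δ / θ.n0 :=
    exp_neg_le_div (by linarith) hδ0 (by nlinarith [hT.m_ge])
  have hen : Real.exp (-(1 / 2 * θ.n0 / 8 : ℝ)) ≤ θ.δ / θ.m :=
    exp_neg_le_div (by linarith) hδ0 (by nlinarith [hT.n0_ge_log])
  have hen' : Real.exp (-(1 / 4 * θ.n0 / 8 : ℝ)) ≤ θ.δ / θ.m :=
    exp_neg_le_div (by linarith) hδ0 (by nlinarith [hT.n0_ge_log])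
  have hle : ∀ a : ℝ, 1 ≤ a → a * (θ.δ / a) = θ.δ := fun a ha => by
    have : a ≠ 0 := by linarith
    field_simp
  have hdiv : ∀ a b : ℝ, 1 ≤ a → a ≤ b → θ.δ / b ≤ θ.δ / a := fun a b ha hab => by gcongr
  have hle1 : ∀ a : ℝ, 1 ≤ a → θ.δ / a ≤ 1 := fun a ha => by
    rw [div_le_one (by linarith)]; linarith
  have hsq : ∀ a : ℝ, 1 ≤ a → a * (θ.δ / a) ^ 2 ≤ θ.δ := fun a ha => by
    have h1 : 0 ≤ θ.δ / a := by positivity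
    calc a * (θ.δ / a) ^ 2 = a * (θ.δ / a) * (θ.δ / a) := by ring
      _ = θ.δ * (θ.δ / a) := by rw [hle a ha]
      _ ≤ θ.δ * 1 := by gcongr; exact hle1 a ha
      _ = θ.δ := mul_one _
  have l0 : ∀ x : ℝ, 0 ≤ 2 * Real.sqrt x := fun x => by positivity
  have b1 := trainLaw_norm_noise (m := θ.m) (d := θ.d) (n := θ.n0) (σ0 := θ.σ0) hp.le hp1
    hB.σp_pos.ne'
  have b2 := trainLaw_norm_weight (m := θ.m) (d := θ.d) (n := θ.n0) (σp := θ.σp) (σ0 := θ.σ0)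
    hp.le hp1
  have b3 := trainLaw_feature_noise (m := θ.m) (n := θ.n0) (σ0 := θ.σ0) hp.le hp1
    hB.σp_pos.le θ.μ (l0 (Real.log (θ.n0 / θ.δ)))
  have b4 := trainLaw_weight_feature (m := θ.m) (n := θ.n0) (σp := θ.σp) hp.le hp1
    hB.σ0_pos.le θ.μ (l0 (Real.log (θ.m / θ.δ)))
  have b5 := trainLaw_weight_noise (m := θ.m) (d := θ.d) (n := θ.n0) (σp := θ.σp) hp.le hp1
    hB.σ0_pos.le (l0 (Real.log (θ.ntilde * θ.m / θ.δ)))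
  have b6 := trainLaw_noise_noise (m := θ.m) (d := θ.d) (n := θ.n0) (σ0 := θ.σ0) hp.le hp1
    hB.σp_pos.le (l0 (Real.log (θ.n0 / θ.δ)))
  have b7 := trainLaw_active_neurons (m := θ.m) (d := θ.d) (n := θ.n0) (σp := θ.σp) (σ0 := θ.σ0)
    hp.le hp1
  have b8 := trainLaw_active_samples (m := θ.m) (d := θ.d) (n := θ.n0) (σp := θ.σp) (σ0 := θ.σ0)
    hp.le hp1
  have b9 := trainLaw_strong_samples (m := θ.m) (d := θ.d) (n := θ.n0) (σp := θ.σp) (σ0 := θ.σ0)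
    hp.le hp1 hp2.le
  rw [exp_neg_sq_log hn hδ0 hδ] at b3 b6
  rw [exp_neg_sq_log hm hδ0 hδ] at b4
  rw [exp_neg_sq_log hnm hδ0 hδ] at b5
  have r1 : θ.n0 * (2 * Real.exp (-(θ.d / 16 : ℝ))) ≤ 2 * θ.δ := by
    have h1 := hed.trans (hdiv θ.n0 _ hn (hnt.trans (le_mul_of_one_le_right (by linarith) hm)))
    have h2 := mul_le_mul_of_nonneg_left h1 (show (0 : ℝ) ≤ θ.n0 by linarith)
    rw [hle _ hn] at h2
    linarith
  have r2 : 2 * θ.m * Real.exp (-(θ.d / 16 : ℝ)) ≤ 2 * θ.δ := by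
    have h1 := hed.trans (hdiv θ.m _ hm (le_mul_of_one_le_left (by linarith) (hn.trans hnt)))
    have h2 := mul_le_mul_of_nonneg_left h1 (show (0 : ℝ) ≤ θ.m by linarith)
    rw [hle _ hm] at h2
    linarith
  have r3 : 2 * θ.n0 * (2 * (θ.δ / θ.n0) ^ 2) ≤ 4 * θ.δ := by linarith [hsq _ hn]
  have r4 : 4 * θ.m * (2 * (θ.δ / θ.m) ^ 2) ≤ 8 * θ.δ := by linarith [hsq _ hm]
  have r5 : 2 * θ.m * θ.n0 * (2 * (θ.δ / (θ.ntilde * θ.m)) ^ 2) ≤ 4 * θ.δ := by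
    have h1 := hsq _ hnm
    have h2 : (θ.m : ℝ) * θ.n0 * (θ.δ / (θ.ntilde * θ.m)) ^ 2 ≤
        θ.ntilde * θ.m * (θ.δ / (θ.ntilde * θ.m)) ^ 2 := by
      rw [mul_comm (θ.m : ℝ)]; gcongr
    linarith
  -- The n0² pairs are the reason for the level 2√(log(n0/δ)), whose tail is the square of δ/n0.
  have r6 : θ.n0 * θ.n0 * (2 * (θ.δ / θ.n0) ^ 2) ≤ 2 * θ.δ := by
    have h1 : θ.n0 * θ.n0 * (2 * (θ.δ / θ.n0) ^ 2) =
      2 * ((θ.n0 * (θ.δ / θ.n0)) * (θ.n0 * (θ.δ / θ.n0))) := by ring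
    rw [h1, hle _ hn]
    nlinarith
  have r7 : 2 * θ.n0 * Real.exp (-(1 / 2 * θ.m / 8 : ℝ)) ≤ 2 * θ.δ := by
    have h2 := mul_le_mul_of_nonneg_left hem (show (0 : ℝ) ≤ θ.n0 by linarith)
    rw [hle _ hn] at h2
    linarith
  have r8 : θ.m * Real.exp (-(1 / 2 * θ.n0 / 8 : ℝ)) ≤ θ.δ := by
    have h2 := mul_le_mul_of_nonneg_left hen (show (0 : ℝ) ≤ θ.m by linarith)
    rwa [hle _ hm] at h2
  have r9 : 2 * Real.exp (-(1 / 4 * θ.n0 / 8 : ℝ)) ≤ 2 * θ.δ := by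
    have h1 := hdiv 1 _ le_rfl hm
    rw [div_one] at h1
    linarith
  have hsum : 27 * θ.δ = 2 * θ.δ + (2 * θ.δ + (4 * θ.δ + (8 * θ.δ + (4 * θ.δ +
      (2 * θ.δ + (2 * θ.δ + (θ.δ + 2 * θ.δ))))))) := by ring
  rw [hsum]
  repeat rw [ENNReal.ofReal_add (by positivity) (by positivity)]
  refine le_trans (measure_mono ?_) ((measure_union_le _ _).trans (add_le_add
    (b1.trans (ENNReal.ofReal_le_ofReal r1)) ((measure_union_le _ _).trans (add_le_add
    (b2.trans (ENNReal.ofReal_le_ofReal r2)) ((measure_union_le _ _).trans (add_le_add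
    (b3.trans (ENNReal.ofReal_le_ofReal r3)) ((measure_union_le _ _).trans (add_le_add
    (b4.trans (ENNReal.ofReal_le_ofReal r4)) ((measure_union_le _ _).trans (add_le_add
    (b5.trans (ENNReal.ofReal_le_ofReal r5)) ((measure_union_le _ _).trans (add_le_add
    (b6.trans (ENNReal.ofReal_le_ofReal r6)) ((measure_union_le _ _).trans (add_le_add
    (b7.trans (ENNReal.ofReal_le_ofReal r7)) ((measure_union_le _ _).trans (add_le_add
    (b8.trans (ENNReal.ofReal_le_ofReal r8))
    (b9.trans (ENNReal.ofReal_le_ofReal r9))))))))))))))))))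
  intro z hz
  by_contra hcon
  simp only [Set.mem_union, Set.mem_ofPred_eq, not_or] at hcon
  obtain ⟨g1, g2, g3, g4, g5, g6, g7, g8, g9⟩ := hcon
  exact hz (typicalTraining hB hF hT hG hδ hδ' hK (by linarith) he0 he1 heK he4 hes
    (by simpa only [not_exists, not_or] using g1) g2 g3 g4 g5 g6 g7 g8 g9)

/-- The querying event holds with high probability, for suitable constants. -/
lemma experimentLaw_not_queryingEvent_le {κ c a0 : ℝ} (hB : θ.Basic) (hF : θ.FeatureNorms K C)
    (hT : θ.Training K C) (hP : θ.Pool κ C) (hG : θ.NormGap C) (hK : 0 < K) (hκ : 0 < κ)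
    (ha0pos : 0 < a0) (ha01 : a0 ≤ 1) (ha0c : a0 ≤ c / 20) (hC100 : 100 ≤ C)
    (heK : Real.sqrt K ≤ 1 / 10000000 * a0 * C) (he4 : 4 ≤ 1 / 10000000 * a0 * C)
    (hes : 4 ≤ 1 / 10000000 * a0 * Real.sqrt C)
    (hBC : (1 / a0 + 82) * Real.sqrt (2 * (κ + 1)) ≤ 1 / 10000000 * C)
    {τ : TrainData θ.m θ.d θ.n0 → ℕ} (hτ : Measurable τ)
    (hτb : ∀ z, c * (θ.n0 * θ.m / (θ.η * θ.σp ^ 2 * θ.d)) ≤ (τ z : ℝ)) :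
    experimentLaw θ.m θ.d θ.n0 θ.N θ.p θ.σp θ.σ0
      {ω | ¬QueryingEvent θ.μ θ.p θ.nstar ω.1.1
        (gdIter θ.μ θ.η ω.1.2 ω.1.1 (τ ω.1)) ω.1.2 ω.2} ≤ ENNReal.ofReal (C * (θ.δ + θ.δ')) := by
  have hC0 : 0 < C := by linarith
  have he0 : 0 < 1 / 10000000 * a0 := by positivity
  have he1 : 1 / 10000000 * a0 ≤ 1 / 10000000 := by linarith
  have hδ0 := hB.δ_pos
  have hδ0' := hB.δ'_pos
  have hp := hB.p_pos
  have hp1 : θ.p ≤ 1 := by linarith [hB.p_lt]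
  have := isProbabilityMeasure_experimentLaw (m := θ.m) (d := θ.d) (n := θ.n0) (N := θ.N)
    (σp := θ.σp) (σ0 := θ.σ0) hp.le hp1
  have hCδ : 100 * (θ.δ + θ.δ') ≤ C * (θ.δ + θ.δ') :=
    mul_le_mul_of_nonneg_right hC100 (by positivity)
  -- If δ or δ' exceeds 1/3, the claimed bound exceeds 1 because C ≥ 100. Below 1/3 all the
  -- logarithms are at least 1.
  by_cases hδ : θ.δ ≤ 1 / 3
  swap
  · refine prob_le_one.trans ?_
    rw [ENNReal.one_le_ofReal]
    linarith
  by_cases hδ' : θ.δ' ≤ 1 / 3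
  swap
  · refine prob_le_one.trans ?_
    rw [ENNReal.one_le_ofReal]
    linarith
  have hn := hB.one_le_n0
  have hm := hB.one_le_m
  have hs := hB.σp_pos
  have hη := hB.η_pos
  have hd := hT.d_pos hB hC0 hδ
  have hY := one_le_log_div hm hδ0' hδ'
  have hXδ : 0 ≤ Real.log (1 / θ.δ) := by
    have := one_le_log_div le_rfl hδ0 hδ; linarith
  -- At this level the tail is of order (m/δ')^{-(κ+1)}: the exponent κ pays for the pool size and
  -- the remaining 1 for the neurons and for δ'.
  obtain ⟨l, hl⟩ : ∃ l, l = Real.sqrt (2 * (κ + 1) * Real.log (θ.m / θ.δ')) := ⟨_, rfl⟩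
  have hl0 : 0 ≤ l := hl ▸ Real.sqrt_nonneg _
  have b1 := (experimentLaw_train_le (N := θ.N) hp.le hp1
    {z | ¬TypicalTraining θ.μ z.2 z.1 (θ.σp ^ 2 * θ.d) (1 / 10000000 * a0)}).trans
    (trainLaw_not_typical_le hB hF hT hG hδ hδ' hK (by linarith) he0 he1 heK he4 hes)
  have b2 := experimentLaw_weak_samples (m := θ.m) (d := θ.d) (n := θ.n0) (N := θ.N)
    (σp := θ.σp) (σ0 := θ.σ0) hp.le hp1
  have b3 := experimentLaw_pool_noise (N := θ.N) (σ0 := θ.σ0) hp.le hp1 hs.le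
    (V := fun z => gdIter θ.μ θ.η z.2 z.1 (τ z))
    (fun j r => measurable_gdIter_stoppedAt θ.μ θ.η hτ j r) hl0
  have r2 : Real.exp (-(θ.p * θ.N / 8)) ≤ θ.δ := by
    have h1 := exp_neg_le_div (a := 1) (x := θ.p * θ.N / 8) one_pos hδ0 (by
      have h2 := mul_le_mul_of_nonneg_left hP.ge_log hp.le
      have h3 : θ.p * (C * (θ.p⁻¹ * Real.log (1 / θ.δ))) = C * Real.log (1 / θ.δ) := by
        field_simp
      rw [h3] at h2
      nlinarith)
    rwa [div_one] at h1
  have r3 : 2 * θ.m * θ.N * (2 * Real.exp (-(l ^ 2 / 2))) ≤ 4 * θ.δ' := by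
    have hq : 0 < θ.m / θ.δ' := by positivity
    have h1 : Real.exp (-(l ^ 2 / 2)) = ((θ.m / θ.δ') ^ κ)⁻¹ * (θ.m / θ.δ')⁻¹ := by
      rw [hl, Real.sq_sqrt (by positivity), ← Real.rpow_neg hq.le, ← Real.rpow_neg_one (_ / _),
        ← Real.rpow_add hq, Real.rpow_def_of_pos hq]
      congr 1
      ring
    have h2 : θ.N * ((θ.m / θ.δ') ^ κ)⁻¹ ≤ 1 := by
      rw [← div_eq_mul_inv, div_le_one (Real.rpow_pos_of_pos hq _)]
      exact hP.le_poly
    calc 2 * θ.m * θ.N * (2 * Real.exp (-(l ^ 2 / 2)))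
        = 4 * (θ.N * ((θ.m / θ.δ') ^ κ)⁻¹) * (θ.m * (θ.m / θ.δ')⁻¹) := by rw [h1]; ring
      _ ≤ 4 * 1 * (θ.m * (θ.m / θ.δ')⁻¹) := by gcongr
      _ = 4 * θ.δ' := by
        have : (θ.m : ℝ) ≠ 0 := by linarith
        field_simp
  have hsum : ENNReal.ofReal (27 * θ.δ) + (ENNReal.ofReal θ.δ + ENNReal.ofReal (4 * θ.δ')) ≤
      ENNReal.ofReal (C * (θ.δ + θ.δ')) := by
    rw [← ENNReal.ofReal_add (by positivity) (by positivity),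
      ← ENNReal.ofReal_add (by positivity) (by positivity)]
    exact ENNReal.ofReal_le_ofReal (by linarith)
  refine le_trans (measure_mono ?_) (((measure_union_le _ _).trans (add_le_add b1
    ((measure_union_le _ _).trans (add_le_add (b2.trans (ENNReal.ofReal_le_ofReal r2))
    (b3.trans (ENNReal.ofReal_le_ofReal r3)))))).trans hsum)
  intro ω hω
  by_contra hcon
  simp only [Set.mem_union, Set.mem_ofPred_eq, not_or, not_not, not_lt, not_exists] at hcon
  obtain ⟨H, hweak, hpool⟩ := hcon
  refine hω ?_
  -- The querying time makes ηDt/(n0 m) at least c, and `min_le_totalWeight` turns this into A ≥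
  -- min(1, c/20), hence A ≥ a0.
  have hA : a0 ≤ θ.η / (θ.n0 * θ.m : ℝ) * (θ.σp ^ 2 * θ.d) *
      (totalWeight θ.μ θ.η ω.1.2 ω.1.1 (τ ω.1) / θ.n0) := by
    refine le_trans ?_ (H.min_le_totalWeight hη.le (τ ω.1))
    refine le_min ha01 (ha0c.trans ?_)
    have h1 := hτb ω.1
    have h2 : c ≤ θ.η / (θ.n0 * θ.m : ℝ) * (θ.σp ^ 2 * θ.d) * τ ω.1 := by
      calc c = θ.η / (θ.n0 * θ.m : ℝ) * (θ.σp ^ 2 * θ.d) *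
            (c * (θ.n0 * θ.m / (θ.η * θ.σp ^ 2 * θ.d))) := by field_simp
        _ ≤ _ := by gcongr
    linarith
  refine H.queryingEvent hη.le θ.nstar ?_ hweak fun a j r => ?_
  · exact mul_le_mul_of_nonneg_left hA (by norm_num)
  · refine (hpool (a, j, r)).trans ?_
    rw [hl]
    refine (pool_noise_le hB hT hG hδ hδ' hκ ha0pos hA hC0 (by norm_num) hBC
      (H.norm_gdIter_le hη.le (τ ω.1) j r)).trans_eq ?_
    field_simp

end Params

end ActiveLearning

theorem mainTheorem2 (K κ c : ℝ) (hK : 0 < K) (hκ : 0 < κ) (hc : 0 < c) :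
    ∃ C : ℝ, 0 < C ∧
      ∀ θ : ActiveLearning.Params,
        θ.Basic → θ.FeatureNorms K C → θ.Training K C → θ.Pool κ C → θ.NormGap C →
        ∀ τ : ActiveLearning.TrainData θ.m θ.d θ.n0 → ℕ, Measurable τ →
          (∀ z, c * (θ.n0 * θ.m / (θ.η * θ.σp ^ 2 * θ.d)) ≤ (τ z : ℝ) ∧ (τ z : ℝ) ≤ θ.Tstar) →
          ActiveLearning.experimentLaw θ.m θ.d θ.n0 θ.N θ.p θ.σp θ.σ0
            {ω | ¬ ActiveLearning.QueryingEvent θ.μ θ.p θ.nstar ω.1.1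
                (ActiveLearning.gdIter θ.μ θ.η ω.1.2 ω.1.1 (τ ω.1)) ω.1.2 ω.2}
            ≤ ENNReal.ofReal (C * (θ.δ + θ.δ')) := by
  set a0 : ℝ := min 1 (c / 20)
  have ha0pos : 0 < a0 := lt_min one_pos (by positivity)
  have ha01 : a0 ≤ 1 := min_le_left _ _
  -- The factor a0 ≤ A makes e small relative to A, as `queryingEvent` requires.
  set e : ℝ := 1 / 10000000 * a0
  have he0 : 0 < e := by positivity
  set B : ℝ := (1 / a0 + 82) * Real.sqrt (2 * (κ + 1))
  have hB0 : 0 ≤ B := by positivity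
  -- Each summand serves one demand: the total failure probability, the square-root conditions on
  -- correlations, the weak-to-strong ratio, the pool noise, and the initialisation.
  set C : ℝ := 100 + (4 / e) ^ 2 + Real.sqrt K / e + 10000000 * B + 4 / e with hCdef
  have q1 : 0 ≤ (4 / e) ^ 2 := by positivity
  have q2 : 0 ≤ Real.sqrt K / e := by positivity
  have q3 : 0 ≤ 4 / e := by positivity
  have hC100 : 100 ≤ C := by linarith
  have hC0 : 0 < C := by linarith
  have heK : Real.sqrt K ≤ e * C := by
    rw [← div_le_iff₀' he0]; linarith
  have he4 : 4 ≤ e * C := by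
    rw [← div_le_iff₀' he0]; linarith
  have hes : 4 ≤ e * Real.sqrt C := by
    rw [← div_le_iff₀' he0]
    exact Real.le_sqrt_of_sq_le (by linarith)
  have hBC : B ≤ 1 / 10000000 * C := by linarith
  exact ⟨C, hC0, fun θ hB hF hT hP hG τ hτ hτb =>
    ActiveLearning.Params.experimentLaw_not_queryingEvent_le hB hF hT hP hG hK hκ ha0pos ha01
      (min_le_right _ _) hC100 heK he4 hes hBC hτ fun z => (hτb z).1⟩
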